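/- Let $\rho,\sigma$ be density matrices on $n$ qubits whose nonzero eigenvalues are all at least $\gamma\in(0,1)$, with $\operatorname{supp}\rho\subseteq\operatorname{supp}\sigma$ (equivalently $D(\rho\|\sigma)<\infty$), where $$D(\rho\|\sigma)=-\operatorname{tr}(\rho\ln\sigma)-S(\rho),\qquad S(\rho)=-\operatorname{tr}(\rho\ln\rho).$$ A purified query oracle for $\rho$ is a unitary $U_\rho$ on the $n$-qubit register $A$ and some register $B$ of qubits such that $|\Psi_\rho\rangle=U_\rho|0\rangle_A|0\rangle_B$ satisfies $\operatorname{tr}_B|\Psi_\rho\rangle\langle\Psi_\rho|=\rho$; similarly $U_\sigma$ for $\sigma$ (the auxiliary register may have another size). A query is one use of $U_\rho$, $U_\rho^\dagger$, $U_\sigma$ or $U_\sigma^\dagger$; a query circuit alternates queries with unitaries that do not depend on the oracles, on a memory with any number of further work qubits, started in $|0\cdots0\rangle$. Write $\log^+x=\max\{0,\log x\}$. For every failure probability $\delta\in(0,1)$ there is a constant $C$, depending only on $\delta$, such that for all $n$, all sizes of the two auxiliary registers, all $\gamma\in(0,1)$ and all $\varepsilon>0$: 1. there is an algorithm which makes finitely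 many independent runs of query circuits, measures a single qubit at the end of each run, and computes from the measured bits an estimate of $D(\rho\|\sigma)$, with at most $$C\,\frac{1}{\gamma\varepsilon^2}\,\log^2\!\Big(\frac1\gamma\Big)\,\log^+\!\Big(\frac{\log(1/\gamma)}{\varepsilon}\Big)$$ queries in total over all runs; 2. there is a general quantum query algorithm (a query circuit, measured in the computational basis at the end, as is used for amplitude estimation) which computes an estimate of $D(\rho\|\sigma)$, with at most $$C\,\frac{1}{\gamma\varepsilon}\,\log\!\Big(\frac1\gamma\Big)\,\log^+\!\Big(\frac{\log(1/\gamma)}{\varepsilon}\Big)$$ queries. In both cases the algorithm depends only on $\delta$, $n$, the register sizes, $\gamma$ and $\varepsilon$, and for all $\rho,\sigma$ as above and all purified query oracles $U_\rho,U_\sigma$ of them, the estimate differs from $D(\rho\|\sigma)$ by at most $\varepsilon$ with probability at least $1-\delta$. -/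

import Mathlib

open scoped Kronecker ComplexOrder

noncomputable section

namespace QEntropy

/-- Labels of the computational basis of a register of `n` qubits; `0` labels `|0…0⟩`. -/
abbrev Qubits (n : ℕ) : Type := Fin n → Fin 2

/-! ### States and relative entropy -/

/-- `ρ` is a density matrix. -/
def IsState {ι : Type} [Fintype ι] (ρ : Matrix ι ι ℂ) : Prop :=
  ρ.PosSemidef ∧ ρ.trace = 1

/-- All nonzero eigenvalues of the (Hermitian) matrix `ρ` are at least `γ`. -/
def EigenvaluesAtLeast {ι : Type} [Fintype ι] [DecidableEq ι] (ρ : Matrix ι ι ℂ) (γ : ℝ) : Prop :=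
  ∀ x ∈ spectrum ℝ ρ, x ≠ 0 → γ ≤ x

/-- The support of a Hermitian matrix: its range, i.e. the orthogonal complement of its kernel. -/
def supp {ι : Type} [Fintype ι] (ρ : Matrix ι ι ℂ) : Submodule ℂ (ι → ℂ) :=
  LinearMap.range ρ.mulVecLin

/-- The logarithm of a positive semidefinite matrix through its spectral decomposition. As
`Real.log 0 = 0`, it is the logarithm on the support and zero on the kernel, which implements the
usual convention `0 log 0 = 0` in the two traces below. -/
def matLog {ι : Type} [Fintype ι] [DecidableEq ι] (ρ : Matrix ι ι ℂ) : Matrix ι ι ℂ :=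
  cfc Real.log ρ

/-- The von Neumann entropy `S(ρ) = - tr (ρ ln ρ)`. -/
def entropy {ι : Type} [Fintype ι] [DecidableEq ι] (ρ : Matrix ι ι ℂ) : ℝ :=
  -((ρ * matLog ρ).trace).re

/-- The relative entropy `D(ρ‖σ) = - tr (ρ ln σ) - S(ρ)`, for `supp ρ ≤ supp σ` (otherwise the
relative entropy is infinite and this expression is not used). -/
def relEntropy {ι : Type} [Fintype ι] [DecidableEq ι] (ρ σ : Matrix ι ι ℂ) : ℝ :=
  -((ρ * matLog σ).trace).re - entropy ρ

/-! ### Purified query oracles -/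

/-- The partial trace over the second tensor factor. -/
def partialTraceB {ι κ : Type} [Fintype κ] (M : Matrix (ι × κ) (ι × κ) ℂ) : Matrix ι ι ℂ :=
  fun i j => ∑ k, M (i, k) (j, k)

/-- A unitary on registers `A` (`n` qubits) and `B` (`a` qubits). -/
abbrev Oracle (n a : ℕ) : Type := Matrix.unitaryGroup (Qubits n × Qubits a) ℂ

/-- `U` is a purified query oracle of `ρ`: the state `|Ψ⟩ = U |0⟩_A |0⟩_B` satisfies
`tr_B |Ψ⟩⟨Ψ| = ρ`. -/
def IsPurifiedOracle {n a : ℕ} (U : Oracle n a) (ρ : Matrix (Qubits n) (Qubits n) ℂ) : Prop :=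
  let Ψ : Qubits n × Qubits a → ℂ := U.1.mulVec (Pi.single 0 1)
  partialTraceB (Matrix.vecMulVec Ψ (star Ψ)) = ρ

/-! ### Quantum query circuits -/

/-- Basis labels of the memory of a circuit: the registers on which the oracle of `ρ` acts, those on
which the oracle of `σ` acts, and `w` work qubits. -/
abbrev Mem (n a b w : ℕ) : Type :=
  (Qubits n × Qubits a) × (Qubits n × Qubits b) × Qubits w

/-- The four kinds of query: either oracle or the inverse of either oracle. -/
inductive Query where
  | rho
  | rhoInv
  | sigma
  | sigmaInv

/-- The unitary on the memory that a query performs. -/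
def Query.gate {n a b w : ℕ} (Uρ : Oracle n a) (Uσ : Oracle n b) :
    Query → Matrix (Mem n a b w) (Mem n a b w) ℂ
  | .rho => Uρ.1 ⊗ₖ (1 : Matrix _ _ ℂ)
  | .rhoInv => Uρ.1.conjTranspose ⊗ₖ (1 : Matrix _ _ ℂ)
  | .sigma => (1 : Matrix _ _ ℂ) ⊗ₖ (Uσ.1 ⊗ₖ (1 : Matrix _ _ ℂ))
  | .sigmaInv => (1 : Matrix _ _ ℂ) ⊗ₖ (Uσ.1.conjTranspose ⊗ₖ (1 : Matrix _ _ ℂ))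

/-- A quantum query circuit: an initial unitary, then a list of steps, each of which makes one query
and then applies a unitary. The unitaries and the kinds of query do not depend on the oracles. -/
structure QueryCircuit (n a b : ℕ) where
  /-- The number of work qubits. -/
  width : ℕ
  /-- The unitary applied to `|0…0⟩` before the first query. -/
  init : Matrix.unitaryGroup (Mem n a b width) ℂ
  /-- The queries, each with the unitary that follows it, in the order in which they are applied. -/
  steps : List (Query × Matrix.unitaryGroup (Mem n a b width) ℂ)

namespace QueryCircuit

variable {n a b : ℕ}

/-- The number of queries to the two oracles and their inverses. -/
def queries (c : QueryCircuit n a b) : ℕ := c.steps.length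

/-- The state of the memory at the end of the circuit, started in `|0…0⟩`. -/
def finalState (c : QueryCircuit n a b) (Uρ : Oracle n a) (Uσ : Oracle n b) :
    Mem n a b c.width → ℂ :=
  c.steps.foldl
    (fun ψ s => s.2.1.mulVec ((s.1.gate Uρ Uσ).mulVec ψ))
    (c.init.1.mulVec (Pi.single 0 1))

/-- The probability of the outcome `x` when the whole memory is measured in the computational basis
at the end. -/
def outcomeProb (c : QueryCircuit n a b) (Uρ : Oracle n a) (Uσ : Oracle n b)
    (x : Mem n a b c.width) : ℝ :=
  ‖c.finalState Uρ Uσ x‖ ^ 2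

/-- The probability of the outcome `v` when only the work qubit `q` is measured at the end. -/
def qubitProb (c : QueryCircuit n a b) (Uρ : Oracle n a) (Uσ : Oracle n b)
    (q : Fin c.width) (v : Fin 2) : ℝ :=
  ∑ x : Mem n a b c.width, if x.2.2 q = v then c.outcomeProb Uρ Uσ x else 0

end QueryCircuit

/-- An algorithm by repeated single-qubit measurements: finitely many independent runs of query
circuits, a single qubit measured in each run, and an estimate computed from the measured bits. -/
structure SamplingAlgorithm (n a b : ℕ) where
  /-- The number of runs. -/
  runs : ℕ
  /-- The circuit of each run. -/
  circuit : Fin runs → QueryCircuit n a b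
  /-- The qubit measured in each run. -/
  qubit : (j : Fin runs) → Fin (circuit j).width
  /-- The estimate returned. -/
  estimate : (Fin runs → Fin 2) → ℝ

namespace SamplingAlgorithm

variable {n a b : ℕ}

/-- The total number of queries over all runs. -/
def queries (alg : SamplingAlgorithm n a b) : ℕ := ∑ j, (alg.circuit j).queries

/-- The probability that the estimate is within `ε` of `D`. -/
def successProb (alg : SamplingAlgorithm n a b) (Uρ : Oracle n a) (Uσ : Oracle n b)
    (D ε : ℝ) : ℝ :=
  ∑ o : Fin alg.runs → Fin 2,
    if |alg.estimate o - D| ≤ ε then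
      ∏ j, (alg.circuit j).qubitProb Uρ Uσ (alg.qubit j) (o j)
    else 0

end SamplingAlgorithm

/-- A general quantum query algorithm: a query circuit, a measurement of the whole memory at the end,
and an estimate computed from the outcome (intermediate measurements can be deferred to the end). -/
structure QueryAlgorithm (n a b : ℕ) where
  /-- The circuit. -/
  circuit : QueryCircuit n a b
  /-- The estimate returned. -/
  estimate : Mem n a b circuit.width → ℝ

namespace QueryAlgorithm

variable {n a b : ℕ}

/-- The number of queries. -/
def queries (alg : QueryAlgorithm n a b) : ℕ := alg.circuit.queries

/-- The probability that the estimate is within `ε` of `D`. -/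
def successProb (alg : QueryAlgorithm n a b) (Uρ : Oracle n a) (Uσ : Oracle n b)
    (D ε : ℝ) : ℝ :=
  ∑ x : Mem n a b alg.circuit.width,
    if |alg.estimate x - D| ≤ ε then alg.circuit.outcomeProb Uρ Uσ x else 0

end QueryAlgorithm

/-- The pairs of states of the problem, with purified query oracles: `ρ` and `σ` have their nonzero
eigenvalues at least `γ`, and the support of `ρ` lies in the support of `σ`. -/
def ValidInput {n a b : ℕ} (γ : ℝ) (ρ σ : Matrix (Qubits n) (Qubits n) ℂ)
    (Uρ : Oracle n a) (Uσ : Oracle n b) : Prop :=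
  IsState ρ ∧ IsState σ ∧ EigenvaluesAtLeast ρ γ ∧ EigenvaluesAtLeast σ γ ∧
    supp ρ ≤ supp σ ∧ IsPurifiedOracle Uρ ρ ∧ IsPurifiedOracle Uσ σ

end QEntropy

end

noncomputable section

namespace QEntropy

open Matrix

/-! ### Families of operators made with queries -/

/-! Write D(ρ‖σ) = tr(ρ ln ρ) − tr(ρ ln σ) and expand −2 ln x = Σ_{k≥1} (1 − x²)^k / k. On
eigenvalues x ≥ γ the terms from K on sum to at most exp(−γ²K) once γ²K ≥ 1
(`abs_two_log_add_sum_le`), so it suffices to estimate weighted sums of tr((1 − τ²)^k ρ), for τ = σ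
and τ = ρ, up to K of order s²/γ².

A purified oracle U of τ block-encodes τ: the block of U† SWAP U at |0⟩ is τ. Multiplied by the
reflection about |0⟩ it becomes a walk operator W for which W + W† acts as 2τ on the vectors |0⟩ ⊗
v, so that E = (2 − W² − W†²)/4 acts there as 1 − τ² (`star_inject_dotProduct_walk`). The binomial
expansion of E^k consists of signed powers W^{2(j−k)} weighted by a symmetric binomial distribution,
which is concentrated on |j − k| of order √k (`re_pow_eq_sum_binomWeight`,
`sum_binomWeight_tail_le`). Hence about s√k steps of the walk replace k of them, with error of order
exp(−s²), and the degree needed is s²/γ instead of s²/γ². A Hadamard test with a random power of W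
turns a whole block of the series into the bias of one qubit (`QubitTest.of_walk`). Queries come
without control, but W is oracle-free up to a conjugation, and only the middle factor of a
conjugation needs the control (`Ctrl.conj`).

The block 4^i ≤ k < 4^(i+1) has weight at most 3 and a test of cost about s·2^i. Giving it effort
proportional to (3/2)^(I−i) makes both the costs and the errors geometric sums, so the number of
blocks costs no extra factor. Averaging measured bits yields 1/ε²; amplitude estimation
(`CircuitEst.of_test`) yields 1/ε. Chebyshev's inequality turns mean square errors into success
probability.

With L = ln(1/γ), s² is of order ln(L/ε), which is the logarithmic factor. The powers of L in the
stated bounds serve only to absorb constants and rounding. When γ > 1/2 or L ≤ 2ε, the value of D is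
known in advance to precision ε and no query is made. -/

/-- The operator family `F`, indexed by the two oracles, is a product of oracle-independent
unitaries and `k` queries, each acting on some tensor factor of the space with basis `Y`. -/
inductive Impl (n a b : ℕ) {Y : Type} [Fintype Y] [DecidableEq Y] :
    ℕ → (Oracle n a → Oracle n b → Matrix Y Y ℂ) → Prop
  | free (V : Matrix.unitaryGroup Y ℂ) : Impl n a b 0 (fun _ _ => V.1)
  | rho {Z : Type} [Fintype Z] [DecidableEq Z] (e : (Qubits n × Qubits a) × Z ≃ Y) :
      Impl n a b 1 (fun Uρ _ => Matrix.reindex e e (Uρ.1 ⊗ₖ (1 : Matrix Z Z ℂ)))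
  | sigma {Z : Type} [Fintype Z] [DecidableEq Z] (e : (Qubits n × Qubits b) × Z ≃ Y) :
      Impl n a b 1 (fun _ Uσ => Matrix.reindex e e (Uσ.1 ⊗ₖ (1 : Matrix Z Z ℂ)))
  | mul {k l : ℕ} {F G : Oracle n a → Oracle n b → Matrix Y Y ℂ} :
      Impl n a b k F → Impl n a b l G → Impl n a b (k + l) (fun Uρ Uσ => F Uρ Uσ * G Uρ Uσ)
  | adj {k : ℕ} {F : Oracle n a → Oracle n b → Matrix Y Y ℂ} :
      Impl n a b k F → Impl n a b k (fun Uρ Uσ => (F Uρ Uσ)ᴴ)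

/-! ### Unitary matrices under tensoring, block sums and permutations -/

section Unitary

variable {Y Z : Type} [Fintype Y] [DecidableEq Y] [Fintype Z] [DecidableEq Z]

theorem reindex_mem_unitaryGroup (e : Y ≃ Z) {M : Matrix Y Y ℂ}
    (h : M ∈ Matrix.unitaryGroup Y ℂ) : Matrix.reindex e e M ∈ Matrix.unitaryGroup Z ℂ := by
  rw [Matrix.mem_unitaryGroup_iff] at h ⊢
  rw [star_eq_conjTranspose, conjTranspose_reindex, ← Matrix.star_eq_conjTranspose,
    reindex_apply, reindex_apply, submatrix_mul_equiv, h, submatrix_one_equiv]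

theorem kronecker_one_mem_unitaryGroup {M : Matrix Y Y ℂ} (h : M ∈ Matrix.unitaryGroup Y ℂ) :
    M ⊗ₖ (1 : Matrix Z Z ℂ) ∈ Matrix.unitaryGroup (Y × Z) ℂ :=
  Matrix.kronecker_mem_unitary h (one_mem _)

theorem conjTranspose_mem_unitaryGroup {M : Matrix Y Y ℂ} (h : M ∈ Matrix.unitaryGroup Y ℂ) :
    Mᴴ ∈ Matrix.unitaryGroup Y ℂ :=
  Unitary.star_mem h

theorem blockDiagonal_mem_unitaryGroup {M : Z → Matrix Y Y ℂ}
    (h : ∀ z, M z ∈ Matrix.unitaryGroup Y ℂ) :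
    blockDiagonal M ∈ Matrix.unitaryGroup (Y × Z) ℂ := by
  rw [Matrix.mem_unitaryGroup_iff, star_eq_conjTranspose, blockDiagonal_conjTranspose,
    ← blockDiagonal_mul, ← blockDiagonal_one]
  congr 1
  funext z
  exact Matrix.mem_unitaryGroup_iff.1 (h z)

theorem permMatrix_mem_unitaryGroup (π : Equiv.Perm Y) :
    π.permMatrix ℂ ∈ Matrix.unitaryGroup Y ℂ := by
  rw [Matrix.mem_unitaryGroup_iff, star_eq_conjTranspose, conjTranspose_permMatrix,
    ← Matrix.permMatrix_mul]
  simp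

theorem permMatrix_mul_mul_conjTranspose (π : Equiv.Perm Y) (M : Matrix Y Y ℂ) :
    π.permMatrix ℂ * M * (π.permMatrix ℂ)ᴴ = M.submatrix π π := by
  rw [conjTranspose_permMatrix, Equiv.Perm.permMatrix, Equiv.Perm.permMatrix,
    PEquiv.toMatrix_toPEquiv_mul, PEquiv.mul_toMatrix_toPEquiv]
  rfl

end Unitary

namespace Impl

variable {n a b : ℕ} {Y Z : Type} [Fintype Y] [DecidableEq Y] [Fintype Z] [DecidableEq Z]
  {k l : ℕ} {F G : Oracle n a → Oracle n b → Matrix Y Y ℂ}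

theorem congr (h : Impl n a b k F) (hFG : ∀ Uρ Uσ, F Uρ Uσ = G Uρ Uσ) : Impl n a b k G := by
  have : F = G := by funext x y; exact hFG x y
  exact this ▸ h

theorem cast (h : Impl n a b k F) (hkl : k = l) : Impl n a b l F := hkl ▸ h

theorem free' (V : Matrix Y Y ℂ) (hV : V ∈ Matrix.unitaryGroup Y ℂ) :
    Impl n a b 0 (fun _ _ => V) := free ⟨V, hV⟩

theorem mem_unitaryGroup (h : Impl n a b k F) (Uρ : Oracle n a) (Uσ : Oracle n b) :
    F Uρ Uσ ∈ Matrix.unitaryGroup Y ℂ := by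
  induction h with
  | free V => exact V.2
  | rho e => exact reindex_mem_unitaryGroup e (kronecker_one_mem_unitaryGroup Uρ.2)
  | sigma e => exact reindex_mem_unitaryGroup e (kronecker_one_mem_unitaryGroup Uσ.2)
  | mul _ _ h1 h2 => exact mul_mem h1 h2
  | adj _ h1 => exact conjTranspose_mem_unitaryGroup h1

theorem reindex (h : Impl n a b k F) (e : Y ≃ Z) :
    Impl n a b k (fun Uρ Uσ => Matrix.reindex e e (F Uρ Uσ)) := by
  induction h with
  | free V => exact free' _ (reindex_mem_unitaryGroup e V.2)
  | rho e' => exact (rho (e'.trans e)).congr fun _ _ => by ext; simp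
  | sigma e' => exact (sigma (e'.trans e)).congr fun _ _ => by ext; simp
  | mul _ _ h1 h2 => exact (mul h1 h2).congr fun _ _ => by simp [submatrix_mul_equiv]
  | adj _ h1 => exact (adj h1).congr fun _ _ => by simp

/-- A query may leave any tensor factor idle, so an additional register is absorbed into the idle
factor of each query. -/
theorem kron_one (h : Impl n a b k F) (Z : Type) [Fintype Z] [DecidableEq Z] :
    Impl n a b k (fun Uρ Uσ => F Uρ Uσ ⊗ₖ (1 : Matrix Z Z ℂ)) := by
  induction h with
  | free V => exact free' _ (kronecker_one_mem_unitaryGroup V.2)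
  | rho e' =>
    refine (rho ((Equiv.prodAssoc _ _ _).symm.trans (Equiv.prodCongr e' (Equiv.refl Z)))).congr
      fun _ _ => ?_
    ext ⟨i, i'⟩ ⟨j, j'⟩
    simp [Matrix.one_apply, Prod.ext_iff, ite_and]
    split_ifs <;> rfl
  | sigma e' =>
    refine (sigma ((Equiv.prodAssoc _ _ _).symm.trans (Equiv.prodCongr e' (Equiv.refl Z)))).congr
      fun _ _ => ?_
    ext ⟨i, i'⟩ ⟨j, j'⟩
    simp [Matrix.one_apply, Prod.ext_iff, ite_and]
    split_ifs <;> rfl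
  | mul _ _ h1 h2 =>
    exact (mul h1 h2).congr fun _ _ => by rw [← mul_kronecker_mul, one_mul]
  | adj _ h1 =>
    exact (adj h1).congr fun _ _ => by rw [conjTranspose_kronecker, conjTranspose_one]

theorem one_kron (h : Impl n a b k F) (Z : Type) [Fintype Z] [DecidableEq Z] :
    Impl n a b k (fun Uρ Uσ => (1 : Matrix Z Z ℂ) ⊗ₖ F Uρ Uσ) := by
  refine ((h.kron_one Z).reindex (Equiv.prodComm _ _)).congr fun _ _ => ?_
  ext ⟨i, i'⟩ ⟨j, j'⟩
  simp [mul_comm]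

end Impl

/-! ### Controlled operators -/

/-- `F` can be applied under the control of any predicate on a further register, with `k`
queries. -/
def Ctrl (n a b : ℕ) {Y : Type} [Fintype Y] [DecidableEq Y] (k : ℕ)
    (F : Oracle n a → Oracle n b → Matrix Y Y ℂ) : Prop :=
  ∀ (Z : Type) [Fintype Z] [DecidableEq Z] (P : Z → Prop) [DecidablePred P],
    Impl n a b k (fun Uρ Uσ => blockDiagonal fun z => if P z then F Uρ Uσ else 1)

namespace Ctrl

variable {n a b : ℕ} {Y : Type} [Fintype Y] [DecidableEq Y]
  {k l : ℕ} {F G : Oracle n a → Oracle n b → Matrix Y Y ℂ}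

theorem free (V : Matrix Y Y ℂ) (hV : V ∈ Matrix.unitaryGroup Y ℂ) :
    Ctrl n a b 0 (fun _ _ => V) := fun Z _ _ P _ =>
  Impl.free' _ (blockDiagonal_mem_unitaryGroup fun z => by
    split_ifs
    exacts [hV, one_mem _])

theorem mul (hF : Ctrl n a b k F) (hG : Ctrl n a b l G) :
    Ctrl n a b (k + l) (fun Uρ Uσ => F Uρ Uσ * G Uρ Uσ) := fun Z _ _ P _ => by
  refine ((hF Z P).mul (hG Z P)).congr fun _ _ => ?_
  rw [← blockDiagonal_mul]
  congr 1
  funext z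
  split_ifs <;> simp

/-- Only the middle factor of `F G F†` has to be controlled. -/
theorem conj (hF : Impl n a b k F) (hG : Ctrl n a b l G) :
    Ctrl n a b (k + l + k) (fun Uρ Uσ => F Uρ Uσ * G Uρ Uσ * (F Uρ Uσ)ᴴ) := fun Z _ _ P _ => by
  refine (((hF.kron_one Z).mul (hG Z P)).mul (hF.adj.kron_one Z)).congr fun Uρ Uσ => ?_
  rw [kronecker_one, kronecker_one, ← blockDiagonal_mul, ← blockDiagonal_mul]
  congr 1
  funext z
  split_ifs
  · rfl
  · rw [mul_one]
    exact Matrix.mem_unitaryGroup_iff.1 (hF.mem_unitaryGroup Uρ Uσ)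

/-- Round N applies F exactly on the branches whose exponent exceeds N. Thus all branches share N
controlled uses, however many values the control register has. -/
theorem pow (hF : Ctrl n a b k F) {Z : Type} [Fintype Z] [DecidableEq Z] (p : Z → ℕ) (N : ℕ) :
    Impl n a b (N * k) (fun Uρ Uσ => blockDiagonal fun z => F Uρ Uσ ^ min (p z) N) := by
  induction N with
  | zero =>
    refine ((Impl.free' (n := n) (a := a) (b := b) (1 : Matrix (Y × Z) (Y × Z) ℂ)
      (one_mem _)).congr fun Uρ Uσ => ?_).cast (by simp)
    rw [← blockDiagonal_one]
    congr 1
    funext z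
    simp
  | succ N ih =>
    refine (((hF Z (fun z => N < p z)).mul ih).congr fun Uρ Uσ => ?_).cast (by ring)
    rw [← blockDiagonal_mul]
    congr 1
    funext z
    split_ifs with h
    · rw [← pow_succ', min_eq_right h.le, min_eq_right (Nat.succ_le_of_lt h)]
    · rw [one_mul, min_eq_left (not_lt.1 h), min_eq_left (by omega)]

end Ctrl

/-! ### From operator families to query circuits -/

section Compile

variable {n a b w : ℕ}

/-- The family `F` of operators on the memory can be applied at the end of any circuit by means of
`k` further queries. -/
def Appends (n a b w k : ℕ)
    (F : Oracle n a → Oracle n b → Matrix (Mem n a b w) (Mem n a b w) ℂ) : Prop :=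
  ∀ (V : Matrix.unitaryGroup (Mem n a b w) ℂ)
    (l : List (Query × Matrix.unitaryGroup (Mem n a b w) ℂ)),
    ∃ (V' : Matrix.unitaryGroup (Mem n a b w) ℂ)
      (l' : List (Query × Matrix.unitaryGroup (Mem n a b w) ℂ)),
      l'.length = l.length + k ∧ ∀ Uρ Uσ,
        (QueryCircuit.mk w V' l').finalState Uρ Uσ =
          F Uρ Uσ *ᵥ (QueryCircuit.mk w V l).finalState Uρ Uσ

namespace Appends

variable {k m : ℕ} {F G : Oracle n a → Oracle n b → Matrix (Mem n a b w) (Mem n a b w) ℂ}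

theorem congr (h : Appends n a b w k F) (hFG : ∀ Uρ Uσ, F Uρ Uσ = G Uρ Uσ) :
    Appends n a b w k G := by
  have : F = G := by funext x y; exact hFG x y
  exact this ▸ h

/-- The unitary is merged into the one following the last query, or into the initial unitary if
there is no query yet; a circuit has no other place for it. -/
theorem free (U : Matrix (Mem n a b w) (Mem n a b w) ℂ)
    (hU : U ∈ Matrix.unitaryGroup (Mem n a b w) ℂ) : Appends n a b w 0 (fun _ _ => U) := by
  intro V l
  rcases List.eq_nil_or_concat l with rfl | ⟨l, ⟨q, V'⟩, rfl⟩
  · refine ⟨⟨U, hU⟩ * V, [], by simp, fun Uρ Uσ => ?_⟩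
    simp only [QueryCircuit.finalState, List.foldl_nil, mulVec_mulVec]
    rfl
  · refine ⟨V, l ++ [(q, ⟨U, hU⟩ * V')], by simp, fun Uρ Uσ => ?_⟩
    simp [QueryCircuit.finalState, Matrix.mul_assoc]

theorem query (q : Query) : Appends n a b w 1 (fun Uρ Uσ => q.gate Uρ Uσ) := fun V l =>
  ⟨V, l ++ [(q, 1)], by simp, fun Uρ Uσ => by simp [QueryCircuit.finalState]⟩

theorem mul (hF : Appends n a b w k F) (hG : Appends n a b w m G) :
    Appends n a b w (k + m) (fun Uρ Uσ => F Uρ Uσ * G Uρ Uσ) := by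
  intro V l
  obtain ⟨V', l', h', H'⟩ := hG V l
  obtain ⟨V'', l'', h'', H''⟩ := hF V' l'
  refine ⟨V'', l'', by omega, fun Uρ Uσ => ?_⟩
  rw [H'', H', mulVec_mulVec]

/-- Permutations of the basis are oracle-free, so conjugating by them is free of queries. -/
theorem conj (h : Appends n a b w k F) (π : Equiv.Perm (Mem n a b w)) :
    Appends n a b w k (fun Uρ Uσ => (F Uρ Uσ).submatrix π π) := by
  intro V l
  obtain ⟨V', l', h', H'⟩ := ((((free _ (permMatrix_mem_unitaryGroup π)).mul h).mul
    (free _ (conjTranspose_mem_unitaryGroup (permMatrix_mem_unitaryGroup π)))).congr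
    fun Uρ Uσ => permMatrix_mul_mul_conjTranspose π (F Uρ Uσ)) V l
  exact ⟨V', l', by omega, H'⟩

end Appends

variable {Z : Type} [DecidableEq Z]

/-- Exchange the first query register with the tensor factor of the work space selected by `e`. -/
def swapRho (e : (Qubits n × Qubits a) × Z ≃ Qubits w) : Equiv.Perm (Mem n a b w) where
  toFun x := ((e.symm x.2.2).1, x.2.1, e (x.1, (e.symm x.2.2).2))
  invFun x := ((e.symm x.2.2).1, x.2.1, e (x.1, (e.symm x.2.2).2))
  left_inv x := by simp
  right_inv x := by simp

/-- Exchange the second query register with the tensor factor of the work space selected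
by `e`. -/
def swapSigma (e : (Qubits n × Qubits b) × Z ≃ Qubits w) : Equiv.Perm (Mem n a b w) where
  toFun x := (x.1, (e.symm x.2.2).1, e (x.2.1, (e.symm x.2.2).2))
  invFun x := (x.1, (e.symm x.2.2).1, e (x.2.1, (e.symm x.2.2).2))
  left_inv x := by simp
  right_inv x := by simp

/-- An operator on the work qubits, as an operator on the memory. -/
def onWork (n a b : ℕ) {w : ℕ} (M : Matrix (Qubits w) (Qubits w) ℂ) :
    Matrix (Mem n a b w) (Mem n a b w) ℂ :=
  (1 : Matrix (Qubits n × Qubits a) (Qubits n × Qubits a) ℂ) ⊗ₖ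
    ((1 : Matrix (Qubits n × Qubits b) (Qubits n × Qubits b) ℂ) ⊗ₖ M)

theorem onWork_mem_unitaryGroup {M : Matrix (Qubits w) (Qubits w) ℂ}
    (h : M ∈ Matrix.unitaryGroup (Qubits w) ℂ) :
    onWork n a b M ∈ Matrix.unitaryGroup (Mem n a b w) ℂ :=
  Matrix.kronecker_mem_unitary (one_mem _) (Matrix.kronecker_mem_unitary (one_mem _) h)

theorem onWork_mul (M N : Matrix (Qubits w) (Qubits w) ℂ) :
    onWork n a b (M * N) = onWork n a b M * onWork n a b N := by
  simp [onWork, ← mul_kronecker_mul]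

/-- Exchanging the query register with a factor of the work space, querying and exchanging back acts
on the work space alone; the content of the query register is restored. -/
theorem kronecker_submatrix_swapRho (e : (Qubits n × Qubits a) × Z ≃ Qubits w)
    (U : Matrix (Qubits n × Qubits a) (Qubits n × Qubits a) ℂ) :
    (U ⊗ₖ (1 : Matrix ((Qubits n × Qubits b) × Qubits w) _ ℂ)).submatrix (swapRho e) (swapRho e) =
      onWork n a b (Matrix.reindex e e (U ⊗ₖ (1 : Matrix Z Z ℂ))) := by
  ext ⟨r, s, x⟩ ⟨r', s', x'⟩
  obtain ⟨⟨q, z⟩, rfl⟩ := e.surjective x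
  obtain ⟨⟨q', z'⟩, rfl⟩ := e.surjective x'
  simp only [submatrix_apply, kronecker_apply, onWork, Matrix.reindex_apply, swapRho,
    Equiv.coe_fn_mk, Equiv.symm_apply_apply, Matrix.one_apply, Prod.mk.injEq,
    EmbeddingLike.apply_eq_iff_eq]
  by_cases h1 : r = r' <;> by_cases h2 : s = s' <;> by_cases h3 : z = z' <;> simp [h1, h2, h3]

theorem kronecker_submatrix_swapSigma (e : (Qubits n × Qubits b) × Z ≃ Qubits w)
    (U : Matrix (Qubits n × Qubits b) (Qubits n × Qubits b) ℂ) :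
    ((1 : Matrix (Qubits n × Qubits a) _ ℂ) ⊗ₖ (U ⊗ₖ (1 : Matrix (Qubits w) _ ℂ))).submatrix
        (swapSigma e) (swapSigma e) =
      onWork n a b (Matrix.reindex e e (U ⊗ₖ (1 : Matrix Z Z ℂ))) := by
  ext ⟨r, s, x⟩ ⟨r', s', x'⟩
  obtain ⟨⟨q, z⟩, rfl⟩ := e.surjective x
  obtain ⟨⟨q', z'⟩, rfl⟩ := e.surjective x'
  simp only [submatrix_apply, kronecker_apply, onWork, Matrix.reindex_apply, swapSigma,
    Equiv.coe_fn_mk, Equiv.symm_apply_apply, Matrix.one_apply, Prod.mk.injEq,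
    EmbeddingLike.apply_eq_iff_eq]
  by_cases h1 : r = r' <;> by_cases h2 : s = s' <;> by_cases h3 : z = z' <;> simp [h1, h2, h3]

/-- The adjoint is carried through the induction because `Impl` is closed under adjoints; on
generators it amounts to the inverse query. -/
theorem Impl.appends {k : ℕ} {F : Oracle n a → Oracle n b → Matrix (Qubits w) (Qubits w) ℂ}
    (h : Impl n a b k F) :
    Appends n a b w k (fun Uρ Uσ => onWork n a b (F Uρ Uσ)) ∧
      Appends n a b w k (fun Uρ Uσ => onWork n a b (F Uρ Uσ)ᴴ) := by
  induction h with
  | free V =>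
    exact ⟨.free _ (onWork_mem_unitaryGroup V.2),
      .free _ (onWork_mem_unitaryGroup (conjTranspose_mem_unitaryGroup V.2))⟩
  | rho e =>
    constructor
    · exact ((Appends.query .rho).conj (swapRho e)).congr fun Uρ Uσ =>
        kronecker_submatrix_swapRho e _
    · refine ((Appends.query .rhoInv).conj (swapRho e)).congr fun Uρ Uσ =>
        (kronecker_submatrix_swapRho e _).trans ?_
      rw [conjTranspose_reindex, conjTranspose_kronecker, conjTranspose_one]
  | sigma e =>
    constructor
    · exact ((Appends.query .sigma).conj (swapSigma e)).congr fun Uρ Uσ =>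
        kronecker_submatrix_swapSigma e _
    · refine ((Appends.query .sigmaInv).conj (swapSigma e)).congr fun Uρ Uσ =>
        (kronecker_submatrix_swapSigma e _).trans ?_
      rw [conjTranspose_reindex, conjTranspose_kronecker, conjTranspose_one]
  | @mul k l F G _ _ h1 h2 =>
    constructor
    · exact (h1.1.mul h2.1).congr fun _ _ => (onWork_mul _ _).symm
    · refine add_comm l k ▸ (h2.2.mul h1.2).congr fun _ _ => ?_
      rw [conjTranspose_mul, onWork_mul]
  | adj _ h1 => exact ⟨h1.2, h1.1.congr fun _ _ => by rw [conjTranspose_conjTranspose]⟩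

theorem onWork_mulVec_single (M : Matrix (Qubits w) (Qubits w) ℂ) (x : Mem n a b w) :
    (onWork n a b M *ᵥ Pi.single 0 1) x =
      if x.1 = 0 ∧ x.2.1 = 0 then (M *ᵥ Pi.single 0 1) x.2.2 else 0 := by
  obtain ⟨r, s, x⟩ := x
  simp only [mulVec_single_one, col_apply, onWork]
  change (1 : Matrix _ _ ℂ) r 0 * ((1 : Matrix _ _ ℂ) s 0 * M x 0) = _
  simp only [Matrix.one_apply]
  by_cases h1 : r = 0 <;> by_cases h2 : s = 0 <;> simp [h1, h2]

/-- Every family of operators on the work qubits is performed by a circuit. -/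
theorem Impl.exists_circuit {k : ℕ}
    {F : Oracle n a → Oracle n b → Matrix (Qubits w) (Qubits w) ℂ} (h : Impl n a b k F) :
    ∃ (V : Matrix.unitaryGroup (Mem n a b w) ℂ)
      (l : List (Query × Matrix.unitaryGroup (Mem n a b w) ℂ)), l.length = k ∧
      ∀ Uρ Uσ x, (QueryCircuit.mk w V l).outcomeProb Uρ Uσ x =
        if x.1 = 0 ∧ x.2.1 = 0 then ‖(F Uρ Uσ *ᵥ Pi.single 0 1) x.2.2‖ ^ 2 else 0 := by
  obtain ⟨V, l, hl, H⟩ := h.appends.1 1 []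
  refine ⟨V, l, by simpa using hl, fun Uρ Uσ x => ?_⟩
  rw [QueryCircuit.outcomeProb, H]
  simp only [QueryCircuit.finalState, List.foldl_nil, OneMemClass.coe_one, one_mulVec]
  rw [onWork_mulVec_single]
  split_ifs <;> simp

/-- The sum of a quantity over the outcomes of such a circuit. -/
theorem sum_ite_outcome (g : Qubits w → ℝ) :
    ∑ x : Mem n a b w, (if x.1 = 0 ∧ x.2.1 = 0 then g x.2.2 else 0) = ∑ y, g y := by
  rw [Fintype.sum_prod_type, Fintype.sum_eq_single 0 fun r hr => by simp [hr],
    Fintype.sum_prod_type, Fintype.sum_eq_single 0 fun s hs => by simp [hs]]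
  simp

end Compile

/-! ### Estimators with a bound on the mean square error -/

section Probability

/-- Chebyshev's inequality for an estimate of bounded bias. -/
theorem one_sub_le_sum_of_sq_error {ι : Type*} [Fintype ι] {p g : ι → ℝ} (hp : ∀ i, 0 ≤ p i)
    (h1 : ∑ i, p i = 1) {v D ε δ : ℝ} (hε : 0 < ε)
    (h : ∑ i, p i * (g i - v) ^ 2 ≤ δ * ε ^ 2 / 4) (hv : |v - D| ≤ ε / 2) :
    1 - δ ≤ ∑ i, if |g i - D| ≤ ε then p i else 0 := by
  have key : ∀ i, p i - 4 / ε ^ 2 * (p i * (g i - v) ^ 2) ≤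
      if |g i - D| ≤ ε then p i else 0 := by
    intro i
    have h0 : 0 ≤ 4 / ε ^ 2 * (p i * (g i - v) ^ 2) :=
      mul_nonneg (by positivity) (mul_nonneg (hp i) (sq_nonneg _))
    split_ifs with hi
    · linarith
    · have h2 : ε / 2 ≤ |g i - v| := by
        have := abs_sub_le (g i) v D
        linarith [not_le.1 hi]
      have h3 : (ε / 2) ^ 2 ≤ (g i - v) ^ 2 := by
        rw [← sq_abs (g i - v)]
        gcongr
      have h4 : p i = 4 / ε ^ 2 * (p i * (ε / 2) ^ 2) := by
        field_simp
        norm_num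
      have h5 : 4 / ε ^ 2 * (p i * (ε / 2) ^ 2) ≤ 4 / ε ^ 2 * (p i * (g i - v) ^ 2) := by
        have := hp i
        gcongr
      linarith
  have h5 := Finset.sum_le_sum fun i (_ : i ∈ Finset.univ) => key i
  rw [Finset.sum_sub_distrib, ← Finset.mul_sum, h1] at h5
  have h6 : 4 / ε ^ 2 * ∑ i, p i * (g i - v) ^ 2 ≤ 4 / ε ^ 2 * (δ * ε ^ 2 / 4) := by gcongr
  have h7 : 4 / ε ^ 2 * (δ * ε ^ 2 / 4) = δ := by field_simp
  linarith

/-- The second moment of a sum of independent centered random variables. -/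
theorem sum_prod_mul_sum_sq {ι : Type*} [Fintype ι] [DecidableEq ι] {κ : Type*} [Fintype κ]
    {p g : ι → κ → ℝ} (h1 : ∀ i, ∑ x, p i x = 1) (h0 : ∀ i, ∑ x, p i x * g i x = 0) :
    ∑ o : ι → κ, (∏ i, p i (o i)) * (∑ i, g i (o i)) ^ 2 = ∑ i, ∑ x, p i x * g i x ^ 2 := by
  have key : ∀ i j, ∑ o : ι → κ, (∏ k, p k (o k)) * (g i (o i) * g j (o j)) =
      if i = j then ∑ x, p i x * g i x ^ 2 else 0 := by
    intro i j
    -- The mixed moment becomes a product over all coordinates, with factor 1 away from i and j, so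
    -- that the sum over o factorizes.
    have e1 : ∀ o : ι → κ, (∏ k, p k (o k)) * (g i (o i) * g j (o j)) =
        ∏ k, p k (o k) * ((if k = i then g k (o k) else 1) * (if k = j then g k (o k) else 1)) := by
      intro o
      rw [Finset.prod_mul_distrib, Finset.prod_mul_distrib, Finset.prod_ite_eq',
        Finset.prod_ite_eq']
      simp
    simp_rw [e1]
    rw [← Fintype.prod_sum (fun k x => p k x *
      ((if k = i then g k x else 1) * (if k = j then g k x else 1)))]
    split_ifs with hij
    · subst hij
      rw [Finset.prod_eq_single i]
      · simp [sq]
      · intro k _ hk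
        simp [hk, h1]
      · simp
    · apply Finset.prod_eq_zero (Finset.mem_univ i)
      simp [hij, h0]
  simp_rw [sq, Finset.sum_mul_sum, Finset.mul_sum]
  rw [Finset.sum_comm]
  refine Finset.sum_congr rfl fun i _ => ?_
  rw [Finset.sum_comm]
  simp_rw [key]
  simp [sq]

/-- The variance of a weighted sum of independent signs. -/
theorem sum_prod_mul_sum_sign_sub_sq_le {ι : Type*} [Fintype ι] [DecidableEq ι]
    {p : ι → Fin 2 → ℝ} (h1 : ∀ i, p i 0 + p i 1 = 1) (w : ι → ℝ) :
    ∑ o : ι → Fin 2, (∏ i, p i (o i)) *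
      (∑ i, w i * (if o i = 0 then 1 else -1) - ∑ i, w i * (p i 0 - p i 1)) ^ 2 ≤
        ∑ i, w i ^ 2 := by
  have e1 : ∀ o : ι → Fin 2,
      ∑ i, w i * (if o i = 0 then 1 else -1) - ∑ i, w i * (p i 0 - p i 1) =
        ∑ i, w i * ((if o i = 0 then 1 else -1) - (p i 0 - p i 1)) := by
    intro o
    rw [← Finset.sum_sub_distrib]
    exact Finset.sum_congr rfl fun i _ => by ring
  simp_rw [e1]
  rw [sum_prod_mul_sum_sq (p := p)
    (g := fun i x => w i * ((if x = 0 then 1 else -1) - (p i 0 - p i 1)))]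
  · refine Finset.sum_le_sum fun i _ => ?_
    have h2 : p i 1 = 1 - p i 0 := by linarith [h1 i]
    simp only [Fin.sum_univ_two, if_true, one_ne_zero, if_false, h2]
    -- A sign with P(+) = p has variance 4p(1 − p) = 1 − (2p − 1)² ≤ 1.
    nlinarith [sq_nonneg (w i * (2 * p i 0 - 1))]
  · intro i
    rw [Fin.sum_univ_two, h1]
  · intro i
    have h2 : p i 1 = 1 - p i 0 := by linarith [h1 i]
    simp only [Fin.sum_univ_two, if_true, one_ne_zero, if_false, h2]
    ring

theorem sum_getElem_eq_sum_map {α M : Type*} [AddCommMonoid M] (L : List α) (f : α → M) :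
    ∑ j : Fin L.length, f L[j] = (L.map f).sum := by
  rw [← List.sum_ofFn]
  congr 1
  exact List.ofFn_getElem_eq_map L f

/-- The difference of the two sides is the variance of g, which is nonnegative. -/
theorem sq_sum_mul_le_sum_mul_sq {ι : Type*} [Fintype ι] {p g : ι → ℝ} (hp : ∀ i, 0 ≤ p i)
    (h1 : ∑ i, p i = 1) : (∑ i, p i * g i) ^ 2 ≤ ∑ i, p i * g i ^ 2 := by
  have h := Finset.sum_nonneg fun i (_ : i ∈ Finset.univ) =>
    mul_nonneg (hp i) (sq_nonneg (g i - ∑ j, p j * g j))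
  have e : ∀ i, p i * (g i - ∑ j, p j * g j) ^ 2 = p i * g i ^ 2 -
      2 * (∑ j, p j * g j) * (p i * g i) + (∑ j, p j * g j) ^ 2 * p i := fun i => by ring
  simp_rw [e] at h
  rw [Finset.sum_add_distrib, Finset.sum_sub_distrib, ← Finset.mul_sum, ← Finset.mul_sum, h1] at h
  nlinarith

/-- Mean square errors of independent estimates: the root mean square errors add. -/
theorem sum_sum_mul_sq_add_le {ι κ : Type*} [Fintype ι] [Fintype κ] {p f : ι → ℝ} {q g : κ → ℝ}
    (hp : ∀ i, 0 ≤ p i) (hp1 : ∑ i, p i = 1) (hq : ∀ i, 0 ≤ q i) (hq1 : ∑ i, q i = 1)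
    {d e : ℝ} (hd : 0 ≤ d) (he : 0 ≤ e) (hf : ∑ i, p i * f i ^ 2 ≤ d ^ 2)
    (hg : ∑ i, q i * g i ^ 2 ≤ e ^ 2) :
    ∑ i, ∑ j, p i * q j * (f i + g j) ^ 2 ≤ (d + e) ^ 2 := by
  have e1 : ∑ i, ∑ j, p i * q j * (f i + g j) ^ 2 =
      ∑ i, p i * f i ^ 2 + 2 * (∑ i, p i * f i) * (∑ j, q j * g j) + ∑ j, q j * g j ^ 2 := by
    have : ∀ i j, p i * q j * (f i + g j) ^ 2 = p i * f i ^ 2 * q j +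
        2 * (p i * f i) * (q j * g j) + p i * (q j * g j ^ 2) := fun i j => by ring
    simp_rw [this, Finset.sum_add_distrib, ← Finset.mul_sum, ← Finset.sum_mul, hq1, hp1,
      ← Finset.mul_sum]
    ring
  have h1 : |∑ i, p i * f i| ≤ d :=
    abs_le_of_sq_le_sq ((sq_sum_mul_le_sum_mul_sq hp hp1).trans hf) hd
  have h2 : |∑ i, q i * g i| ≤ e :=
    abs_le_of_sq_le_sq ((sq_sum_mul_le_sum_mul_sq hq hq1).trans hg) he
  have h3 : (∑ i, p i * f i) * (∑ j, q j * g j) ≤ d * e :=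
    (le_abs_self _).trans ((abs_mul _ _).trans_le (mul_le_mul h1 h2 (abs_nonneg _) hd))
  rw [e1]
  nlinarith

end Probability

/-! ### Finite registers as qubits, and conservation of norm -/

section Embedding

variable {Y Z : Type} [Fintype Y]

/-- Circuits start in |0…0⟩, hence the identification is composed with a transposition that moves
the chosen basis vector there. -/
theorem exists_equiv_qubits {w : ℕ} (h : Fintype.card Y = 2 ^ w) (y : Y) :
    ∃ e : Y ≃ Qubits w, e y = 0 := by
  obtain ⟨e⟩ : Nonempty (Y ≃ Qubits w) := Fintype.card_eq.1 (by simp [h])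
  exact ⟨e.trans (Equiv.swap (e y) 0), by simp⟩

variable [DecidableEq Y] [Fintype Z] [DecidableEq Z]

/-- A qubit adjoined in front of a register. -/
def consQubit {w : ℕ} (e : Y ≃ Qubits w) : Y × Fin 2 ≃ Qubits (w + 1) where
  toFun x := Fin.cons x.2 (e x.1)
  invFun x := (e.symm (Fin.tail x), x 0)
  left_inv x := by simp
  right_inv x := by simp

theorem reindex_mulVec_single (e : Y ≃ Z) (M : Matrix Y Y ℂ) {y : Y} {z : Z} (h : e y = z) :
    Matrix.reindex e e M *ᵥ Pi.single z 1 = fun x => (M *ᵥ Pi.single y 1) (e.symm x) := by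
  subst h
  ext x
  simp

theorem sum_norm_sq_mulVec {M : Matrix Y Y ℂ} (h : M ∈ Matrix.unitaryGroup Y ℂ) (v : Y → ℂ) :
    ∑ y, ‖(M *ᵥ v) y‖ ^ 2 = ∑ y, ‖v y‖ ^ 2 := by
  have key : ∀ v : Y → ℂ, ((∑ y, ‖v y‖ ^ 2 : ℝ) : ℂ) = star v ⬝ᵥ v := by
    intro v
    simp [dotProduct, Complex.conj_mul']
  have h2 : star (M *ᵥ v) ⬝ᵥ (M *ᵥ v) = star v ⬝ᵥ v := by
    rw [star_mulVec, dotProduct_mulVec, vecMul_vecMul, ← star_eq_conjTranspose,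
      Matrix.mem_unitaryGroup_iff'.1 h, vecMul_one]
  exact_mod_cast (key _).trans (h2.trans (key v).symm)

theorem sum_norm_sq_mulVec_single {M : Matrix Y Y ℂ} (h : M ∈ Matrix.unitaryGroup Y ℂ) (y : Y) :
    ∑ x, ‖(M *ᵥ Pi.single y 1) x‖ ^ 2 = 1 := by
  rw [sum_norm_sq_mulVec h, Fintype.sum_eq_single y fun x hx => by simp [hx]]
  simp

end Embedding

variable {n a b : ℕ}

/-- The bias `P(0) - P(1)` of one qubit is `c`, after an operator made with `k` queries. -/
def QubitTest (n a b k : ℕ) (c : Oracle n a → Oracle n b → ℝ) : Prop :=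
  ∃ (Y : Type) (_ : Fintype Y) (_ : DecidableEq Y) (w : ℕ) (y : Y)
    (F : Oracle n a → Oracle n b → Matrix (Y × Fin 2) (Y × Fin 2) ℂ),
    Fintype.card Y = 2 ^ w ∧ Impl n a b k F ∧ ∀ Uρ Uσ,
      ∑ x, (‖(F Uρ Uσ *ᵥ Pi.single (y, 0) 1) (x, 0)‖ ^ 2 -
        ‖(F Uρ Uσ *ᵥ Pi.single (y, 0) 1) (x, 1)‖ ^ 2) = c Uρ Uσ

/-! #### Sampling -/

/-- A circuit with a marked work qubit. -/
abbrev Run (n a b : ℕ) : Type := Σ c : QueryCircuit n a b, Fin c.width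

/-- The probability of the outcome `v` of a run. -/
def Run.prob (r : Run n a b) (Uρ : Oracle n a) (Uσ : Oracle n b) (v : Fin 2) : ℝ :=
  r.1.qubitProb Uρ Uσ r.2 v

theorem Run.prob_nonneg (r : Run n a b) (Uρ : Oracle n a) (Uσ : Oracle n b) (v : Fin 2) :
    0 ≤ r.prob Uρ Uσ v :=
  Finset.sum_nonneg fun x _ => by
    split_ifs
    exacts [sq_nonneg _, le_rfl]

/-- All the work happens on the work qubits, with the tested qubit placed at position 0; the query
registers end in |0…0⟩ and do not affect the statistics. -/
theorem QubitTest.exists_run {k : ℕ} {c : Oracle n a → Oracle n b → ℝ}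
    (h : QubitTest n a b k c) : ∃ r : Run n a b, r.1.queries = k ∧ ∀ Uρ Uσ,
      r.prob Uρ Uσ 0 + r.prob Uρ Uσ 1 = 1 ∧ r.prob Uρ Uσ 0 - r.prob Uρ Uσ 1 = c Uρ Uσ := by
  obtain ⟨Y, _, _, w, y, F, hw, hF, hc⟩ := h
  obtain ⟨e, he⟩ := exists_equiv_qubits hw y
  have he' : consQubit e (y, 0) = 0 := by
    simp only [consQubit, Equiv.coe_fn_mk, he]
    funext i
    refine Fin.cases rfl (fun j => rfl) i
  obtain ⟨V, l, hl, H⟩ := (hF.reindex (consQubit e)).exists_circuit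
  have hprob : ∀ Uρ Uσ v, (QueryCircuit.mk (w + 1) V l).qubitProb Uρ Uσ 0 v =
      ∑ x, ‖(F Uρ Uσ *ᵥ Pi.single (y, 0) 1) (x, v)‖ ^ 2 := by
    intro Uρ Uσ v
    have h1 : ∀ x : Mem n a b (w + 1), (if x.2.2 0 = v then
        (QueryCircuit.mk (w + 1) V l).outcomeProb Uρ Uσ x else 0) =
        if x.1 = 0 ∧ x.2.1 = 0 then (if x.2.2 0 = v then ‖(F Uρ Uσ *ᵥ Pi.single (y, 0) 1)
          ((consQubit e).symm x.2.2)‖ ^ 2 else 0) else 0 := by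
      intro x
      rw [H, reindex_mulVec_single _ _ he']
      split_ifs <;> rfl
    rw [QueryCircuit.qubitProb]
    refine (Finset.sum_congr rfl fun x _ => h1 x).trans ?_
    rw [sum_ite_outcome (fun z : Qubits (w + 1) => if z 0 = v then
      ‖(F Uρ Uσ *ᵥ Pi.single (y, 0) 1) ((consQubit e).symm z)‖ ^ 2 else 0),
      ← Equiv.sum_comp (consQubit e), Fintype.sum_prod_type]
    refine Finset.sum_congr rfl fun x _ => ?_
    simp only [Equiv.symm_apply_apply]
    rw [Fintype.sum_eq_single v]
    · simp [consQubit]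
    · intro u hu
      simp [consQubit, hu]
  refine ⟨⟨⟨w + 1, V, l⟩, 0⟩, hl, fun Uρ Uσ => ⟨?_, ?_⟩⟩
  · simp only [Run.prob, hprob]
    rw [← sum_norm_sq_mulVec_single (hF.mem_unitaryGroup Uρ Uσ) (y, 0), Fintype.sum_prod_type]
    simp [Finset.sum_add_distrib]
  · simp only [Run.prob, hprob]
    rw [← hc, Finset.sum_sub_distrib]

/-- `v` is the mean of a weighted sum of measured signs with variance at most `s`, obtained from
independent runs with `k` queries in total. -/
def SamplingEst (n a b k : ℕ) (v : Oracle n a → Oracle n b → ℝ) (s : ℝ) : Prop :=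
  ∃ L : List (Run n a b × ℝ), (L.map fun r => r.1.1.queries).sum = k ∧
    (L.map fun r => r.2 ^ 2).sum ≤ s ∧ ∀ Uρ Uσ,
      (∀ r ∈ L, r.1.prob Uρ Uσ 0 + r.1.prob Uρ Uσ 1 = 1) ∧
      (L.map fun r => r.2 * (r.1.prob Uρ Uσ 0 - r.1.prob Uρ Uσ 1)).sum = v Uρ Uσ

namespace SamplingEst

variable {k l : ℕ} {v u : Oracle n a → Oracle n b → ℝ} {s t : ℝ}

theorem zero : SamplingEst n a b 0 (fun _ _ => 0) 0 := ⟨[], by simp⟩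

theorem add (h : SamplingEst n a b k v s) (h' : SamplingEst n a b l u t) :
    SamplingEst n a b (k + l) (fun Uρ Uσ => v Uρ Uσ + u Uρ Uσ) (s + t) := by
  obtain ⟨L, h1, h2, h3⟩ := h
  obtain ⟨L', h1', h2', h3'⟩ := h'
  refine ⟨L ++ L', by simp [h1, h1'], by simpa using add_le_add h2 h2', fun Uρ Uσ => ⟨?_, ?_⟩⟩
  · intro r hr
    rcases List.mem_append.1 hr with hr | hr
    · exact (h3 Uρ Uσ).1 r hr
    · exact (h3' Uρ Uσ).1 r hr
  · rw [List.map_append, List.sum_append, (h3 Uρ Uσ).2, (h3' Uρ Uσ).2]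

theorem smul (h : SamplingEst n a b k v s) (x : ℝ) :
    SamplingEst n a b k (fun Uρ Uσ => x * v Uρ Uσ) (x ^ 2 * s) := by
  obtain ⟨L, h1, h2, h3⟩ := h
  refine ⟨L.map fun r => (r.1, x * r.2), by simpa [Function.comp_def] using h1, ?_,
    fun Uρ Uσ => ⟨?_, ?_⟩⟩
  · simp only [List.map_map, Function.comp_def, mul_pow, List.sum_map_mul_left]
    gcongr
  · intro r hr
    obtain ⟨r', hr', rfl⟩ := List.mem_map.1 hr
    exact (h3 Uρ Uσ).1 r' hr'
  · simp only [List.map_map, Function.comp_def, mul_assoc, List.sum_map_mul_left]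
    rw [(h3 Uρ Uσ).2]

theorem sum {I : ℕ} {k : ℕ → ℕ} {v : ℕ → Oracle n a → Oracle n b → ℝ} {s : ℕ → ℝ}
    (h : ∀ i < I, SamplingEst n a b (k i) (v i) (s i)) :
    SamplingEst n a b (∑ i ∈ Finset.range I, k i)
      (fun Uρ Uσ => ∑ i ∈ Finset.range I, v i Uρ Uσ) (∑ i ∈ Finset.range I, s i) := by
  induction I with
  | zero => simpa using zero
  | succ I ih =>
    simp only [Finset.sum_range_succ]
    exact (ih fun i hi => h i (by omega)).add (h I (by omega))

/-- Take N runs of weight 1/N: the mean stays c and the sum of squared weights is N/N² = 1/N. -/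
theorem of_test {c : Oracle n a → Oracle n b → ℝ} (h : QubitTest n a b k c) {N : ℕ}
    (hN : N ≠ 0) : SamplingEst n a b (N * k) c (1 / N) := by
  obtain ⟨r, hr, H⟩ := h.exists_run
  refine ⟨List.replicate N (r, 1 / (N : ℝ)), by simp [hr], ?_, fun Uρ Uσ => ⟨?_, ?_⟩⟩
  · simp only [List.map_replicate, List.sum_replicate, nsmul_eq_mul]
    apply le_of_eq
    field_simp
  · intro r' hr'
    rw [List.eq_of_mem_replicate hr']
    exact (H Uρ Uσ).1
  · simp only [List.map_replicate, List.sum_replicate, nsmul_eq_mul]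
    rw [(H Uρ Uσ).2]
    field_simp

/-- The weighted sum of the measured signs is the estimate. The budget is split in two: bias at most
ε/2, and variance small enough for Chebyshev with deviation ε/2. -/
theorem exists_algorithm (h : SamplingEst n a b k v s) :
    ∃ alg : SamplingAlgorithm n a b, alg.queries = k ∧ ∀ Uρ Uσ (D ε δ : ℝ), 0 < ε →
      |v Uρ Uσ - D| ≤ ε / 2 → s ≤ δ * ε ^ 2 / 4 → 1 - δ ≤ alg.successProb Uρ Uσ D ε := by
  obtain ⟨L, h1, h2, h3⟩ := h
  refine ⟨⟨L.length, fun j => L[j].1.1, fun j => L[j].1.2,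
    fun o => ∑ j : Fin L.length, L[j].2 * (if o j = 0 then 1 else -1)⟩,
    (sum_getElem_eq_sum_map L fun r => r.1.1.queries).trans h1, fun Uρ Uσ D ε δ hε hD hs => ?_⟩
  obtain ⟨h4, h5⟩ := h3 Uρ Uσ
  have hp1 : ∀ j : Fin L.length, L[j].1.prob Uρ Uσ 0 + L[j].1.prob Uρ Uσ 1 = 1 := fun j =>
    h4 _ (List.getElem_mem _)
  have hX := sum_prod_mul_sum_sign_sub_sq_le hp1 fun j : Fin L.length => L[j].2
  rw [sum_getElem_eq_sum_map L fun r => r.2 * (r.1.prob Uρ Uσ 0 - r.1.prob Uρ Uσ 1), h5,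
    sum_getElem_eq_sum_map L fun r => r.2 ^ 2] at hX
  refine one_sub_le_sum_of_sq_error
    (p := fun o : Fin L.length → Fin 2 => ∏ j : Fin L.length, L[j].1.prob Uρ Uσ (o j))
    (fun o => Finset.prod_nonneg fun j _ => Run.prob_nonneg _ _ _ _) ?_ hε
    (hX.trans (h2.trans hs)) hD
  rw [← Fintype.prod_sum fun (j : Fin L.length) x => L[j].1.prob Uρ Uσ x]
  simp only [Fin.sum_univ_two, hp1, Finset.prod_const_one]

end SamplingEst

/-! #### A single circuit -/

/-- `v` can be estimated with root mean square error `e` by measuring the state prepared from a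
basis state with `k` queries. -/
def CircuitEst (n a b k : ℕ) (v : Oracle n a → Oracle n b → ℝ) (e : ℝ) : Prop :=
  0 ≤ e ∧ ∃ (Y : Type) (_ : Fintype Y) (_ : DecidableEq Y) (w : ℕ) (y : Y)
    (F : Oracle n a → Oracle n b → Matrix Y Y ℂ) (f : Y → ℝ),
    Fintype.card Y = 2 ^ w ∧ Impl n a b k F ∧ ∀ Uρ Uσ,
      ∑ x, ‖(F Uρ Uσ *ᵥ Pi.single y 1) x‖ ^ 2 * (f x - v Uρ Uσ) ^ 2 ≤ e ^ 2

namespace CircuitEst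

variable {k l : ℕ} {v u : Oracle n a → Oracle n b → ℝ} {d e : ℝ}

theorem zero : CircuitEst n a b 0 (fun _ _ => 0) 0 :=
  ⟨le_rfl, Unit, inferInstance, inferInstance, 0, (), fun _ _ => 1, fun _ => 0, by simp,
    .free' 1 (one_mem _), by simp⟩

theorem smul (h : CircuitEst n a b k v e) (x : ℝ) :
    CircuitEst n a b k (fun Uρ Uσ => x * v Uρ Uσ) (|x| * e) := by
  obtain ⟨he, Y, _, _, w, y, F, f, hw, hF, H⟩ := h
  refine ⟨by positivity, Y, _, _, w, y, F, fun y => x * f y, hw, hF, fun Uρ Uσ => ?_⟩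
  have : ∀ z, ‖(F Uρ Uσ *ᵥ Pi.single y 1) z‖ ^ 2 * (x * f z - x * v Uρ Uσ) ^ 2 =
      x ^ 2 * (‖(F Uρ Uσ *ᵥ Pi.single y 1) z‖ ^ 2 * (f z - v Uρ Uσ) ^ 2) := fun z => by ring
  simp_rw [this]
  rw [← Finset.mul_sum, mul_pow, sq_abs]
  have := H Uρ Uσ
  gcongr

/-- Both preparations run side by side on a tensor product, so their outcomes are independent and
the two estimates can be added. -/
theorem add (h : CircuitEst n a b k v d) (h' : CircuitEst n a b l u e) :
    CircuitEst n a b (k + l) (fun Uρ Uσ => v Uρ Uσ + u Uρ Uσ) (d + e) := by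
  obtain ⟨hd, Y, _, _, w, y, F, f, hw, hF, H⟩ := h
  obtain ⟨he, Z, _, _, w', z, G, g, hw', hG, H'⟩ := h'
  refine ⟨by positivity, Y × Z, inferInstance, inferInstance, w + w', (y, z),
    fun Uρ Uσ => F Uρ Uσ ⊗ₖ G Uρ Uσ, fun x => f x.1 + g x.2, by simp [hw, hw', pow_add],
    ((hF.kron_one Z).mul (hG.one_kron Y)).congr fun Uρ Uσ => ?_, fun Uρ Uσ => ?_⟩
  · rw [← mul_kronecker_mul, mul_one, one_mul]
  have := sum_sum_mul_sq_add_le (fun x => sq_nonneg _)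
    (sum_norm_sq_mulVec_single (hF.mem_unitaryGroup Uρ Uσ) y) (fun x => sq_nonneg _)
    (sum_norm_sq_mulVec_single (hG.mem_unitaryGroup Uρ Uσ) z) hd he (H Uρ Uσ) (H' Uρ Uσ)
  refine le_trans (le_of_eq ?_) this
  rw [Fintype.sum_prod_type]
  refine Finset.sum_congr rfl fun i _ => Finset.sum_congr rfl fun j _ => ?_
  simp only [mulVec_single_one, col_apply]
  rw [kronecker_apply, norm_mul]
  ring

theorem sum {I : ℕ} {k : ℕ → ℕ} {v : ℕ → Oracle n a → Oracle n b → ℝ} {e : ℕ → ℝ}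
    (h : ∀ i < I, CircuitEst n a b (k i) (v i) (e i)) :
    CircuitEst n a b (∑ i ∈ Finset.range I, k i)
      (fun Uρ Uσ => ∑ i ∈ Finset.range I, v i Uρ Uσ) (∑ i ∈ Finset.range I, e i) := by
  induction I with
  | zero => simpa using zero
  | succ I ih =>
    simp only [Finset.sum_range_succ]
    exact (ih fun i hi => h i (by omega)).add (h I (by omega))

theorem exists_algorithm (h : CircuitEst n a b k v e) :
    ∃ alg : QueryAlgorithm n a b, alg.queries = k ∧ ∀ Uρ Uσ (D ε δ : ℝ), 0 < ε →
      |v Uρ Uσ - D| ≤ ε / 2 → e ^ 2 ≤ δ * ε ^ 2 / 4 → 1 - δ ≤ alg.successProb Uρ Uσ D ε := by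
  obtain ⟨he, Y, _, _, w, y, F, f, hw, hF, H⟩ := h
  obtain ⟨q, hq⟩ := exists_equiv_qubits hw y
  obtain ⟨V, l, hl, hV⟩ := (hF.reindex q).exists_circuit
  refine ⟨⟨⟨w, V, l⟩, fun x => f (q.symm x.2.2)⟩, hl, fun Uρ Uσ D ε δ hε hD hs => ?_⟩
  have key := one_sub_le_sum_of_sq_error (fun x => sq_nonneg _)
    (sum_norm_sq_mulVec_single (hF.mem_unitaryGroup Uρ Uσ) y) hε ((H Uρ Uσ).trans hs) hD
  refine key.trans (le_of_eq ?_)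
  rw [← Equiv.sum_comp q.symm, ← sum_ite_outcome (n := n) (a := a) (b := b)]
  refine Finset.sum_congr rfl fun x _ => ?_
  simp only [hV, reindex_mulVec_single _ _ hq]
  split_ifs <;> rfl

end CircuitEst

/-! ### Amplitude estimation -/

/-! ### State preparation and measurement of observables -/

section Vectors

variable {Y Z : Type} [Fintype Y] [DecidableEq Y] [Fintype Z] [DecidableEq Z]

/-- A unit vector extends to an orthonormal basis, whose vectors are the columns of the unitary. -/
theorem exists_unitary_mulVec_single (v : Y → ℂ) (hv : ∑ y, ‖v y‖ ^ 2 = 1) (y : Y) :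
    ∃ Q ∈ Matrix.unitaryGroup Y ℂ, Q *ᵥ Pi.single y 1 = v := by
  have hv' : ‖WithLp.toLp 2 v‖ = 1 := by
    rw [EuclideanSpace.norm_eq]
    simp [hv]
  have ho : Orthonormal ℂ (({y} : Set Y).domRestrict fun _ => WithLp.toLp 2 v) :=
    ⟨fun _ => hv', fun i j hij => absurd (Subsingleton.elim i j) hij⟩
  obtain ⟨B, hB⟩ := ho.exists_orthonormalBasis_extension_of_card_eq (by simp)
  refine ⟨(EuclideanSpace.basisFun Y ℂ).toBasis.toMatrix B,
    (EuclideanSpace.basisFun Y ℂ).toMatrix_orthonormalBasis_mem_unitary B, ?_⟩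
  ext i
  simp [Module.Basis.toMatrix_apply, hB y rfl]

theorem blockDiagonal_mulVec_apply {Y Z : Type} [Fintype Y] [Fintype Z] [DecidableEq Z] (M : Z → Matrix Y Y ℂ) (v : Y × Z → ℂ) (x : Y) (z : Z) :
    (blockDiagonal M *ᵥ v) (x, z) = (M z *ᵥ fun x' => v (x', z)) x := by
  simp only [mulVec, dotProduct, Fintype.sum_prod_type, blockDiagonal_apply]
  refine Finset.sum_congr rfl fun i _ => ?_
  simp

theorem kronecker_mulVec_single (A : Matrix Y Y ℂ) (B : Matrix Z Z ℂ) (y : Y) (z : Z) :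
    (A ⊗ₖ B) *ᵥ Pi.single (y, z) 1 =
      fun p => (A *ᵥ Pi.single y 1) p.1 * (B *ᵥ Pi.single z 1) p.2 := by
  ext p
  simp only [mulVec_single_one]
  rfl

theorem one_kronecker_mulVec_apply {Y Z : Type} [Fintype Y] [DecidableEq Y] [Fintype Z] (B : Matrix Z Z ℂ) (v : Y × Z → ℂ) (x : Y) (z : Z) :
    (((1 : Matrix Y Y ℂ) ⊗ₖ B) *ᵥ v) (x, z) = (B *ᵥ fun z' => v (x, z')) z := by
  simp [mulVec, dotProduct, Fintype.sum_prod_type, Matrix.one_apply,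
    ite_mul, Finset.sum_ite_irrel]

/-- An observable is measured in its eigenbasis. -/
theorem _root_.Matrix.IsHermitian.exists_measurement {B : Matrix Z Z ℂ} (hB : B.IsHermitian) :
    ∃ Q ∈ Matrix.unitaryGroup Z ℂ, ∃ f : Z → ℝ, ∀ (v : Z → ℂ) (c : ℝ),
      ∑ z, ‖(Q *ᵥ v) z‖ ^ 2 * (f z - c) ^ 2 = ∑ z, ‖(B *ᵥ v) z - c * v z‖ ^ 2 := by
  set U := hB.eigenvectorUnitary with hU
  refine ⟨(U.1)ᴴ, conjTranspose_mem_unitaryGroup U.2, hB.eigenvalues, fun v c => ?_⟩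
  have h1 : U.1 * (U.1)ᴴ = 1 := Matrix.mem_unitaryGroup_iff.1 U.2
  have h2 : B = U.1 * diagonal (fun z => (hB.eigenvalues z : ℂ)) * (U.1)ᴴ := by
    conv_lhs => rw [hB.spectral_theorem]
    rfl
  have h3 : ∀ z, (B *ᵥ v) z - c * v z = (U.1 *ᵥ (diagonal (fun z =>
      ((hB.eigenvalues z - c : ℝ) : ℂ)) *ᵥ ((U.1)ᴴ *ᵥ v))) z := by
    intro z
    have h4 : diagonal (fun z => ((hB.eigenvalues z - c : ℝ) : ℂ)) =
        diagonal (fun z => (hB.eigenvalues z : ℂ)) - (c : ℂ) • (1 : Matrix Z Z ℂ) := by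
      ext i j
      by_cases hij : i = j <;> simp [hij]
    rw [h4, mulVec_mulVec, mulVec_mulVec, Matrix.mul_sub, Matrix.sub_mul, ← h2, sub_mulVec]
    simp [h1, smul_mulVec]
  simp_rw [h3]
  rw [sum_norm_sq_mulVec U.2]
  refine Finset.sum_congr rfl fun z _ => ?_
  rw [mulVec_diagonal, norm_mul, mul_pow, Complex.norm_real, Real.norm_eq_abs, sq_abs, mul_comm]

end Vectors

/-! ### The path observable on a clock register -/

section Path

/-- Half the adjacency matrix of the path with `M` vertices. -/
def pathMatrix (M : ℕ) : Matrix (Fin M) (Fin M) ℂ :=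
  fun i j => if (j : ℕ) = i + 1 ∨ (i : ℕ) = j + 1 then 1 / 2 else 0

theorem pathMatrix_isHermitian (M : ℕ) : (pathMatrix M).IsHermitian := by
  ext i j
  simp only [conjTranspose_apply, pathMatrix, or_comm]
  split_ifs <;> simp

/-- Vertex t carries u (t + 1); the zero values at 0 and M + 1 stand for the neighbours missing at
the ends of the path, so every vertex obeys the same averaging rule. -/
theorem pathMatrix_mulVec {M : ℕ} {u : ℕ → ℂ} (h0 : u 0 = 0) (hM : u (M + 1) = 0) (t : Fin M) :
    (pathMatrix M *ᵥ fun s : Fin M => u (s + 1)) t = (u (t + 2) + u t) / 2 := by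
  have e : ∀ s : Fin M, pathMatrix M t s * u (s + 1) =
      (if (s : ℕ) = t + 1 then u (s + 1) / 2 else 0) +
        (if (s : ℕ) + 1 = t then u (s + 1) / 2 else 0) := by
    intro s
    simp only [pathMatrix]
    by_cases h1 : (s : ℕ) = t + 1
    · have h2 : ¬ (s : ℕ) + 1 = t := by omega
      simp only [h1, true_or, if_true]
      rw [if_neg (by omega)]
      ring
    · by_cases h2 : (s : ℕ) + 1 = t
      · simp [h1, h2]
        ring
      · simp [h1, h2, Ne.symm h2]
  simp only [mulVec, dotProduct, e]
  rw [Finset.sum_add_distrib,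
    Fin.sum_univ_eq_sum_range (fun s => if s = t + 1 then u (s + 1) / 2 else 0) M,
    Fin.sum_univ_eq_sum_range (fun s => if s + 1 = t then u (s + 1) / 2 else 0) M,
    Finset.sum_ite_eq']
  have h1 : (if (t : ℕ) + 1 ∈ Finset.range M then u (t + 1 + 1) / 2 else 0) = u (t + 2) / 2 := by
    split_ifs with h
    · rfl
    · have : (t : ℕ) + 2 = M + 1 := by
        have := t.2
        simp only [Finset.mem_range] at h
        omega
      rw [this, hM, zero_div]
  have h2 : ∑ s ∈ Finset.range M, (if s + 1 = (t : ℕ) then u (s + 1) / 2 else 0) = u t / 2 := by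
    rcases Nat.eq_zero_or_pos (t : ℕ) with h | h
    · simp [h, h0]
    · have h3 : ∀ s, s + 1 = (t : ℕ) ↔ s = (t : ℕ) - 1 := fun s => by omega
      simp_rw [h3]
      rw [Finset.sum_ite_eq', if_pos (by simp only [Finset.mem_range]; omega)]
      congr 2
      omega
  rw [h1, h2, add_div]

variable {Y : Type} [Fintype Y] [DecidableEq Y]

/-- If `G + G†` acts on `ψ` as `2c`, then the path observable on the clock register has a value
close to `c` in the superposition of the vectors `G ^ t ψ` with slowly varying amplitudes. -/
theorem sum_norm_sq_pathMatrix_sub_le {G : Matrix Y Y ℂ} (hG : G ∈ Matrix.unitaryGroup Y ℂ)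
    {ψ : Y → ℂ} (hψ : ∑ y, ‖ψ y‖ ^ 2 = 1) {c : ℝ}
    (hc : G *ᵥ ψ + Gᴴ *ᵥ ψ = (2 * c : ℂ) • ψ) {M : ℕ} {α : ℕ → ℝ} (h0 : α 0 = 0)
    (hM : α (M + 1) = 0) :
    ∑ y, ∑ t : Fin M, ‖(pathMatrix M *ᵥ fun s : Fin M => (α (s + 1) : ℂ) * ((G ^ (s : ℕ)) *ᵥ ψ) y) t
        - c * ((α (t + 1) : ℂ) * ((G ^ (t : ℕ)) *ᵥ ψ) y)‖ ^ 2 ≤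
      ∑ t : Fin M, ((α (t + 2) - α (t + 1)) ^ 2 + (α (t + 1) - α t) ^ 2) / 2 := by
  have hGG : Gᴴ * G = 1 := Matrix.mem_unitaryGroup_iff'.1 hG
  have hGG' : G * Gᴴ = 1 := Matrix.mem_unitaryGroup_iff.1 hG
  have hcomm : Commute Gᴴ G := by rw [Commute, SemiconjBy, hGG, hGG']
  -- Applying G^t to the hypothesis gives the three-term recurrence c G^t ψ = (G^(t+1) ψ + G^(t−1)
  -- ψ)/2. With constant amplitudes this would be an exact eigenvector equation for the path
  -- observable away from the ends; the error comes from the increments of α.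
  have hrec : ∀ (t : ℕ) y, (c : ℂ) * ((G ^ t) *ᵥ ψ) y =
      (((G ^ (t + 1)) *ᵥ ψ) y + ((Gᴴ * G ^ t) *ᵥ ψ) y) / 2 := by
    intro t y
    have h1 : (G ^ t) *ᵥ (G *ᵥ ψ + Gᴴ *ᵥ ψ) = (G ^ t) *ᵥ ((2 * c : ℂ) • ψ) := by rw [hc]
    rw [mulVec_add, mulVec_mulVec, mulVec_mulVec, ← pow_succ, ← (hcomm.pow_right t).eq,
      mulVec_smul] at h1
    have h2 := congrFun h1 y
    simp only [Pi.add_apply, Pi.smul_apply, smul_eq_mul] at h2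
    rw [h2]
    ring
  have hnorm : ∀ A ∈ Matrix.unitaryGroup Y ℂ, ∑ y, ‖(A *ᵥ ψ) y‖ ^ 2 = 1 := fun A hA => by
    rw [sum_norm_sq_mulVec hA, hψ]
  rw [Finset.sum_comm]
  refine Finset.sum_le_sum fun t _ => ?_
  have hpt : ∀ y, (pathMatrix M *ᵥ fun s : Fin M => (α (s + 1) : ℂ) * ((G ^ (s : ℕ)) *ᵥ ψ) y) t -
      c * ((α (t + 1) : ℂ) * ((G ^ (t : ℕ)) *ᵥ ψ) y) =
      ((α (t + 2) - α (t + 1) : ℝ) : ℂ) / 2 * ((G ^ ((t : ℕ) + 1)) *ᵥ ψ) y -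
        ((α (t + 1) - α t : ℝ) : ℂ) / 2 * ((Gᴴ * G ^ (t : ℕ)) *ᵥ ψ) y := by
    intro y
    -- The natural subtraction s − 1 is harmless at s = 0 because α 0 = 0; for the same reason
    -- G^(t−1) may be written as G† G^t also at t = 0.
    have h3 := pathMatrix_mulVec (u := fun s => (α s : ℂ) * ((G ^ (s - 1)) *ᵥ ψ) y)
      (by simp [h0]) (by simp [hM]) t
    have h1 : (α t : ℂ) * ((G ^ ((t : ℕ) - 1)) *ᵥ ψ) y =
        (α t : ℂ) * ((Gᴴ * G ^ (t : ℕ)) *ᵥ ψ) y := by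
      rcases Nat.eq_zero_or_pos (t : ℕ) with h | h
      · simp [h, h0]
      · obtain ⟨s, hs⟩ : ∃ s, (t : ℕ) = s + 1 := ⟨t - 1, by omega⟩
        rw [hs, pow_succ', ← Matrix.mul_assoc, hGG, one_mul, Nat.add_sub_cancel]
    have h2 := hrec t y
    simp only [Nat.add_sub_cancel] at h3
    rw [h3, h1, show (t : ℕ) + 2 - 1 = t + 1 by omega,
      show (c : ℂ) * ((α (t + 1) : ℂ) * ((G ^ (t : ℕ)) *ᵥ ψ) y) =
        (α (t + 1) : ℂ) * (c * ((G ^ (t : ℕ)) *ᵥ ψ) y) by ring, h2]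
    push_cast
    ring
  calc ∑ y, ‖(pathMatrix M *ᵥ fun s : Fin M => (α (s + 1) : ℂ) * ((G ^ (s : ℕ)) *ᵥ ψ) y) t -
      c * ((α (t + 1) : ℂ) * ((G ^ (t : ℕ)) *ᵥ ψ) y)‖ ^ 2
      ≤ ∑ y, ((α (t + 2) - α (t + 1)) ^ 2 / 2 * ‖((G ^ ((t : ℕ) + 1)) *ᵥ ψ) y‖ ^ 2 +
        (α (t + 1) - α t) ^ 2 / 2 * ‖((Gᴴ * G ^ (t : ℕ)) *ᵥ ψ) y‖ ^ 2) := by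
        refine Finset.sum_le_sum fun y _ => ?_
        rw [hpt]
        set A := ((G ^ ((t : ℕ) + 1)) *ᵥ ψ) y
        set B := ((Gᴴ * G ^ (t : ℕ)) *ᵥ ψ) y
        set p := α (t + 2) - α (t + 1)
        set q := α (t + 1) - α t
        have h1 : ‖(p : ℂ) / 2 * A - (q : ℂ) / 2 * B‖ ≤ |p| / 2 * ‖A‖ + |q| / 2 * ‖B‖ := by
          refine (norm_sub_le _ _).trans (le_of_eq ?_)
          simp
        calc ‖(p : ℂ) / 2 * A - (q : ℂ) / 2 * B‖ ^ 2 ≤ (|p| / 2 * ‖A‖ + |q| / 2 * ‖B‖) ^ 2 := by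
              gcongr
          _ ≤ 2 * ((|p| / 2 * ‖A‖) ^ 2 + (|q| / 2 * ‖B‖) ^ 2) := add_sq_le
          _ = _ := by
            rw [mul_pow, mul_pow, div_pow, div_pow, sq_abs, sq_abs]
            ring
    _ = _ := by
        rw [Finset.sum_add_distrib, ← Finset.mul_sum, ← Finset.mul_sum,
          hnorm _ (pow_mem hG _), hnorm _ (mul_mem (conjTranspose_mem_unitaryGroup hG)
            (pow_mem hG _))]
        ring

/-- A triangular window. -/
theorem exists_window (h : ℕ) (hh : h ≠ 0) : ∃ α : ℕ → ℝ, α 0 = 0 ∧ α (4 * h + 1) = 0 ∧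
    ∑ t : Fin (4 * h), α (t + 1) ^ 2 = 1 ∧
    ∑ t : Fin (4 * h), ((α (t + 2) - α (t + 1)) ^ 2 + (α (t + 1) - α t) ^ 2) / 2 ≤
      (2 / (h : ℝ)) ^ 2 := by
  -- A tent of slope ±1: the increments are at most 1, while the sum of squares is at least 2h³,
  -- since the 2h middle terms are each at least h². After normalization the bound is 4h/(2h³) =
  -- 2/h².
  set β : ℕ → ℝ := fun t => min (t : ℝ) (4 * h + 1 - t) with hβ
  set ν : ℝ := ∑ t : Fin (4 * h), β (t + 1) ^ 2 with hν
  have hh' : (0 : ℝ) < h := by positivity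
  have hν1 : 2 * (h : ℝ) ^ 3 ≤ ν := by
    rw [hν, Fin.sum_univ_eq_sum_range (fun t => β (t + 1) ^ 2)]
    have h1 : Finset.Ico h (3 * h) ⊆ Finset.range (4 * h) := by
      intro t
      simp only [Finset.mem_Ico, Finset.mem_range]
      omega
    refine le_trans ?_ (Finset.sum_le_sum_of_subset_of_nonneg h1 fun t _ _ => sq_nonneg _)
    have h2 : ∀ t ∈ Finset.Ico h (3 * h), (h : ℝ) ^ 2 ≤ β (t + 1) ^ 2 := by
      intro t ht
      rw [Finset.mem_Ico] at ht
      have h3 : (h : ℝ) ≤ t := by exact_mod_cast ht.1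
      have h4 : (t : ℝ) ≤ 3 * h := by exact_mod_cast ht.2.le
      have : (h : ℝ) ≤ β (t + 1) := by
        simp only [hβ, le_min_iff]
        push_cast
        constructor <;> linarith
      gcongr
    refine le_trans (le_of_eq ?_) (Finset.sum_le_sum h2)
    rw [Finset.sum_const, Nat.card_Ico, nsmul_eq_mul, show 3 * h - h = 2 * h by omega]
    push_cast
    ring
  have hν0 : 0 < ν := lt_of_lt_of_le (by positivity) hν1
  have hlip : ∀ t, (β (t + 1) - β t) ^ 2 ≤ 1 := by
    intro t
    rw [sq_le_one_iff_abs_le_one]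
    refine (abs_min_sub_min_le_max _ _ _ _).trans (max_le ?_ ?_) <;> push_cast <;> norm_num
  have hs : (√ν) ^ 2 = ν := Real.sq_sqrt hν0.le
  refine ⟨fun t => β t / √ν, ?_, ?_, ?_, ?_⟩
  · simp only [hβ]
    rw [min_eq_left (by push_cast; linarith)]
    simp
  · simp only [hβ]
    rw [min_eq_right (by push_cast; linarith)]
    push_cast
    simp
  · simp_rw [div_pow, hs]
    rw [← Finset.sum_div, ← hν, div_self hν0.ne']
  · have h1 : ∀ t : Fin (4 * h), ((β (t + 2) / √ν - β (t + 1) / √ν) ^ 2 +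
        (β (t + 1) / √ν - β t / √ν) ^ 2) / 2 ≤ 1 / ν := by
      intro t
      rw [← sub_div, ← sub_div, div_pow, div_pow, hs, ← add_div, div_div, mul_comm ν, ← div_div]
      gcongr
      have := hlip t
      have : (β (t + 2) - β (t + 1)) ^ 2 ≤ 1 := hlip (t + 1)
      linarith
    refine (Finset.sum_le_sum fun t _ => h1 t).trans ?_
    rw [Finset.sum_const, Finset.card_univ, Fintype.card_fin, nsmul_eq_mul]
    push_cast
    calc 4 * (h : ℝ) * (1 / ν) ≤ 4 * (h : ℝ) * (1 / (2 * (h : ℝ) ^ 3)) := by gcongr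
      _ ≤ (2 / (h : ℝ)) ^ 2 := by
        field_simp
        norm_num

end Path

/-! ### Reflections and amplitude estimation -/

section AmplitudeEstimation

variable {Y : Type} [Fintype Y] [DecidableEq Y]

/-- The reflection about the basis vector `y`. -/
def reflect (y : Y) : Matrix Y Y ℂ := diagonal fun x => if x = y then 1 else -1

theorem diagonal_sign_mem_unitaryGroup {s : Y → ℂ} (h : ∀ y, s y = 1 ∨ s y = -1) :
    diagonal s ∈ Matrix.unitaryGroup Y ℂ := by
  rw [Matrix.mem_unitaryGroup_iff, star_eq_conjTranspose, diagonal_conjTranspose,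
    diagonal_mul_diagonal, ← diagonal_one]
  congr 1
  funext y
  rcases h y with h | h <;> simp [h]

theorem reflect_mem_unitaryGroup (y : Y) : reflect y ∈ Matrix.unitaryGroup Y ℂ :=
  diagonal_sign_mem_unitaryGroup fun x => by
    by_cases h : x = y <;> simp [h]

theorem reflect_mulVec (y : Y) (v : Y → ℂ) :
    reflect y *ᵥ v = (2 * v y) • Pi.single y 1 - v := by
  ext x
  rw [reflect, mulVec_diagonal]
  by_cases h : x = y
  · subst h
    simp
    ring
  · simp [h]

theorem reflect_conjTranspose {Y : Type} [DecidableEq Y] (y : Y) : (reflect y)ᴴ = reflect y := by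
  rw [reflect, diagonal_conjTranspose]
  congr 1
  funext x
  simp [apply_ite star]

/-- The product of the reflections about `F e` and `R` acts on `F e` like a rotation. -/
theorem grover_mulVec_add {F R : Matrix Y Y ℂ} (hF : F ∈ Matrix.unitaryGroup Y ℂ)
    (hR : Rᴴ = R) (y : Y) :
    (F * reflect y * Fᴴ * R) *ᵥ (F *ᵥ Pi.single y 1) +
      (F * reflect y * Fᴴ * R)ᴴ *ᵥ (F *ᵥ Pi.single y 1) =
      (2 * (star (F *ᵥ Pi.single y 1) ⬝ᵥ (R *ᵥ (F *ᵥ Pi.single y 1)))) • (F *ᵥ Pi.single y 1) := by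
  have h1 : Fᴴ * F = 1 := Matrix.mem_unitaryGroup_iff'.1 hF
  have h2 : F * Fᴴ = 1 := Matrix.mem_unitaryGroup_iff.1 hF
  set ψ := F *ᵥ Pi.single y 1 with hψ
  -- The reflection about ψ fixes ψ, so G†ψ = Rψ, whereas Gψ = 2⟨ψ, Rψ⟩ψ − Rψ. The sum leaves only
  -- the multiple of ψ.
  have h3 : (F * reflect y * Fᴴ * R)ᴴ *ᵥ ψ = R *ᵥ ψ := by
    have h4 : Fᴴ *ᵥ ψ = Pi.single y 1 := by rw [hψ, mulVec_mulVec, h1, one_mulVec]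
    rw [conjTranspose_mul, conjTranspose_mul, conjTranspose_mul, conjTranspose_conjTranspose,
      reflect_conjTranspose, hR, ← mulVec_mulVec, ← mulVec_mulVec, ← mulVec_mulVec, h4,
      reflect_mulVec]
    congr 1
    rw [mulVec_sub, mulVec_smul, ← hψ]
    ext x
    simp
    ring
  have h5 : (Fᴴ *ᵥ (R *ᵥ ψ)) y = star ψ ⬝ᵥ (R *ᵥ ψ) := by
    rw [hψ, star_mulVec, ← dotProduct_mulVec, ← hψ]
    simp [dotProduct, Pi.single_apply, apply_ite star]
  rw [h3, ← mulVec_mulVec, ← mulVec_mulVec, ← mulVec_mulVec, reflect_mulVec, mulVec_sub,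
    mulVec_smul, h5, mulVec_mulVec _ F, h2, one_mulVec, ← hψ, sub_add_cancel]

variable {n a b : ℕ}

/-- The bias c is ⟨ψ, Rψ⟩ for the sign R of the tested qubit. A clock in the window state controls
the power of the Grover iterate G, and the path observable of the clock is then measured: its mean
square deviation from c is the squared residual of an approximate eigenvector equation. There are
4·2^μ iterates of 2k queries each, and one preparation of k queries. -/
theorem CircuitEst.of_test {k : ℕ} {c : Oracle n a → Oracle n b → ℝ} (hc : QubitTest n a b k c)
    (μ : ℕ) : CircuitEst n a b ((8 * 2 ^ μ + 1) * k) c (2 / (2 ^ μ : ℕ)) := by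
  obtain ⟨Y', _, _, w, y', F, hw, hF, H⟩ := hc
  have hμ : 2 ^ μ ≠ 0 := by positivity
  have hM : 4 * 2 ^ μ ≠ 0 := by positivity
  have : NeZero (4 * 2 ^ μ) := ⟨hM⟩
  obtain ⟨α, hα0, hαM, hα1, hα2⟩ := exists_window (2 ^ μ) hμ
  obtain ⟨Qa, hQa, hQa'⟩ := exists_unitary_mulVec_single
    (fun t : Fin (4 * 2 ^ μ) => (α (t + 1) : ℂ)) (by simpa using hα1) 0
  obtain ⟨Q, hQ, f, hf⟩ := (pathMatrix_isHermitian (4 * 2 ^ μ)).exists_measurement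
  set R : Matrix (Y' × Fin 2) (Y' × Fin 2) ℂ := diagonal fun x => if x.2 = 0 then 1 else -1
    with hR
  have hRu : R ∈ Matrix.unitaryGroup _ ℂ := diagonal_sign_mem_unitaryGroup fun x => by
    by_cases h : x.2 = 0 <;> simp [h]
  have hRs : Rᴴ = R := by
    rw [hR, diagonal_conjTranspose]
    congr 1
    funext x
    simp [apply_ite star]
  set G : Oracle n a → Oracle n b → Matrix (Y' × Fin 2) (Y' × Fin 2) ℂ :=
    fun Uρ Uσ => F Uρ Uσ * reflect (y', 0) * (F Uρ Uσ)ᴴ * R with hG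
  have hGc : Ctrl n a b (k + 0 + k + 0) G :=
    (Ctrl.conj hF (Ctrl.free _ (reflect_mem_unitaryGroup _))).mul (Ctrl.free _ hRu)
  -- Read from right to left: prepare the clock, prepare ψ, apply G^t controlled by the clock value
  -- t, rotate the clock to the eigenbasis of the path matrix.
  have himpl := ((Impl.free' (n := n) (a := a) (b := b) Q hQ).one_kron (Y' × Fin 2)).mul
    ((hGc.pow (fun t : Fin (4 * 2 ^ μ) => (t : ℕ)) (4 * 2 ^ μ)).mul
      ((hF.kron_one (Fin (4 * 2 ^ μ))).mul ((Impl.free' Qa hQa).one_kron (Y' × Fin 2))))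
  refine ⟨by positivity, (Y' × Fin 2) × Fin (4 * 2 ^ μ), inferInstance, inferInstance,
    w + 1 + (2 + μ), ((y', 0), 0), _, fun x => f x.2, by simp [hw, pow_add],
    himpl.cast (by ring), fun Uρ Uσ => ?_⟩
  have hFu := hF.mem_unitaryGroup Uρ Uσ
  have hGu : G Uρ Uσ ∈ Matrix.unitaryGroup _ ℂ :=
    mul_mem (mul_mem (mul_mem hFu (reflect_mem_unitaryGroup _))
      (conjTranspose_mem_unitaryGroup hFu)) hRu
  set ψ := F Uρ Uσ *ᵥ Pi.single (y', 0) 1 with hψ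
  have hcψ : star ψ ⬝ᵥ (R *ᵥ ψ) = (c Uρ Uσ : ℂ) := by
    rw [← H, ← hψ, dotProduct, Fintype.sum_prod_type]
    push_cast
    refine Finset.sum_congr rfl fun x _ => ?_
    simp only [hR, mulVec_diagonal, Fin.sum_univ_two, Pi.star_apply]
    simp only [if_true, one_ne_zero, if_false, one_mul, neg_one_mul, mul_neg, ← Complex.conj_mul']
    rw [sub_eq_add_neg]
    rfl
  have hrot : G Uρ Uσ *ᵥ ψ + (G Uρ Uσ)ᴴ *ᵥ ψ = (2 * c Uρ Uσ : ℂ) • ψ := by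
    rw [← hcψ]
    exact grover_mulVec_add hFu hRs (y', 0)
  have key := (sum_norm_sq_pathMatrix_sub_le hGu (sum_norm_sq_mulVec_single hFu _) hrot hα0
    hαM).trans hα2
  refine le_trans (le_of_eq ?_) key
  rw [Fintype.sum_prod_type]
  refine Finset.sum_congr rfl fun x _ => ?_
  rw [← hf]
  refine Finset.sum_congr rfl fun t _ => ?_
  congr 3
  rw [← mulVec_mulVec, one_kronecker_mulVec_apply]
  congr 2
  funext s
  rw [← mulVec_mulVec, ← mul_kronecker_mul, one_mul, mul_one, kronecker_mulVec_single, hQa',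
    blockDiagonal_mulVec_apply, min_eq_left s.2.le, ← hψ]
  have : (fun x' => ψ x' * (α (s + 1) : ℂ)) = (α (s + 1) : ℂ) • ψ := by
    ext
    simp [mul_comm]
  simp only [this, mulVec_smul, Pi.smul_apply, smul_eq_mul]

end AmplitudeEstimation

/-! ### Tests for powers of a unitary -/

section HadamardTest

/-- The Hadamard gate. -/
def hadamard : Matrix (Fin 2) (Fin 2) ℂ := ((√2 : ℝ) : ℂ)⁻¹ • !![1, 1; 1, -1]

theorem sqrt_two_inv_mul_self : ((√2 : ℝ) : ℂ)⁻¹ * ((√2 : ℝ) : ℂ)⁻¹ = 1 / 2 := by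
  rw [← mul_inv, ← Complex.ofReal_mul, Real.mul_self_sqrt (by norm_num)]
  norm_num

theorem hadamard_mem_unitaryGroup : hadamard ∈ Matrix.unitaryGroup (Fin 2) ℂ := by
  rw [Matrix.mem_unitaryGroup_iff]
  have h := sqrt_two_inv_mul_self
  ext i j
  fin_cases i <;> fin_cases j <;>
    simp only [hadamard, star_eq_conjTranspose, Matrix.mul_apply, Fin.sum_univ_two] <;>
    simp [h] <;> norm_num

variable {n a b : ℕ} {Y : Type} [Fintype Y] [DecidableEq Y]

/-- A Hadamard test with a random power of a unitary. -/
theorem QubitTest.of_ctrl {k l w : ℕ} (hw : Fintype.card Y = 2 ^ w) (y : Y)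
    {F W : Oracle n a → Oracle n b → Matrix Y Y ℂ} (hF : Impl n a b k F) (hW : Ctrl n a b l W)
    {μ : ℕ} {q : Fin (2 ^ μ) → ℝ} (hq : ∀ t, 0 ≤ q t) (hq1 : ∑ t, q t = 1)
    {s : Fin (2 ^ μ) → ℝ} (hs : ∀ t, s t = 1 ∨ s t = -1) {p : Fin (2 ^ μ) → ℕ} {N : ℕ}
    (hp : ∀ t, p t ≤ N) :
    QubitTest n a b (k + N * l) (fun Uρ Uσ => ∑ t, q t * (s t *
      (star (F Uρ Uσ *ᵥ Pi.single y 1) ⬝ᵥ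
        ((W Uρ Uσ ^ p t) *ᵥ (F Uρ Uσ *ᵥ Pi.single y 1))).re)) := by
  have : NeZero (2 ^ μ) := ⟨by positivity⟩
  -- The random exponent is purified with amplitudes √(q t). The register t is afterwards only a
  -- control and its branches never interfere, so the bias is the average over q. The second factor
  -- is the qubit of the Hadamard test.
  obtain ⟨Qa, hQa, hQa'⟩ := exists_unitary_mulVec_single
    (fun z : Fin (2 ^ μ) × Fin 2 => ((√(q z.1) : ℝ) : ℂ) * ((√2 : ℝ) : ℂ)⁻¹) (by
      rw [Fintype.sum_prod_type, ← hq1]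
      refine Finset.sum_congr rfl fun t _ => ?_
      simp [mul_pow, Real.sq_sqrt (hq t)]
      ring) (0, 0)
  -- The sign s t is a phase on the branch that carries the power of W.
  set D : Matrix (Fin (2 ^ μ) × Fin 2) (Fin (2 ^ μ) × Fin 2) ℂ :=
    diagonal fun z => if z.2 = 0 then 1 else (s z.1 : ℂ) with hD
  have hDu : D ∈ Matrix.unitaryGroup _ ℂ := diagonal_sign_mem_unitaryGroup fun z => by
    by_cases h : z.2 = 0
    · simp [h]
    · rcases hs z.1 with h' | h' <;> simp [h, h']
  set K : Matrix (Fin (2 ^ μ) × Fin 2) (Fin (2 ^ μ) × Fin 2) ℂ :=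
    ((1 : Matrix (Fin (2 ^ μ)) (Fin (2 ^ μ)) ℂ) ⊗ₖ hadamard) * D with hK
  have hKu : K ∈ Matrix.unitaryGroup _ ℂ :=
    mul_mem (Matrix.kronecker_mem_unitary (one_mem _) hadamard_mem_unitaryGroup) hDu
  have himpl := (((Impl.free' (n := n) (a := a) (b := b) K hKu).one_kron Y).mul
    ((hW.pow (fun z : Fin (2 ^ μ) × Fin 2 => if z.2 = 0 then 0 else p z.1) N).mul
      ((hF.kron_one (Fin (2 ^ μ) × Fin 2)).mul ((Impl.free' Qa hQa).one_kron Y)))).reindex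
        (Equiv.prodAssoc Y (Fin (2 ^ μ)) (Fin 2)).symm
  refine ⟨Y × Fin (2 ^ μ), inferInstance, inferInstance, w + μ, (y, 0), _,
    by simp [hw, pow_add], himpl.cast (by ring), fun Uρ Uσ => ?_⟩
  set φ := F Uρ Uσ *ᵥ Pi.single y 1 with hφ
  rw [reindex_mulVec_single (y := (y, (0, 0))) (z := ((y, 0), 0))
    (Equiv.prodAssoc Y (Fin (2 ^ μ)) (Fin 2)).symm _ rfl]
  have hK' : ∀ (v : Fin (2 ^ μ) × Fin 2 → ℂ) (t : Fin (2 ^ μ)) (x : Fin 2), (K *ᵥ v) (t, x) =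
      ((√2 : ℝ) : ℂ)⁻¹ * (v (t, 0) + (if x = 0 then 1 else -1) * (s t * v (t, 1))) := by
    intro v t x
    rw [hK, ← mulVec_mulVec, one_kronecker_mulVec_apply]
    fin_cases x <;> simp [hadamard, hD, mulVec, dotProduct, Fin.sum_univ_two, diagonal_apply] <;>
      ring
  have hfin : ∀ (x : Y) (t : Fin (2 ^ μ)) (u : Fin 2),
      ((((1 : Matrix Y Y ℂ) ⊗ₖ K) * ((blockDiagonal fun z : Fin (2 ^ μ) × Fin 2 =>
        W Uρ Uσ ^ min (if z.2 = 0 then 0 else p z.1) N) * (F Uρ Uσ ⊗ₖ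
          (1 : Matrix (Fin (2 ^ μ) × Fin 2) (Fin (2 ^ μ) × Fin 2) ℂ) * ((1 : Matrix Y Y ℂ) ⊗ₖ Qa))))
          *ᵥ Pi.single (y, (0, 0)) 1) (x, (t, u)) =
        ((√(q t) : ℝ) : ℂ) / 2 *
          (φ x + (if u = 0 then 1 else -1) * (s t * ((W Uρ Uσ ^ p t) *ᵥ φ) x)) := by
    intro x t u
    rw [← mulVec_mulVec, one_kronecker_mulVec_apply, hK']
    have hin : ∀ z : Fin (2 ^ μ) × Fin 2, (((blockDiagonal fun z : Fin (2 ^ μ) × Fin 2 =>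
        W Uρ Uσ ^ min (if z.2 = 0 then 0 else p z.1) N) * (F Uρ Uσ ⊗ₖ
          (1 : Matrix (Fin (2 ^ μ) × Fin 2) (Fin (2 ^ μ) × Fin 2) ℂ) * ((1 : Matrix Y Y ℂ) ⊗ₖ Qa)))
          *ᵥ Pi.single (y, (0, 0)) 1) (x, z) = ((√(q z.1) : ℝ) : ℂ) * ((√2 : ℝ) : ℂ)⁻¹ *
            ((W Uρ Uσ ^ (if z.2 = 0 then 0 else p z.1)) *ᵥ φ) x := by
      intro z
      have hz : (if z.2 = 0 then 0 else p z.1) ≤ N := by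
        split_ifs
        exacts [Nat.zero_le _, hp _]
      rw [← mulVec_mulVec, ← mul_kronecker_mul, one_mul, mul_one, kronecker_mulVec_single, hQa',
        blockDiagonal_mulVec_apply, min_eq_left hz, ← hφ]
      have : (fun x' => φ x' * (((√(q z.1) : ℝ) : ℂ) * ((√2 : ℝ) : ℂ)⁻¹)) =
          (((√(q z.1) : ℝ) : ℂ) * ((√2 : ℝ) : ℂ)⁻¹) • φ := by
        ext
        simp [mul_comm]
      simp only [this, mulVec_smul, Pi.smul_apply, smul_eq_mul]
    rw [hin, hin]
    simp only [if_true, one_ne_zero, if_false, pow_zero, one_mulVec]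
    linear_combination ((√(q t) : ℝ) : ℂ) *
      (φ x + (if u = 0 then 1 else -1) * (s t * ((W Uρ Uσ ^ p t) *ᵥ φ) x)) * sqrt_two_inv_mul_self
  have hdiff : ∀ (x : Y) (t : Fin (2 ^ μ)),
      ‖((√(q t) : ℝ) : ℂ) / 2 * (φ x + 1 * (s t * ((W Uρ Uσ ^ p t) *ᵥ φ) x))‖ ^ 2 -
        ‖((√(q t) : ℝ) : ℂ) / 2 * (φ x + (-1) * (s t * ((W Uρ Uσ ^ p t) *ᵥ φ) x))‖ ^ 2 =
      q t * (s t * (star (φ x) * ((W Uρ Uσ ^ p t) *ᵥ φ) x).re) := by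
    intro x t
    have h1 : ‖((√(q t) : ℝ) : ℂ) / 2‖ ^ 2 = q t / 4 := by
      rw [norm_div, div_pow, Complex.norm_real, Real.norm_eq_abs, sq_abs, Real.sq_sqrt (hq t)]
      norm_num
    rw [norm_mul, norm_mul, mul_pow, mul_pow, h1, ← Complex.normSq_eq_norm_sq,
      ← Complex.normSq_eq_norm_sq]
    simp only [Complex.normSq_apply, Complex.add_re, Complex.add_im, Complex.mul_re,
      Complex.mul_im, Complex.ofReal_re, Complex.ofReal_im, Complex.star_def, Complex.conj_re,
      Complex.conj_im, Complex.one_re, Complex.one_im, Complex.neg_re, Complex.neg_im]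
    ring
  rw [Fintype.sum_prod_type, Finset.sum_comm]
  refine Finset.sum_congr rfl fun t _ => ?_
  rw [dotProduct, Complex.re_sum, Finset.mul_sum, Finset.mul_sum]
  refine Finset.sum_congr rfl fun x _ => ?_
  have e0 := hfin x t 0
  have e1 := hfin x t 1
  simp only [if_true, one_ne_zero, if_false] at e0 e1
  exact (congrArg₂ (fun u v : ℂ => ‖u‖ ^ 2 - ‖v‖ ^ 2) e0 e1).trans (hdiff x t)

end HadamardTest

/-! ### Binomial expansion and its truncation -/

section Binomial

/-- The symmetric binomial distribution on `2k` steps. -/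
def binomWeight (k j : ℕ) : ℝ := (Nat.choose (2 * k) j : ℝ) / 4 ^ k

/-- The distance of `j` and `k`. -/
def natDist (k j : ℕ) : ℕ := (j - k) + (k - j)

theorem binomWeight_nonneg (k j : ℕ) : 0 ≤ binomWeight k j := by
  unfold binomWeight
  positivity

theorem sum_binomWeight (k : ℕ) : ∑ j ∈ Finset.range (2 * k + 1), binomWeight k j = 1 := by
  simp only [binomWeight]
  rw [← Finset.sum_div, div_eq_one_iff_eq (by positivity)]
  have := Nat.sum_range_choose (2 * k)
  rw [show (4 : ℝ) ^ k = 2 ^ (2 * k) by rw [pow_mul]; norm_num]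
  exact_mod_cast this

/-- The moment generating function. -/
theorem sum_binomWeight_mul_exp_le (k : ℕ) (s : ℝ) :
    ∑ j ∈ Finset.range (2 * k + 1), binomWeight k j * Real.exp (s * ((j : ℝ) - k)) ≤
      Real.exp (s ^ 2 * k / 4) := by
  have h1 : ∑ j ∈ Finset.range (2 * k + 1), binomWeight k j * Real.exp (s * ((j : ℝ) - k)) =
      Real.cosh (s / 2) ^ (2 * k) := by
    rw [Real.cosh_eq, div_pow, add_pow, Finset.sum_div]
    refine Finset.sum_congr rfl fun j hj => ?_
    have hj' : j ≤ 2 * k := by simpa [Nat.lt_succ_iff] using hj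
    rw [← Real.exp_nat_mul, ← Real.exp_nat_mul, ← Real.exp_add, binomWeight,
      show (2 : ℝ) ^ (2 * k) = 4 ^ k by rw [pow_mul]; norm_num]
    have : (j : ℝ) * (s / 2) + ((2 * k - j : ℕ) : ℝ) * -(s / 2) = s * ((j : ℝ) - k) := by
      rw [Nat.cast_sub hj']
      push_cast
      ring
    rw [this]
    ring
  rw [h1]
  refine (pow_le_pow_left₀ (Real.cosh_pos _).le (Real.cosh_le_exp_half_sq _) _).trans (le_of_eq ?_)
  rw [← Real.exp_nat_mul]
  push_cast
  congr 1
  ring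

/-- Chernoff's bound, applied to the two tails separately. -/
theorem sum_binomWeight_tail_le {k m : ℕ} (hk : 0 < k) :
    ∑ j ∈ Finset.range (2 * k + 1), (if m < natDist k j then binomWeight k j else 0) ≤
      2 * Real.exp (-((m : ℝ) ^ 2 / k)) := by
  have hk' : (0 : ℝ) < k := by exact_mod_cast hk
  -- This minimizes the exponent −sm + s²k/4; the minimum is −m²/k.
  set s : ℝ := 2 * m / k with hs
  have hs0 : 0 ≤ s := by positivity
  have h1 : ∀ j, (if m < natDist k j then binomWeight k j else 0) ≤
      Real.exp (-(s * m)) * (binomWeight k j * Real.exp (s * ((j : ℝ) - k)) +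
        binomWeight k j * Real.exp (-s * ((j : ℝ) - k))) := by
    intro j
    have hb := binomWeight_nonneg k j
    have h0 : 0 ≤ Real.exp (-(s * m)) * (binomWeight k j * Real.exp (s * ((j : ℝ) - k)) +
        binomWeight k j * Real.exp (-s * ((j : ℝ) - k))) := by positivity
    split_ifs with h
    · have h2 : 1 ≤ Real.exp (-(s * m)) * Real.exp (s * ((j : ℝ) - k)) +
          Real.exp (-(s * m)) * Real.exp (-s * ((j : ℝ) - k)) := by
        rw [← Real.exp_add, ← Real.exp_add]
        unfold natDist at h
        rcases le_total k j with hkj | hkj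
        · have h3 : (m : ℝ) ≤ (j : ℝ) - k := by
            rw [← Nat.cast_sub hkj]
            exact_mod_cast (by omega)
          have : 0 ≤ -(s * m) + s * ((j : ℝ) - k) := by nlinarith
          have := Real.one_le_exp this
          have := Real.exp_pos (-(s * m) + -s * ((j : ℝ) - k))
          linarith
        · have h3 : (m : ℝ) ≤ (k : ℝ) - j := by
            rw [← Nat.cast_sub hkj]
            exact_mod_cast (by omega)
          have : 0 ≤ -(s * m) + -s * ((j : ℝ) - k) := by nlinarith
          have := Real.one_le_exp this
          have := Real.exp_pos (-(s * m) + s * ((j : ℝ) - k))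
          linarith
      nlinarith
    · exact h0
  refine (Finset.sum_le_sum fun j _ => h1 j).trans ?_
  rw [← Finset.mul_sum, Finset.sum_add_distrib]
  have h2 := sum_binomWeight_mul_exp_le k s
  have h3 := sum_binomWeight_mul_exp_le k (-s)
  rw [neg_sq] at h3
  calc Real.exp (-(s * m)) * _ ≤ Real.exp (-(s * m)) *
        (Real.exp (s ^ 2 * k / 4) + Real.exp (s ^ 2 * k / 4)) := by gcongr
    _ = 2 * (Real.exp (-(s * m)) * Real.exp (s ^ 2 * k / 4)) := by ring
    _ = _ := by
      rw [← Real.exp_add]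
      congr 2
      rw [hs]
      field_simp
      ring

variable {Y : Type} [Fintype Y] [DecidableEq Y]

/-- The signed real parts of the matrix elements of even powers of `W`. -/
def evenCoeff (W : Matrix Y Y ℂ) (φ : Y → ℂ) (t : ℕ) : ℝ :=
  (-1) ^ t * (star φ ⬝ᵥ ((W ^ (2 * t)) *ᵥ φ)).re

theorem abs_evenCoeff_le {W : Matrix Y Y ℂ} (hW : W ∈ Matrix.unitaryGroup Y ℂ) {φ : Y → ℂ}
    (hφ : ∑ y, ‖φ y‖ ^ 2 = 1) (t : ℕ) : |evenCoeff W φ t| ≤ 1 := by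
  rw [evenCoeff, abs_mul, abs_pow, abs_neg, abs_one, one_pow, one_mul]
  refine (Complex.abs_re_le_norm _).trans ((norm_sum_le _ _).trans ?_)
  have h1 := sum_norm_sq_mulVec (pow_mem hW (2 * t)) φ
  rw [hφ] at h1
  calc ∑ y, ‖(star φ) y * ((W ^ (2 * t)) *ᵥ φ) y‖
      ≤ ∑ y, (‖φ y‖ ^ 2 + ‖((W ^ (2 * t)) *ᵥ φ) y‖ ^ 2) / 2 := by
        refine Finset.sum_le_sum fun y _ => ?_
        rw [norm_mul, Pi.star_apply, norm_star]
        nlinarith [sq_nonneg (‖φ y‖ - ‖((W ^ (2 * t)) *ᵥ φ) y‖)]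
    _ = 1 := by
        rw [← Finset.sum_div, Finset.sum_add_distrib, hφ, h1]
        norm_num

theorem re_star_dotProduct_conjTranspose {Y : Type} [Fintype Y] (A : Matrix Y Y ℂ) (φ : Y → ℂ) :
    (star φ ⬝ᵥ (Aᴴ *ᵥ φ)).re = (star φ ⬝ᵥ (A *ᵥ φ)).re := by
  have : star φ ⬝ᵥ (Aᴴ *ᵥ φ) = star (star φ ⬝ᵥ (A *ᵥ φ)) := by
    rw [dotProduct_mulVec, ← star_mulVec, ← star_dotProduct_star, star_star]
  rw [this]
  rfl

/-- For S = −W² the operator 2 − W² − W†² equals S†(S + 1)², so its k-th power is S†^k (S + 1)^(2k),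
a binomial sum of the powers S^(j−k). Taking real parts identifies S^d with S^(−d), so that only |j
− k| matters. -/
theorem re_pow_eq_sum_binomWeight {W : Matrix Y Y ℂ} (hW : W ∈ Matrix.unitaryGroup Y ℂ)
    (φ : Y → ℂ) (k : ℕ) :
    (star φ ⬝ᵥ (((1 / 4 : ℂ) • (2 - W ^ 2 - Wᴴ ^ 2)) ^ k *ᵥ φ)).re =
      ∑ j ∈ Finset.range (2 * k + 1), binomWeight k j * evenCoeff W φ (natDist k j) := by
  set S : Matrix Y Y ℂ := -W ^ 2 with hS
  have hW1 : Wᴴ * W = 1 := Matrix.mem_unitaryGroup_iff'.1 hW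
  have hS1 : Sᴴ * S = 1 := by
    rw [hS, conjTranspose_neg, neg_mul_neg, conjTranspose_pow, sq, sq, Matrix.mul_assoc,
      ← Matrix.mul_assoc Wᴴ W W, hW1, one_mul, hW1]
  have hS2 : S * Sᴴ = 1 := mul_eq_one_comm.1 hS1
  have hcomm : Commute Sᴴ S := by rw [Commute, SemiconjBy, hS1, hS2]
  have hE : (2 - W ^ 2 - Wᴴ ^ 2) = Sᴴ * (S + 1) ^ 2 := by
    rw [show (S + 1) ^ 2 = S * S + 2 * S + 1 by noncomm_ring, mul_add, mul_add, ← Matrix.mul_assoc,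
      hS1, two_mul, mul_add, hS1, hS, conjTranspose_neg, conjTranspose_pow,
      ← one_add_one_eq_two]
    noncomm_ring
  have hSt : ∀ t, (star φ ⬝ᵥ ((S ^ t) *ᵥ φ)).re = evenCoeff W φ t := by
    intro t
    rw [hS, neg_pow, ← pow_mul, evenCoeff]
    rcases Nat.even_or_odd t with ht | ht
    · rw [ht.neg_one_pow, ht.neg_one_pow, one_mul, one_mul]
    · rw [ht.neg_one_pow, ht.neg_one_pow, neg_one_mul, neg_one_mul, neg_mulVec, dotProduct_neg,
        Complex.neg_re]
  have hterm : ∀ j, (star φ ⬝ᵥ ((Sᴴ ^ k * S ^ j) *ᵥ φ)).re = evenCoeff W φ (natDist k j) := by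
    intro j
    rcases le_total k j with hkj | hkj
    · obtain ⟨d, rfl⟩ := Nat.exists_eq_add_of_le hkj
      rw [pow_add, ← Matrix.mul_assoc, ← hcomm.mul_pow, hS1, one_pow, one_mul, hSt]
      congr 1
      unfold natDist
      omega
    · obtain ⟨d, rfl⟩ := Nat.exists_eq_add_of_le hkj
      rw [add_comm j d, pow_add, Matrix.mul_assoc, ← hcomm.mul_pow, hS1, one_pow, mul_one,
        ← conjTranspose_pow, re_star_dotProduct_conjTranspose, hSt]
      congr 1
      unfold natDist
      omega
  have hexp : ((1 / 4 : ℂ) • (2 - W ^ 2 - Wᴴ ^ 2)) ^ k =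
      ∑ j ∈ Finset.range (2 * k + 1), (binomWeight k j : ℂ) • (Sᴴ ^ k * S ^ j) := by
    have h3 : Commute Sᴴ ((S + 1) ^ 2) := (hcomm.add_right (Commute.one_right _)).pow_right 2
    rw [smul_pow, hE, h3.mul_pow, ← pow_mul, (Commute.one_right S).add_pow, Finset.mul_sum,
      Finset.smul_sum]
    refine Finset.sum_congr rfl fun j _ => ?_
    rw [one_pow, mul_one, binomWeight, ← nsmul_eq_mul', mul_smul_comm, ← Nat.cast_smul_eq_nsmul ℂ,
      smul_smul]
    congr 1
    push_cast
    rw [one_div, inv_pow]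
    ring
  rw [hexp, sum_mulVec, dotProduct_sum, Complex.re_sum]
  refine Finset.sum_congr rfl fun j _ => ?_
  rw [smul_mulVec, dotProduct_smul, smul_eq_mul, Complex.re_ofReal_mul, hterm]

/-- The distribution of the truncated distance, averaged with the weights `1 / k`. -/
def stepWeight (A B m t : ℕ) : ℝ :=
  (∑ k ∈ Finset.Ico A B, (1 / (k : ℝ)))⁻¹ * ∑ k ∈ Finset.Ico A B, (1 / (k : ℝ)) *
    ∑ j ∈ Finset.range (2 * k + 1), if min (natDist k j) m = t then binomWeight k j else 0

theorem stepWeight_nonneg (A B m t : ℕ) : 0 ≤ stepWeight A B m t := by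
  refine mul_nonneg (inv_nonneg.2 (Finset.sum_nonneg fun k _ => by positivity))
    (Finset.sum_nonneg fun k _ => mul_nonneg (by positivity) (Finset.sum_nonneg fun j _ => ?_))
  split_ifs
  exacts [binomWeight_nonneg k j, le_rfl]

theorem sum_one_div_pos {A B : ℕ} (hA : 0 < A) (hAB : A < B) :
    0 < ∑ k ∈ Finset.Ico A B, (1 / (k : ℝ)) :=
  Finset.sum_pos (fun k hk => by
    have : 0 < k := lt_of_lt_of_le hA (Finset.mem_Ico.1 hk).1
    positivity) ⟨A, by simpa using hAB⟩

/-- Mass beyond m is moved to m and not discarded, so the weights form a probability distribution,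
and expectations can be computed before the distance is truncated. -/
theorem sum_mul_sum_stepWeight {A B m N : ℕ} (hA : 0 < A) (hAB : A < B) (hm : m < N)
    (f : ℕ → ℝ) :
    (∑ k ∈ Finset.Ico A B, (1 / (k : ℝ))) * ∑ t : Fin N, stepWeight A B m t * f t =
      ∑ k ∈ Finset.Ico A B, (1 / (k : ℝ)) *
        ∑ j ∈ Finset.range (2 * k + 1), binomWeight k j * f (min (natDist k j) m) := by
  have h0 := (sum_one_div_pos hA hAB).ne'
  rw [Fin.sum_univ_eq_sum_range (fun t => stepWeight A B m t * f t) N]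
  simp only [stepWeight, mul_assoc]
  rw [← Finset.mul_sum, mul_inv_cancel_left₀ h0]
  simp only [Finset.sum_mul]
  rw [Finset.sum_comm]
  refine Finset.sum_congr rfl fun k _ => ?_
  simp only [mul_assoc, ← Finset.mul_sum]
  congr 1
  simp only [Finset.sum_mul]
  rw [Finset.sum_comm]
  refine Finset.sum_congr rfl fun j _ => ?_
  have : min (natDist k j) m ∈ Finset.range N := Finset.mem_range.2 (by omega)
  simp only [ite_mul, zero_mul]
  rw [Finset.sum_ite_eq, if_pos this]

theorem sum_stepWeight {A B m N : ℕ} (hA : 0 < A) (hAB : A < B) (hm : m < N) :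
    ∑ t : Fin N, stepWeight A B m t = 1 := by
  have h := sum_mul_sum_stepWeight hA hAB hm fun _ => 1
  simp only [mul_one, sum_binomWeight] at h
  exact mul_left_cancel₀ (sum_one_div_pos hA hAB).ne' (h.trans (mul_one _).symm)

/-- The error of the truncation. -/
theorem abs_sum_stepWeight_sub_le {A B m N : ℕ} (hA : 0 < A) (hAB : A < B) (hm : m < N)
    {W : Matrix Y Y ℂ} (hW : W ∈ Matrix.unitaryGroup Y ℂ) {φ : Y → ℂ}
    (hφ : ∑ y, ‖φ y‖ ^ 2 = 1) :
    |(∑ k ∈ Finset.Ico A B, (1 / (k : ℝ))) *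
        ∑ t : Fin N, stepWeight A B m t * evenCoeff W φ t -
      ∑ k ∈ Finset.Ico A B, (1 / (k : ℝ)) *
        (star φ ⬝ᵥ (((1 / 4 : ℂ) • (2 - W ^ 2 - Wᴴ ^ 2)) ^ k *ᵥ φ)).re| ≤
      (∑ k ∈ Finset.Ico A B, (1 / (k : ℝ))) * (4 * Real.exp (-((m : ℝ) ^ 2 / B))) := by
  rw [sum_mul_sum_stepWeight hA hAB hm (evenCoeff W φ), ← Finset.sum_sub_distrib, Finset.sum_mul]
  refine (Finset.abs_sum_le_sum_abs _ _).trans (Finset.sum_le_sum fun k hk => ?_)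
  obtain ⟨hk1, hk2⟩ := Finset.mem_Ico.1 hk
  have hk0 : 0 < k := lt_of_lt_of_le hA hk1
  rw [re_pow_eq_sum_binomWeight hW, ← mul_sub, abs_mul, abs_of_nonneg (by positivity)]
  refine mul_le_mul_of_nonneg_left ?_ (by positivity)
  rw [← Finset.sum_sub_distrib]
  -- Truncation changes only the terms with distance above m, each by at most twice its weight. With
  -- the tail bound 2 exp(−m²/k) this gives the factor 4.
  have h1 : ∀ j, |binomWeight k j * evenCoeff W φ (min (natDist k j) m) -
      binomWeight k j * evenCoeff W φ (natDist k j)| ≤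
        2 * (if m < natDist k j then binomWeight k j else 0) := by
    intro j
    split_ifs with h
    · rw [← mul_sub, abs_mul, abs_of_nonneg (binomWeight_nonneg k j), mul_comm]
      refine mul_le_mul_of_nonneg_right ?_ (binomWeight_nonneg k j)
      refine (abs_sub _ _).trans ?_
      linarith [abs_evenCoeff_le hW hφ (min (natDist k j) m), abs_evenCoeff_le hW hφ (natDist k j)]
    · rw [min_eq_left (not_lt.1 h), sub_self, abs_zero, mul_zero]
  refine (Finset.abs_sum_le_sum_abs _ _).trans ((Finset.sum_le_sum fun j _ => h1 j).trans ?_)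
  rw [← Finset.mul_sum]
  have h2 := sum_binomWeight_tail_le (m := m) hk0
  have h3 : Real.exp (-((m : ℝ) ^ 2 / k)) ≤ Real.exp (-((m : ℝ) ^ 2 / B)) := by
    have : (0 : ℝ) < k := by exact_mod_cast hk0
    have : (k : ℝ) ≤ B := by exact_mod_cast hk2.le
    gcongr
  linarith

variable {n a b : ℕ}

/-- Estimating `∑ k ∈ [A, B), (1 / k) ⟨φ, E ^ k φ⟩` for `E = (2 - W² - W†²) / 4` with powers of `W`
of order up to `2 m`. -/
theorem QubitTest.of_walk {k l w : ℕ} (hw : Fintype.card Y = 2 ^ w) (y : Y)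
    {F W : Oracle n a → Oracle n b → Matrix Y Y ℂ} (hF : Impl n a b k F) (hW : Ctrl n a b l W)
    (hWu : ∀ Uρ Uσ, W Uρ Uσ ∈ Matrix.unitaryGroup Y ℂ) {A B : ℕ} (m : ℕ) (hA : 0 < A)
    (hAB : A < B) :
    ∃ c : Oracle n a → Oracle n b → ℝ, QubitTest n a b (k + 2 * m * l) c ∧ ∀ Uρ Uσ,
      |(∑ k ∈ Finset.Ico A B, (1 / (k : ℝ))) * c Uρ Uσ -
        ∑ k ∈ Finset.Ico A B, (1 / (k : ℝ)) * (star (F Uρ Uσ *ᵥ Pi.single y 1) ⬝ᵥ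
          (((1 / 4 : ℂ) • (2 - W Uρ Uσ ^ 2 - (W Uρ Uσ)ᴴ ^ 2)) ^ k *ᵥ
            (F Uρ Uσ *ᵥ Pi.single y 1))).re| ≤
      (∑ k ∈ Finset.Ico A B, (1 / (k : ℝ))) * (4 * Real.exp (-((m : ℝ) ^ 2 / B))) := by
  -- The exponent register must hold the values 0, …, m and have a power of two as its size; a
  -- generous size is harmless since only queries are counted.
  have hm : m < 2 ^ m := Nat.lt_two_pow_self
  refine ⟨_, QubitTest.of_ctrl hw y hF hW (μ := m) (q := fun t => stepWeight A B m t)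
    (fun t => stepWeight_nonneg A B m t) (sum_stepWeight hA hAB hm)
    (s := fun t => (-1) ^ (min (t : ℕ) m)) (fun t => neg_one_pow_eq_or ℝ _)
    (p := fun t => 2 * min (t : ℕ) m) (fun t => by have := min_le_right (t : ℕ) m; omega),
    fun Uρ Uσ => ?_⟩
  refine le_trans (le_of_eq ?_) (abs_sum_stepWeight_sub_le hA hAB hm (hWu Uρ Uσ)
    (sum_norm_sq_mulVec_single (hF.mem_unitaryGroup Uρ Uσ) y))
  congr 3
  refine Finset.sum_congr rfl fun t _ => ?_
  by_cases ht : (t : ℕ) ≤ m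
  · rw [evenCoeff, min_eq_left ht]
  · have : stepWeight A B m t = 0 := by
      rw [stepWeight]
      refine mul_eq_zero_of_right _ (Finset.sum_eq_zero fun k _ => mul_eq_zero_of_right _
        (Finset.sum_eq_zero fun j _ => if_neg ?_))
      have := min_le_right (natDist k j) m
      omega
    rw [this, zero_mul, zero_mul]

end Binomial

/-! ### The walk operator of a density matrix given by a purification -/

section Walk

variable {ι κ ν : Type} [Fintype ι] [DecidableEq ι] [Fintype κ] [DecidableEq κ] [Fintype ν]
  [DecidableEq ν]

theorem kronecker_one_mulVec_apply {X Z : Type} [Fintype X] [Fintype Z] [DecidableEq Z]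
    (A : Matrix X X ℂ) (v : X × Z → ℂ) (x : X) (z : Z) :
    ((A ⊗ₖ (1 : Matrix Z Z ℂ)) *ᵥ v) (x, z) = (A *ᵥ fun x' => v (x', z)) x := by
  rw [kronecker_one, blockDiagonal_mulVec_apply]

/-- The exchange of two registers of the same size. -/
def swapFirst (ι κ ν : Type) : Equiv.Perm ((ι × κ) × (ι × ν)) where
  toFun p := ((p.2.1, p.1.2), (p.1.1, p.2.2))
  invFun p := ((p.2.1, p.1.2), (p.1.1, p.2.2))
  left_inv _ := rfl
  right_inv _ := rfl

theorem swapFirst_inv {ι κ ν : Type} : (swapFirst ι κ ν)⁻¹ = swapFirst ι κ ν := rfl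

/-- A reflection whose block at the basis vector `o` of the first register is the reduced density
matrix of `U o`. -/
def blockReflection (ν : Type) [Fintype ν] [DecidableEq ν] (U : Matrix (ι × κ) (ι × κ) ℂ) :
    Matrix ((ι × κ) × (ι × ν)) ((ι × κ) × (ι × ν)) ℂ :=
  (Uᴴ ⊗ₖ (1 : Matrix (ι × ν) (ι × ν) ℂ)) * (swapFirst ι κ ν).permMatrix ℂ *
    (Uᴴ ⊗ₖ (1 : Matrix (ι × ν) (ι × ν) ℂ))ᴴ

/-- The walk operator. -/
def walk (ν : Type) [Fintype ν] [DecidableEq ν] (o : ι × κ) (U : Matrix (ι × κ) (ι × κ) ℂ) :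
    Matrix ((ι × κ) × (ι × ν)) ((ι × κ) × (ι × ν)) ℂ :=
  (reflect o ⊗ₖ (1 : Matrix (ι × ν) (ι × ν) ℂ)) * blockReflection ν U

/-- Adjoin the basis vector `o` in front. -/
def inject {X Z : Type} [DecidableEq X] (o : X) (v : Z → ℂ) : X × Z → ℂ :=
  fun p => if p.1 = o then v p.2 else 0

theorem reflect_kronecker_mulVec {X Z : Type} [Fintype X] [DecidableEq X] [Fintype Z]
    [DecidableEq Z] (o : X) (u : X × Z → ℂ) :
    (reflect o ⊗ₖ (1 : Matrix Z Z ℂ)) *ᵥ u = (2 : ℂ) • inject o (fun z => u (o, z)) - u := by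
  ext ⟨x, z⟩
  rw [kronecker_one_mulVec_apply, reflect_mulVec]
  by_cases h : x = o <;> simp [inject, h]

theorem blockReflection_conjTranspose (U : Matrix (ι × κ) (ι × κ) ℂ) :
    (blockReflection ν U)ᴴ = blockReflection ν U := by
  rw [blockReflection, conjTranspose_mul, conjTranspose_mul, conjTranspose_conjTranspose,
    conjTranspose_permMatrix, swapFirst_inv, Matrix.mul_assoc]

theorem blockReflection_mem_unitaryGroup {U : Matrix (ι × κ) (ι × κ) ℂ}
    (hU : U ∈ Matrix.unitaryGroup (ι × κ) ℂ) :
    blockReflection ν U ∈ Matrix.unitaryGroup _ ℂ :=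
  have h := kronecker_one_mem_unitaryGroup (Z := ι × ν) (conjTranspose_mem_unitaryGroup hU)
  mul_mem (mul_mem h (permMatrix_mem_unitaryGroup _)) (conjTranspose_mem_unitaryGroup h)

theorem walk_mem_unitaryGroup (o : ι × κ) {U : Matrix (ι × κ) (ι × κ) ℂ}
    (hU : U ∈ Matrix.unitaryGroup (ι × κ) ℂ) : walk ν o U ∈ Matrix.unitaryGroup _ ℂ :=
  mul_mem (kronecker_one_mem_unitaryGroup (reflect_mem_unitaryGroup o))
    (blockReflection_mem_unitaryGroup hU)

/-- The reduced density matrix of the pure state `ψ`. -/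
def reduced {ι κ : Type} [Fintype κ] (ψ : ι × κ → ℂ) : Matrix ι ι ℂ := partialTraceB (vecMulVec ψ (star ψ))

theorem reduced_apply {ι κ : Type} [Fintype κ] (ψ : ι × κ → ℂ) (i j : ι) :
    reduced ψ i j = ∑ k, ψ (i, k) * star (ψ (j, k)) := rfl

/-- The swap puts v in place of the A-part of ψ = U o, and ψ's A-part in the outer register. Pairing
with the other copy of ψ contracts the purifying register, leaving Σ_k ψ(y,k) conj ψ(x,k) as the
kernel acting on v. -/
theorem blockReflection_mulVec_inject (o : ι × κ) (U : Matrix (ι × κ) (ι × κ) ℂ)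
    (v : ι × ν → ℂ) (p : ι × ν) :
    (blockReflection ν U *ᵥ inject o v) (o, p) =
      ((reduced (U *ᵥ Pi.single o 1) ⊗ₖ (1 : Matrix ν ν ℂ)) *ᵥ v) p := by
  obtain ⟨y, s⟩ := p
  set ψ := U *ᵥ Pi.single o 1 with hψ
  have hψ' : ∀ x, U x o = ψ x := fun x => by simp [hψ]
  have h1 : ∀ x (p : ι × ν), ((U ⊗ₖ (1 : Matrix (ι × ν) (ι × ν) ℂ)) *ᵥ inject o v) (x, p) =
      ψ x * v p := by
    intro x p
    rw [kronecker_one_mulVec_apply]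
    simp [mulVec, dotProduct, inject, hψ']
  rw [blockReflection, conjTranspose_kronecker, conjTranspose_conjTranspose, conjTranspose_one,
    ← mulVec_mulVec, ← mulVec_mulVec, kronecker_one_mulVec_apply, permMatrix_mulVec,
    kronecker_one_mulVec_apply,
    show (fun x' => (((U ⊗ₖ (1 : Matrix (ι × ν) (ι × ν) ℂ)) *ᵥ inject o v) ∘ swapFirst ι κ ν)
      (x', y, s)) = fun x' => ψ (y, x'.2) * v (x'.1, s) from funext fun x' => h1 _ _]
  simp only [mulVec, dotProduct,
    conjTranspose_apply, hψ', Fintype.sum_prod_type, reduced_apply, Finset.sum_mul]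
  refine Finset.sum_congr rfl fun x _ => Finset.sum_congr rfl fun k _ => ?_
  ring

/-- With Π the projection on the basis vector o and R the block reflection, (2Π − 1)R + R(2Π − 1)
acts on the range of Π as 2ΠR, and ΠRΠ is the block τ. -/
theorem walk_add_mulVec_inject (o : ι × κ) (U : Matrix (ι × κ) (ι × κ) ℂ) (v : ι × ν → ℂ) :
    (walk ν o U + (walk ν o U)ᴴ) *ᵥ inject o v =
      (2 : ℂ) • inject o ((reduced (U *ᵥ Pi.single o 1) ⊗ₖ (1 : Matrix ν ν ℂ)) *ᵥ v) := by
  have h1 : (reflect o ⊗ₖ (1 : Matrix (ι × ν) (ι × ν) ℂ)) *ᵥ inject o v = inject o v := by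
    rw [reflect_kronecker_mulVec]
    ext ⟨x, z⟩
    by_cases h : x = o
    · simp [inject, h]
      ring
    · simp [inject, h]
  rw [add_mulVec, walk, conjTranspose_mul, blockReflection_conjTranspose, conjTranspose_kronecker,
    reflect_conjTranspose, conjTranspose_one, ← mulVec_mulVec, ← mulVec_mulVec, h1,
    reflect_kronecker_mulVec, sub_add_cancel]
  congr 2
  funext p
  exact blockReflection_mulVec_inject o U v p

/-- The matrix elements of `E ^ k`, where `E = (2 - W² - W†²) / 4`. -/
theorem star_inject_dotProduct_walk (o : ι × κ) {U : Matrix (ι × κ) (ι × κ) ℂ}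
    (hU : U ∈ Matrix.unitaryGroup (ι × κ) ℂ) (v : ι × ν → ℂ) (k : ℕ) :
    star (inject o v) ⬝ᵥ (((1 / 4 : ℂ) • (2 - walk ν o U ^ 2 - (walk ν o U)ᴴ ^ 2)) ^ k *ᵥ
      inject o v) =
      ((1 - reduced (U *ᵥ Pi.single o 1) ^ 2) ^ k * reduced v).trace := by
  set τ := reduced (U *ᵥ Pi.single o 1) with hτ
  set W := walk ν o U with hW
  have hWu : W ∈ Matrix.unitaryGroup _ ℂ := walk_mem_unitaryGroup o hU
  have h1 : W * Wᴴ = 1 := Matrix.mem_unitaryGroup_iff.1 hWu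
  have h2 : Wᴴ * W = 1 := Matrix.mem_unitaryGroup_iff'.1 hWu
  -- Since W is unitary, (W + W†)² = W² + W†² + 2. Hence E preserves the vectors `inject o u`, and
  -- its powers reduce to powers of 1 − τ².
  have hE : (1 / 4 : ℂ) • (2 - W ^ 2 - Wᴴ ^ 2) = 1 - (1 / 4 : ℂ) • ((W + Wᴴ) * (W + Wᴴ)) := by
    rw [add_mul, mul_add, mul_add, h1, h2, sq, sq]
    have : (2 : Matrix ((ι × κ) × (ι × ν)) ((ι × κ) × (ι × ν)) ℂ) = 1 + 1 :=
      one_add_one_eq_two.symm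
    rw [this]
    module
  have hEv : ∀ u : ι × ν → ℂ, (1 - (1 / 4 : ℂ) • ((W + Wᴴ) * (W + Wᴴ))) *ᵥ inject o u =
      inject o (((1 - τ ^ 2) ⊗ₖ (1 : Matrix ν ν ℂ)) *ᵥ u) := by
    intro u
    have h4 : (1 - τ ^ 2) ⊗ₖ (1 : Matrix ν ν ℂ) =
        1 - (τ ⊗ₖ (1 : Matrix ν ν ℂ)) * (τ ⊗ₖ (1 : Matrix ν ν ℂ)) := by
      rw [← mul_kronecker_mul, mul_one, sq, sub_eq_add_neg, add_kronecker, one_kronecker_one,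
        ← neg_one_smul ℂ (τ * τ), smul_kronecker, neg_one_smul, ← sub_eq_add_neg]
    have h5 : ∀ u : ι × ν → ℂ, (W + Wᴴ) *ᵥ inject o u =
        (2 : ℂ) • inject o ((τ ⊗ₖ (1 : Matrix ν ν ℂ)) *ᵥ u) := walk_add_mulVec_inject o U
    rw [sub_mulVec, smul_mulVec, ← mulVec_mulVec, h5, mulVec_smul, h5, h4, sub_mulVec, one_mulVec, one_mulVec, ← mulVec_mulVec]
    ext p
    by_cases h : p.1 = o
    · simp [inject, h]
      ring
    · simp [inject, h]
  have hpow : ∀ k, ((1 / 4 : ℂ) • (2 - W ^ 2 - Wᴴ ^ 2)) ^ k *ᵥ inject o v =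
      inject o ((((1 - τ ^ 2) ^ k) ⊗ₖ (1 : Matrix ν ν ℂ)) *ᵥ v) := by
    intro k
    induction k with
    | zero => simp
    | succ k ih =>
      rw [pow_succ', ← mulVec_mulVec, ih, hE, hEv, mulVec_mulVec, ← mul_kronecker_mul, one_mul,
        ← pow_succ']
  rw [hpow]
  have hin : ∀ u u' : ι × ν → ℂ, star (inject o u) ⬝ᵥ inject o u' = star u ⬝ᵥ u' := by
    intro u u'
    rw [dotProduct, Fintype.sum_prod_type, Fintype.sum_eq_single o]
    · simp [inject, dotProduct]
    · intro x hx
      simp [inject, hx]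
  rw [hin]
  generalize (1 - τ ^ 2) ^ k = A
  have hA : ∀ i s, ((A ⊗ₖ (1 : Matrix ν ν ℂ)) *ᵥ v) (i, s) = ∑ j, A i j * v (j, s) :=
    fun i s => kronecker_one_mulVec_apply A v i s
  simp only [dotProduct, Matrix.trace, diag_apply, Matrix.mul_apply, reduced_apply,
    Fintype.sum_prod_type, hA, Finset.mul_sum, Pi.star_apply]
  refine Finset.sum_congr rfl fun i _ => ?_
  rw [Finset.sum_comm]
  refine Finset.sum_congr rfl fun j _ => Finset.sum_congr rfl fun s _ => ?_
  ring

variable {n a b : ℕ}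

theorem impl_rho : Impl n a b 1 (fun (Uρ : Oracle n a) _ => Uρ.1) :=
  (Impl.rho (Equiv.prodUnique _ Unit)).congr fun _ _ => by
    ext
    simp

theorem impl_sigma : Impl n a b 1 (fun _ (Uσ : Oracle n b) => Uσ.1) :=
  (Impl.sigma (Equiv.prodUnique _ Unit)).congr fun _ _ => by
    ext
    simp

theorem isPurifiedOracle_iff {c : ℕ} (U : Oracle n c) (ρ : Matrix (Qubits n) (Qubits n) ℂ) :
    IsPurifiedOracle U ρ ↔ reduced (U.1 *ᵥ Pi.single 0 1) = ρ := Iff.rfl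

/-- A test for a part of the power series of the logarithm of the density matrix with purified
query oracle `T`, in the state with purified query oracle `Uρ`. -/
theorem exists_qubitTest {c : ℕ} {T : Oracle n a → Oracle n b → Oracle n c}
    (hT : Impl n a b 1 (fun Uρ Uσ => (T Uρ Uσ).1)) {A B : ℕ} (m : ℕ) (hA : 0 < A) (hAB : A < B) :
    ∃ p : Oracle n a → Oracle n b → ℝ, QubitTest n a b (1 + 4 * m) p ∧ ∀ Uρ Uσ,
      ∀ ρ τ : Matrix (Qubits n) (Qubits n) ℂ, IsPurifiedOracle Uρ ρ →
        IsPurifiedOracle (T Uρ Uσ) τ →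
        |(∑ k ∈ Finset.Ico A B, (1 / (k : ℝ))) * p Uρ Uσ -
          ∑ k ∈ Finset.Ico A B, (1 / (k : ℝ)) * ((1 - τ ^ 2) ^ k * ρ).trace.re| ≤
        (∑ k ∈ Finset.Ico A B, (1 / (k : ℝ))) * (4 * Real.exp (-((m : ℝ) ^ 2 / B))) := by
  have hF : Impl n a b 1 (fun (Uρ : Oracle n a) (_ : Oracle n b) =>
      (1 : Matrix (Qubits n × Qubits c) (Qubits n × Qubits c) ℂ) ⊗ₖ Uρ.1) :=
    impl_rho.one_kron (Qubits n × Qubits c)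
  have hV : Ctrl n a b (1 + 0 + 1)
      (fun Uρ Uσ => blockReflection (Qubits a) (T Uρ Uσ).1) :=
    Ctrl.conj (hT.adj.kron_one (Qubits n × Qubits a))
      (Ctrl.free _ (permMatrix_mem_unitaryGroup _))
  have hW : Ctrl n a b (0 + (1 + 0 + 1))
      (fun Uρ Uσ => walk (Qubits a) (0 : Qubits n × Qubits c) (T Uρ Uσ).1) :=
    (Ctrl.free _ (kronecker_one_mem_unitaryGroup (reflect_mem_unitaryGroup 0))).mul hV
  obtain ⟨p, hp, H⟩ := QubitTest.of_walk (w := n + c + (n + a)) (by simp [pow_add])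
    ((0, 0) : (Qubits n × Qubits c) × (Qubits n × Qubits a)) hF hW
    (fun Uρ Uσ => walk_mem_unitaryGroup _ (T Uρ Uσ).2) m hA hAB
  -- One query prepares the purification of ρ; each of up to 2m walk steps uses the oracle of τ and
  -- its inverse once.
  refine ⟨p, (by ring : 1 + 2 * m * (0 + (1 + 0 + 1)) = 1 + 4 * m) ▸ hp,
    fun Uρ Uσ ρ τ hρ hτ => ?_⟩
  rw [isPurifiedOracle_iff] at hρ hτ
  have h1 : ((1 : Matrix (Qubits n × Qubits c) (Qubits n × Qubits c) ℂ) ⊗ₖ Uρ.1) *ᵥ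
      Pi.single (0, 0) 1 = inject 0 (Uρ.1 *ᵥ Pi.single 0 1) := by
    rw [kronecker_mulVec_single]
    ext q
    by_cases h : q.1 = 0 <;> simp [inject, h]
  have h2 := H Uρ Uσ
  simp only [h1, star_inject_dotProduct_walk _ (T Uρ Uσ).2, hρ, hτ] at h2
  exact h2

end Walk

/-! ### Spectral expressions for the relative entropy -/

section Spectral

variable {ι : Type} [Fintype ι] [DecidableEq ι]

/-- The diagonal of `ρ` in the basis of the columns of `U`. -/
def diagWeight {ι : Type} [Fintype ι] (U ρ : Matrix ι ι ℂ) (i : ι) : ℝ := ((Uᴴ * ρ * U) i i).re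

theorem trace_mul_conj_diagonal_re (ρ U : Matrix ι ι ℂ) (d : ι → ℝ) :
    (ρ * (U * diagonal (fun i => (d i : ℂ)) * Uᴴ)).trace.re = ∑ i, diagWeight U ρ i * d i := by
  have : (ρ * (U * diagonal (fun i => (d i : ℂ)) * Uᴴ)).trace =
      (Uᴴ * ρ * U * diagonal (fun i => (d i : ℂ))).trace := by
    rw [← Matrix.mul_assoc, trace_mul_comm, ← Matrix.mul_assoc, ← Matrix.mul_assoc]
  rw [this, Matrix.trace, Complex.re_sum]
  refine Finset.sum_congr rfl fun i _ => ?_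
  rw [diag_apply, mul_diagonal, diagWeight, Complex.re_mul_ofReal]

theorem diagWeight_nonneg {ι : Type} [Fintype ι] {ρ : Matrix ι ι ℂ} (hρ : ρ.PosSemidef) (U : Matrix ι ι ℂ) (i : ι) :
    0 ≤ diagWeight U ρ i :=
  (Complex.le_def.1 ((hρ.conjTranspose_mul_mul_same U).diag_nonneg (i := i))).1

theorem sum_diagWeight {ρ U : Matrix ι ι ℂ} (hρ : ρ.trace = 1) (hU : U ∈ Matrix.unitaryGroup ι ℂ) :
    ∑ i, diagWeight U ρ i = 1 := by
  have h1 : (Uᴴ * ρ * U).trace = 1 := by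
    rw [Matrix.mul_assoc, trace_mul_comm, Matrix.mul_assoc,
      show U * Uᴴ = 1 from Matrix.mem_unitaryGroup_iff.1 hU, mul_one, hρ]
  have h2 := congrArg Complex.re h1
  rwa [Matrix.trace, Complex.re_sum, Complex.one_re] at h2

/-- An eigendecomposition of a density matrix. -/
theorem IsState.exists_eigendecomposition {τ : Matrix ι ι ℂ} (hτ : IsState τ) {γ : ℝ}
    (hγ : EigenvaluesAtLeast τ γ) :
    ∃ U ∈ Matrix.unitaryGroup ι ℂ, ∃ x : ι → ℝ,
      τ = U * diagonal (fun i => (x i : ℂ)) * Uᴴ ∧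
      matLog τ = U * diagonal (fun i => (Real.log (x i) : ℂ)) * Uᴴ ∧
      (∀ i, 0 ≤ x i) ∧ ∑ i, x i = 1 ∧ ∀ i, x i ≠ 0 → γ ≤ x i := by
  have hH := hτ.1.1
  refine ⟨hH.eigenvectorUnitary.1, hH.eigenvectorUnitary.2, hH.eigenvalues, ?_, ?_,
    hτ.1.eigenvalues_nonneg, ?_, fun i hi => hγ _ (hH.eigenvalues_mem_spectrum_real i) hi⟩
  · conv_lhs => rw [hH.spectral_theorem]
    rfl
  · rw [matLog, hH.cfc_eq]
    rfl
  · have h := hH.trace_eq_sum_eigenvalues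
    rw [hτ.2] at h
    have h2 := congrArg Complex.re h
    simpa using h2.symm

/-- The vector ρu, for u the i-th column of U, lies in the range of τ, and every vector of that
range has zero component along a null eigenvector of τ. -/
theorem diagWeight_eq_zero {ρ τ U : Matrix ι ι ℂ} (hU : U ∈ Matrix.unitaryGroup ι ℂ)
    {x : ι → ℝ} (hτ : τ = U * diagonal (fun i => (x i : ℂ)) * Uᴴ) (h : supp ρ ≤ supp τ) {i : ι}
    (hi : x i = 0) : diagWeight U ρ i = 0 := by
  have h1 : Uᴴ * U = 1 := Matrix.mem_unitaryGroup_iff'.1 hU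
  obtain ⟨v, hv⟩ : ρ *ᵥ (U *ᵥ Pi.single i 1) ∈ supp τ :=
    h ⟨U *ᵥ Pi.single i 1, rfl⟩
  have hv' : τ *ᵥ v = ρ *ᵥ (U *ᵥ Pi.single i 1) := hv
  have h2 : (Uᴴ * ρ * U) i i = (Uᴴ *ᵥ (ρ *ᵥ (U *ᵥ Pi.single i 1))) i := by
    rw [mulVec_mulVec, mulVec_mulVec]
    simp
  rw [diagWeight, h2, ← hv', hτ, mulVec_mulVec, ← Matrix.mul_assoc, ← Matrix.mul_assoc, h1,
    one_mul, ← mulVec_mulVec, mulVec_diagonal, hi]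
  simp

theorem one_sub_sq_pow_eq {τ U : Matrix ι ι ℂ} (hU : U ∈ Matrix.unitaryGroup ι ℂ)
    {x : ι → ℝ} (hτ : τ = U * diagonal (fun i => (x i : ℂ)) * Uᴴ) (k : ℕ) :
    (1 - τ ^ 2) ^ k = U * diagonal (fun i => (((1 - x i ^ 2) ^ k : ℝ) : ℂ)) * Uᴴ := by
  have h1 : Uᴴ * U = 1 := Matrix.mem_unitaryGroup_iff'.1 hU
  have h2 : U * Uᴴ = 1 := Matrix.mem_unitaryGroup_iff.1 hU
  have hmul : ∀ D D' : Matrix ι ι ℂ, U * D * Uᴴ * (U * D' * Uᴴ) = U * (D * D') * Uᴴ := by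
    intro D D'
    calc U * D * Uᴴ * (U * D' * Uᴴ) = U * D * (Uᴴ * U) * D' * Uᴴ := by
          simp only [Matrix.mul_assoc]
      _ = _ := by rw [h1, mul_one, Matrix.mul_assoc U]
  have h3 : 1 - τ ^ 2 = U * diagonal (fun i => ((1 - x i ^ 2 : ℝ) : ℂ)) * Uᴴ := by
    have h4 : diagonal (fun i => ((1 - x i ^ 2 : ℝ) : ℂ)) =
        1 - diagonal (fun i => (x i : ℂ)) * diagonal (fun i => (x i : ℂ)) := by
      rw [diagonal_mul_diagonal, ← diagonal_one, diagonal_sub]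
      congr 1
      funext i
      push_cast
      ring
    rw [h4, Matrix.mul_sub, Matrix.sub_mul, mul_one, h2, sq, hτ, hmul]
  induction k with
  | zero => simp [h2]
  | succ k ih =>
    rw [pow_succ, ih, h3, hmul, diagonal_mul_diagonal]
    simp only [pow_succ, Complex.ofReal_mul]

theorem relEntropy_eq (ρ σ : Matrix ι ι ℂ) :
    relEntropy ρ σ = (ρ * matLog ρ).trace.re - (ρ * matLog σ).trace.re := by
  rw [relEntropy, entropy]
  ring

/-- Bounds for `tr (ρ ln τ)`. -/
theorem trace_mul_matLog_mem_Icc {ρ τ : Matrix ι ι ℂ} (hρ : IsState ρ) (hτ : IsState τ) {γ : ℝ}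
    (hγ0 : 0 < γ) (hγ1 : γ < 1) (hγ : EigenvaluesAtLeast τ γ) :
    (ρ * matLog τ).trace.re ∈ Set.Icc (Real.log γ) 0 := by
  obtain ⟨U, hU, x, h1, h2, h3, h4, h5⟩ := hτ.exists_eigendecomposition hγ
  have hx1 : ∀ i, x i ≤ 1 := fun i =>
    h4 ▸ Finset.single_le_sum (fun j _ => h3 j) (Finset.mem_univ i)
  rw [h2, trace_mul_conj_diagonal_re ρ U fun i => Real.log (x i)]
  constructor
  · calc Real.log γ = ∑ i, diagWeight U ρ i * Real.log γ := by
          rw [← Finset.sum_mul, sum_diagWeight hρ.2 hU, one_mul]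
      _ ≤ _ := by
        refine Finset.sum_le_sum fun i _ =>
          mul_le_mul_of_nonneg_left ?_ (diagWeight_nonneg hρ.1 U i)
        -- A null eigenvalue contributes `Real.log 0 = 0`, which also lies between log γ and 0; no
        -- support condition is needed here.
        by_cases hi : x i = 0
        · rw [hi, Real.log_zero]
          exact Real.log_nonpos hγ0.le hγ1.le
        · exact Real.log_le_log hγ0 (h5 i hi)
  · exact Finset.sum_nonpos fun i _ => mul_nonpos_of_nonneg_of_nonpos
      (diagWeight_nonneg hρ.1 U i) (Real.log_nonpos (h3 i) (hx1 i))

/-- If the nonzero eigenvalues exceed one half, then `ln τ` vanishes on the support. -/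
theorem matLog_eq_zero {τ : Matrix ι ι ℂ} (hτ : IsState τ) {γ : ℝ} (hγ1 : 1 / 2 < γ)
    (hγ : EigenvaluesAtLeast τ γ) : matLog τ = 0 := by
  obtain ⟨U, hU, x, h1, h2, h3, h4, h5⟩ := hτ.exists_eigendecomposition hγ
  have hlog : ∀ i, Real.log (x i) = 0 := by
    intro i
    by_cases hi : x i = 0
    · rw [hi, Real.log_zero]
    -- Two nonzero eigenvalues above one half would exceed the trace, so the state is pure and its
    -- only nonzero eigenvalue is 1.
    have h6 : ∀ j, j ≠ i → x j = 0 := by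
      intro j hj
      by_contra hj0
      have h7 : x i + x j ≤ 1 := by
        rw [← h4, ← Finset.sum_pair hj.symm]
        exact Finset.sum_le_sum_of_subset_of_nonneg (Finset.subset_univ _) fun k _ _ => h3 k
      linarith [h5 i hi, h5 j hj0]
    have h8 : x i = 1 := by
      rw [← h4, Fintype.sum_eq_single i h6]
    rw [h8, Real.log_one]
  rw [h2]
  simp [hlog]

/-- Klein's inequality. -/
theorem relEntropy_nonneg {ρ σ : Matrix ι ι ℂ} (hρ : IsState ρ) (hσ : IsState σ) {γ : ℝ}
    (hγρ : EigenvaluesAtLeast ρ γ) (hγσ : EigenvaluesAtLeast σ γ) (hs : supp ρ ≤ supp σ) :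
    0 ≤ relEntropy ρ σ := by
  obtain ⟨A, hA, p, hp1, hp2, hp3, hp4, -⟩ := hρ.exists_eigendecomposition hγρ
  obtain ⟨B, hB, q, hq1, hq2, hq3, hq4, -⟩ := hσ.exists_eigendecomposition hγσ
  have hA1 : Aᴴ * A = 1 := Matrix.mem_unitaryGroup_iff'.1 hA
  set M := Aᴴ * B with hM
  have hMu : M ∈ Matrix.unitaryGroup ι ℂ := mul_mem (conjTranspose_mem_unitaryGroup hA) hB
  -- The squared overlaps of the two eigenbases form a doubly stochastic matrix. This reduces the
  -- claim to the classical one, where ln x ≤ x − 1 is used term by term and the lower bounds sum to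
  -- 1 − 1 = 0.
  set P : ι → ι → ℝ := fun i j => ‖M i j‖ ^ 2 with hP
  have hP0 : ∀ i j, 0 ≤ P i j := fun i j => sq_nonneg _
  have hcol : ∀ j, ∑ i, P i j = 1 := by
    intro j
    have := sum_norm_sq_mulVec_single hMu j
    simpa [hP] using this
  have hrow : ∀ i, ∑ j, P i j = 1 := by
    intro i
    have := sum_norm_sq_mulVec_single (conjTranspose_mem_unitaryGroup hMu) i
    simpa [hP] using this
  have hwA : ∀ i, diagWeight A ρ i = p i := by
    intro i
    rw [diagWeight, hp1, ← Matrix.mul_assoc, ← Matrix.mul_assoc, hA1, one_mul, Matrix.mul_assoc,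
      hA1, mul_one, diagonal_apply_eq, Complex.ofReal_re]
  have hwB : ∀ j, diagWeight B ρ j = ∑ i, p i * P i j := by
    intro j
    have h1 : Bᴴ * ρ * B = Mᴴ * diagonal (fun i => (p i : ℂ)) * M := by
      rw [hM, conjTranspose_mul, conjTranspose_conjTranspose]
      conv_lhs => rw [hp1]
      simp only [Matrix.mul_assoc]
    rw [diagWeight, h1, Matrix.mul_apply, Complex.re_sum]
    refine Finset.sum_congr rfl fun i _ => ?_
    rw [mul_diagonal, conjTranspose_apply, hP]
    have : star (M i j) * (p i : ℂ) * M i j = ((p i * ‖M i j‖ ^ 2 : ℝ) : ℂ) := by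
      push_cast
      rw [← Complex.conj_mul', Complex.star_def]
      ring
    rw [this, Complex.ofReal_re]
  have hD : relEntropy ρ σ = ∑ j, ∑ i, p i * P i j * (Real.log (p i) - Real.log (q j)) := by
    rw [relEntropy_eq, hp2, trace_mul_conj_diagonal_re ρ A fun i => Real.log (p i), hq2,
      trace_mul_conj_diagonal_re ρ B fun i => Real.log (q i)]
    simp only [hwA, hwB, mul_sub, Finset.sum_sub_distrib, Finset.sum_mul]
    congr 1
    rw [Finset.sum_comm]
    refine Finset.sum_congr rfl fun i _ => ?_
    rw [← Finset.sum_mul, ← Finset.mul_sum, hrow, mul_one]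
  have hterm : ∀ i j, P i j * p i - P i j * q j ≤
      p i * P i j * (Real.log (p i) - Real.log (q j)) := by
    intro i j
    -- The support condition makes ρ vanish on null eigenvectors of σ, so the term is zero; this
    -- keeps the default value of log at 0 out of the estimate.
    by_cases hq : q j = 0
    · have h0 : ∑ i, p i * P i j = 0 := by
        rw [← hwB]
        exact diagWeight_eq_zero hB hq1 hs hq
      have h1 := (Finset.sum_eq_zero_iff_of_nonneg fun i _ => mul_nonneg (hp3 i) (hP0 i j)).1 h0 i
        (Finset.mem_univ i)
      rw [h1, hq, mul_comm, h1]
      simp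
    have hq' : 0 < q j := lt_of_le_of_ne (hq3 j) (Ne.symm hq)
    by_cases hp : p i = 0
    · rw [hp]
      simpa using mul_nonneg (hP0 i j) hq'.le
    have hp' : 0 < p i := lt_of_le_of_ne (hp3 i) (Ne.symm hp)
    have h1 : Real.log (q j / p i) ≤ q j / p i - 1 := Real.log_le_sub_one_of_pos (by positivity)
    rw [Real.log_div hq'.ne' hp'.ne'] at h1
    have h2 : p i * (Real.log (q j) - Real.log (p i)) ≤ p i * (q j / p i - 1) := by gcongr
    have h3 : p i * (q j / p i - 1) = q j - p i := by field_simp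
    have h4 := mul_le_mul_of_nonneg_left (h2.trans h3.le) (hP0 i j)
    nlinarith
  rw [hD]
  refine le_trans (le_of_eq ?_) (Finset.sum_le_sum fun j _ =>
    Finset.sum_le_sum fun i _ => hterm i j)
  simp only [Finset.sum_sub_distrib]
  rw [Finset.sum_comm]
  simp only [← Finset.sum_mul, hrow, hcol, one_mul, hp4, hq4, sub_self]

theorem relEntropy_le {ρ σ : Matrix ι ι ℂ} (hρ : IsState ρ) (hσ : IsState σ) {γ : ℝ}
    (hγ0 : 0 < γ) (hγ1 : γ < 1) (hγρ : EigenvaluesAtLeast ρ γ) (hγσ : EigenvaluesAtLeast σ γ) :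
    relEntropy ρ σ ≤ Real.log (1 / γ) := by
  rw [relEntropy_eq, one_div, Real.log_inv]
  linarith [(trace_mul_matLog_mem_Icc hρ hρ hγ0 hγ1 hγρ).2,
    (trace_mul_matLog_mem_Icc hρ hσ hγ0 hγ1 hγσ).1]

end Spectral

/-! ### Truncation of the logarithm series -/

section LogSeries

/-- Truncating the power series of `-ln x² = -ln (1 - (1 - x²))`. -/
theorem abs_two_log_add_sum_le {x γ : ℝ} (hγ : 0 < γ) (hγx : γ ≤ x) (hx : x ≤ 1) {K : ℕ}
    (hK : 1 ≤ γ ^ 2 * K) :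
    |2 * Real.log x + ∑ k ∈ Finset.Ico 1 K, (1 / (k : ℝ)) * (1 - x ^ 2) ^ k| ≤
      Real.exp (-(γ ^ 2 * K)) := by
  have hx0 : 0 < x := hγ.trans_le hγx
  have hγ2 : γ ^ 2 ≤ x ^ 2 := by gcongr
  have hK0 : (0 : ℝ) < K := by
    by_contra h
    nlinarith [sq_nonneg γ]
  obtain ⟨N, rfl⟩ : ∃ N, K = N + 1 := ⟨K - 1, by
    have : 0 < K := by exact_mod_cast hK0
    omega⟩
  set y : ℝ := 1 - x ^ 2 with hy
  have hy0 : 0 ≤ y := by nlinarith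
  have hy1 : y < 1 := by nlinarith
  have hs := Real.hasSum_pow_div_log_of_abs_lt_one (abs_lt.2 ⟨by linarith, hy1⟩)
  have hlog : Real.log (1 - y) = 2 * Real.log x := by
    rw [hy, sub_sub_cancel, Real.log_pow]
    norm_num
  rw [hlog] at hs
  have hfin : ∑ k ∈ Finset.Ico 1 (N + 1), (1 / (k : ℝ)) * y ^ k =
      ∑ k ∈ Finset.range N, y ^ (k + 1) / ((k : ℝ) + 1) := by
    rw [Finset.sum_Ico_eq_sum_range]
    refine Finset.sum_congr rfl fun k _ => ?_
    push_cast
    rw [add_comm 1 k, add_comm (1 : ℝ) k]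
    ring
  have htail := (hasSum_nat_add_iff' N).2 hs
  rw [← hfin] at htail
  set T := -(2 * Real.log x) - ∑ k ∈ Finset.Ico 1 (N + 1), (1 / (k : ℝ)) * y ^ k with hT
  have hT0 : 0 ≤ T := htail.nonneg fun k => by positivity
  -- The tail is dominated by a geometric series of sum y^K / (K(1 − y)). As 1 − y = x² ≥ γ², the
  -- hypothesis on K makes the denominator at least 1.
  have hgeo := (hasSum_geometric_of_lt_one hy0 hy1).mul_left (y ^ (N + 1) / ((N + 1 : ℕ) : ℝ))
  have hle : T ≤ y ^ (N + 1) / ((N + 1 : ℕ) : ℝ) * (1 - y)⁻¹ := by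
    refine hasSum_le (fun k => ?_) htail hgeo
    rw [div_mul_eq_mul_div, ← pow_add, show N + 1 + k = k + N + 1 by ring]
    push_cast
    gcongr
    linarith [(Nat.cast_nonneg k : (0 : ℝ) ≤ k)]
  have h1 : y ^ (N + 1) ≤ Real.exp (-(γ ^ 2 * ((N + 1 : ℕ) : ℝ))) := by
    have h2 : y ≤ Real.exp (-γ ^ 2) := by
      have := Real.add_one_le_exp (-γ ^ 2)
      linarith
    refine (pow_le_pow_left₀ hy0 h2 _).trans (le_of_eq ?_)
    rw [← Real.exp_nat_mul]
    congr 1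
    ring
  have h3 : 1 ≤ ((N + 1 : ℕ) : ℝ) * (1 - y) := by
    rw [hy, sub_sub_cancel]
    nlinarith
  have h4 : y ^ (N + 1) / ((N + 1 : ℕ) : ℝ) * (1 - y)⁻¹ ≤ y ^ (N + 1) := by
    rw [← div_eq_mul_inv, div_div]
    exact div_le_self (by positivity) h3
  rw [show 2 * Real.log x + ∑ k ∈ Finset.Ico 1 (N + 1), (1 / (k : ℝ)) * y ^ k = -T by
    rw [hT]; ring, abs_neg, abs_of_nonneg hT0]
  exact hle.trans (h4.trans h1)

variable {ι : Type} [Fintype ι] [DecidableEq ι]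

theorem abs_two_trace_mul_matLog_add_sum_le {ρ τ : Matrix ι ι ℂ} (hρ : IsState ρ)
    (hτ : IsState τ) {γ : ℝ} (hγ0 : 0 < γ) (hγ : EigenvaluesAtLeast τ γ) (hs : supp ρ ≤ supp τ)
    {K : ℕ} (hK : 1 ≤ γ ^ 2 * K) :
    |2 * (ρ * matLog τ).trace.re +
      ∑ k ∈ Finset.Ico 1 K, (1 / (k : ℝ)) * ((1 - τ ^ 2) ^ k * ρ).trace.re| ≤
      Real.exp (-(γ ^ 2 * K)) := by
  obtain ⟨U, hU, x, h1, h2, h3, h4, h5⟩ := hτ.exists_eigendecomposition hγ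
  have hx1 : ∀ i, x i ≤ 1 := fun i =>
    h4 ▸ Finset.single_le_sum (fun j _ => h3 j) (Finset.mem_univ i)
  have h6 : ∀ k : ℕ, ((1 - τ ^ 2) ^ k * ρ).trace.re = ∑ i, diagWeight U ρ i * (1 - x i ^ 2) ^ k := by
    intro k
    rw [trace_mul_comm, one_sub_sq_pow_eq hU h1, trace_mul_conj_diagonal_re]
  have h7 : 2 * (ρ * matLog τ).trace.re +
      ∑ k ∈ Finset.Ico 1 K, (1 / (k : ℝ)) * ((1 - τ ^ 2) ^ k * ρ).trace.re =
      ∑ i, diagWeight U ρ i * (2 * Real.log (x i) +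
        ∑ k ∈ Finset.Ico 1 K, (1 / (k : ℝ)) * (1 - x i ^ 2) ^ k) := by
    rw [h2, trace_mul_conj_diagonal_re ρ U fun i => Real.log (x i)]
    simp only [h6, mul_add, Finset.sum_add_distrib, Finset.mul_sum]
    rw [Finset.sum_comm]
    congr 1
    · exact Finset.sum_congr rfl fun i _ => by ring
    · exact Finset.sum_congr rfl fun i _ => Finset.sum_congr rfl fun k _ => by ring
  rw [h7]
  refine (Finset.abs_sum_le_sum_abs _ _).trans ?_
  calc _ ≤ ∑ i, diagWeight U ρ i * Real.exp (-(γ ^ 2 * K)) := by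
        refine Finset.sum_le_sum fun i _ => ?_
        have hw := diagWeight_nonneg hρ.1 U i
        rw [abs_mul, abs_of_nonneg hw]
        -- On null eigenvectors of τ the partial sums are harmonic sums and approximate nothing; the
        -- support condition gives these vectors weight zero.
        by_cases hi : x i = 0
        · rw [diagWeight_eq_zero hU h1 hs hi, zero_mul, zero_mul]
        · exact mul_le_mul_of_nonneg_left
            (abs_two_log_add_sum_le hγ0 (h5 i hi) (hx1 i) hK) hw
    _ = _ := by rw [← Finset.sum_mul, sum_diagWeight hρ.2 hU, one_mul]

end LogSeries

/-! ### The algorithms -/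

section Blocks

/-- The total weight of a block of the power series of the logarithm. -/
def blockWeight (i : ℕ) : ℝ := ∑ k ∈ Finset.Ico ((4 : ℕ) ^ i) ((4 : ℕ) ^ (i + 1)), (1 / (k : ℝ))

theorem blockWeight_nonneg (i : ℕ) : 0 ≤ blockWeight i :=
  Finset.sum_nonneg fun k _ => by positivity

/-- There are 3·4^i terms, each at most 4^(−i). -/
theorem blockWeight_le (i : ℕ) : blockWeight i ≤ 3 := by
  have h : ∀ k ∈ Finset.Ico ((4 : ℕ) ^ i) ((4 : ℕ) ^ (i + 1)), (1 / (k : ℝ)) ≤ 1 / 4 ^ i := by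
    intro k hk
    have h1 : ((4 : ℝ) ^ i) ≤ k := by exact_mod_cast (Finset.mem_Ico.1 hk).1
    gcongr
  refine (Finset.sum_le_sum h).trans (le_of_eq ?_)
  rw [Finset.sum_const, Nat.card_Ico, nsmul_eq_mul, Nat.cast_sub (Nat.pow_le_pow_right (by norm_num : 0 < 4)
    (Nat.le_succ i))]
  push_cast
  rw [Nat.succ_eq_add_one, pow_succ]
  field_simp
  ring

theorem sum_blocks (f : ℕ → ℝ) (I : ℕ) :
    ∑ i ∈ Finset.range I, ∑ k ∈ Finset.Ico ((4 : ℕ) ^ i) ((4 : ℕ) ^ (i + 1)), f k =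
      ∑ k ∈ Finset.Ico 1 ((4 : ℕ) ^ I), f k := by
  induction I with
  | zero => simp
  | succ I ih =>
    rw [Finset.sum_range_succ, ih, Finset.sum_Ico_consecutive _ (Nat.one_le_pow I 4 (by norm_num))
      (Nat.pow_le_pow_right (by norm_num : 0 < 4) (Nat.le_succ I))]

theorem sum_two_thirds_pow_le (I : ℕ) :
    ∑ i ∈ Finset.range I, (2 / 3 : ℝ) ^ (I - i) ≤ 2 := by
  induction I with
  | zero => simp
  | succ I ih =>
    rw [Finset.sum_range_succ]
    have h : ∀ i ∈ Finset.range I, (2 / 3 : ℝ) ^ (I + 1 - i) = 2 / 3 * (2 / 3) ^ (I - i) := by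
      intro i hi
      rw [← pow_succ', Nat.succ_sub (Finset.mem_range.1 hi).le]
    rw [Finset.sum_congr rfl h, ← Finset.mul_sum, Nat.add_sub_cancel_left]
    linarith

theorem sum_three_halves_pow_le (I : ℕ) :
    ∑ i ∈ Finset.range I, (3 / 2 : ℝ) ^ (I - i) * 2 ^ i ≤ 3 * 2 ^ I := by
  induction I with
  | zero => simp
  | succ I ih =>
    rw [Finset.sum_range_succ]
    have h : ∀ i ∈ Finset.range I, (3 / 2 : ℝ) ^ (I + 1 - i) * 2 ^ i =
        3 / 2 * ((3 / 2) ^ (I - i) * 2 ^ i) := by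
      intro i hi
      rw [Nat.succ_sub (Finset.mem_range.1 hi).le, pow_succ']
      ring
    rw [Finset.sum_congr rfl h, ← Finset.mul_sum, Nat.add_sub_cancel_left, pow_succ (2 : ℝ) I]
    linarith

theorem sum_two_pow_le (I : ℕ) : ∑ i ∈ Finset.range I, (2 : ℝ) ^ i ≤ 2 ^ I := by
  induction I with
  | zero => simp
  | succ I ih =>
    rw [Finset.sum_range_succ, pow_succ (2 : ℝ) I]
    linarith

/-- The cost of repetitions whose number decreases geometrically with the degree. -/
theorem sum_cost_le {X : ℝ} (hX : 0 ≤ X) {s : ℕ} (hs : 1 ≤ s) (I : ℕ) :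
    ∑ i ∈ Finset.range I, (X * (3 / 2) ^ (I - i) + 1) * (1 + 4 * (s * 2 ^ (i + 1))) ≤
      27 * (s * 2 ^ I) * (X + 1) := by
  have hs' : (1 : ℝ) ≤ s := by exact_mod_cast hs
  have h : ∀ i ∈ Finset.range I, (X * (3 / 2) ^ (I - i) + 1) * (1 + 4 * (s * 2 ^ (i + 1))) ≤
      9 * s * (X * ((3 / 2) ^ (I - i) * 2 ^ i) + 2 ^ i) := by
    intro i _
    have h1 : (1 : ℝ) ≤ s * 2 ^ i := one_le_mul_of_one_le_of_one_le hs' (one_le_pow₀ (by norm_num))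
    calc (X * (3 / 2) ^ (I - i) + 1) * (1 + 4 * (s * 2 ^ (i + 1)))
        ≤ (X * (3 / 2) ^ (I - i) + 1) * (9 * (s * 2 ^ i)) := by
          gcongr
          rw [pow_succ]
          linarith
      _ = _ := by ring
  refine (Finset.sum_le_sum h).trans ?_
  rw [← Finset.mul_sum, Finset.sum_add_distrib, ← Finset.mul_sum]
  have h1 := sum_three_halves_pow_le I
  have h2 := sum_two_pow_le I
  have h3 : (0 : ℝ) ≤ 2 ^ I := by positivity
  calc 9 * (s : ℝ) * (X * ∑ i ∈ Finset.range I, (3 / 2 : ℝ) ^ (I - i) * 2 ^ i +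
        ∑ i ∈ Finset.range I, (2 : ℝ) ^ i) ≤ 9 * s * (X * (3 * 2 ^ I) + 2 ^ I) := by gcongr
    _ ≤ 9 * s * (X * (3 * 2 ^ I) + 3 * 2 ^ I) := by
      gcongr
      linarith
    _ = _ := by ring

variable {n a b : ℕ}

/-- Tests for the blocks of the power series. -/
theorem exists_blockTests (n a b s : ℕ) : ∃ p q : ℕ → Oracle n a → Oracle n b → ℝ,
    (∀ i, QubitTest n a b (1 + 4 * (s * 2 ^ (i + 1))) (p i)) ∧
    (∀ i, QubitTest n a b (1 + 4 * (s * 2 ^ (i + 1))) (q i)) ∧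
    ∀ (I : ℕ) (γ : ℝ) (ρ σ : Matrix (Qubits n) (Qubits n) ℂ) (Uρ : Oracle n a) (Uσ : Oracle n b),
      0 < γ → 1 ≤ s → s ≤ γ * 2 ^ I → ValidInput γ ρ σ Uρ Uσ →
      |∑ i ∈ Finset.range I, (blockWeight i / 2 * p i Uρ Uσ + -(blockWeight i / 2) * q i Uρ Uσ) -
        relEntropy ρ σ| ≤ (12 * I + 1) * Real.exp (-(s : ℝ) ^ 2) := by
  -- The cutoff m = s·2^(i+1) is s times the square root of the block's upper end 4^(i+1), so every
  -- block has the same relative error 4 exp(−s²).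
  have h1 := fun i : ℕ => exists_qubitTest (T := fun (_ : Oracle n a) (Uσ : Oracle n b) => Uσ)
    impl_sigma (s * 2 ^ (i + 1)) (Nat.pow_pos (n := i) (by norm_num : 0 < 4))
    (Nat.pow_lt_pow_right (by norm_num) (Nat.lt_succ_self i))
  have h2 := fun i : ℕ => exists_qubitTest (T := fun (Uρ : Oracle n a) (_ : Oracle n b) => Uρ)
    impl_rho (s * 2 ^ (i + 1)) (Nat.pow_pos (n := i) (by norm_num : 0 < 4))
    (Nat.pow_lt_pow_right (by norm_num) (Nat.lt_succ_self i))
  choose p hp Hp using h1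
  choose q hq Hq using h2
  refine ⟨p, q, hp, hq, fun I γ ρ σ Uρ Uσ hγ hs hI ⟨hρ, hσ, hγρ, hγσ, hsupp, hUρ, hUσ⟩ => ?_⟩
  have hs' : (1 : ℝ) ≤ s := by exact_mod_cast hs
  set E := Real.exp (-(s : ℝ) ^ 2) with hE
  have hE0 : 0 < E := Real.exp_pos _
  -- The series is cut at K = 4^I with γ²K = (γ 2^I)² ≥ s², so its tail is also at most exp(−s²).
  have hK : (s : ℝ) ^ 2 ≤ γ ^ 2 * ((4 ^ I : ℕ) : ℝ) := by
    have : γ ^ 2 * ((4 ^ I : ℕ) : ℝ) = (γ * 2 ^ I) ^ 2 := by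
      push_cast
      rw [mul_pow, ← pow_mul, mul_comm I 2, pow_mul]
      norm_num
    rw [this]
    gcongr
  have hK1 : 1 ≤ γ ^ 2 * ((4 ^ I : ℕ) : ℝ) := le_trans (one_le_pow₀ hs') hK
  have hEK : Real.exp (-(γ ^ 2 * ((4 ^ I : ℕ) : ℝ))) ≤ E := Real.exp_le_exp.2 (by linarith)
  have hblock : ∀ (c : ℕ → ℝ) (τ : Matrix (Qubits n) (Qubits n) ℂ),
      (∀ i, |(∑ k ∈ Finset.Ico ((4 : ℕ) ^ i) ((4 : ℕ) ^ (i + 1)), (1 / (k : ℝ))) * c i -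
        ∑ k ∈ Finset.Ico ((4 : ℕ) ^ i) ((4 : ℕ) ^ (i + 1)), (1 / (k : ℝ)) * ((1 - τ ^ 2) ^ k * ρ).trace.re| ≤
        (∑ k ∈ Finset.Ico ((4 : ℕ) ^ i) ((4 : ℕ) ^ (i + 1)), (1 / (k : ℝ))) *
          (4 * Real.exp (-(((s * 2 ^ (i + 1) : ℕ) : ℝ) ^ 2 / ((4 ^ (i + 1) : ℕ) : ℝ))))) →
      |∑ i ∈ Finset.range I, blockWeight i * c i -
        ∑ k ∈ Finset.Ico 1 ((4 : ℕ) ^ I), (1 / (k : ℝ)) * ((1 - τ ^ 2) ^ k * ρ).trace.re| ≤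
        12 * I * E := by
    intro c τ h
    rw [← sum_blocks, ← Finset.sum_sub_distrib]
    refine (Finset.abs_sum_le_sum_abs _ _).trans ?_
    have h3 : ∀ i, ((s * 2 ^ (i + 1) : ℕ) : ℝ) ^ 2 / ((4 ^ (i + 1) : ℕ) : ℝ) = (s : ℝ) ^ 2 := by
      intro i
      push_cast
      rw [mul_pow, ← pow_mul, mul_comm (i + 1) 2, pow_mul, show (2 : ℝ) ^ 2 = 4 by norm_num,
        mul_div_assoc, div_self (by positivity), mul_one]
    calc _ ≤ ∑ i ∈ Finset.range I, 12 * E := by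
          refine Finset.sum_le_sum fun i _ => (h i).trans ?_
          rw [h3, ← hE]
          have := blockWeight_le i
          calc blockWeight i * (4 * E) ≤ 3 * (4 * E) := by gcongr
            _ = 12 * E := by ring
      _ = _ := by
          rw [Finset.sum_const, Finset.card_range, nsmul_eq_mul]
          ring
  have hp1 := hblock (fun i => p i Uρ Uσ) σ fun i => Hp i Uρ Uσ ρ σ hUρ hUσ
  have hq1 := hblock (fun i => q i Uρ Uσ) ρ fun i => Hq i Uρ Uσ ρ ρ hUρ hUρ
  have hp2 := (abs_two_trace_mul_matLog_add_sum_le hρ hσ hγ hγσ hsupp hK1).trans hEK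
  have hq2 := (abs_two_trace_mul_matLog_add_sum_le hρ hρ hγ hγρ le_rfl hK1).trans hEK
  have e : ∑ i ∈ Finset.range I, (blockWeight i / 2 * p i Uρ Uσ + -(blockWeight i / 2) * q i Uρ Uσ) =
      (∑ i ∈ Finset.range I, blockWeight i * p i Uρ Uσ) / 2 -
        (∑ i ∈ Finset.range I, blockWeight i * q i Uρ Uσ) / 2 := by
    rw [← sub_div, ← Finset.sum_sub_distrib, Finset.sum_div]
    exact Finset.sum_congr rfl fun i _ => by ring
  rw [e, relEntropy_eq]
  rw [abs_le] at *
  constructor <;> nlinarith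

theorem one_div_le_of_three_halves_pow_le {X y : ℝ} (hX : 0 < X) {j : ℕ} (h : X * (3 / 2) ^ j ≤ y) :
    1 / y ≤ 1 / X * (2 / 3) ^ j := by
  have h1 : 0 < X * (3 / 2 : ℝ) ^ j := by positivity
  refine (one_div_le_one_div_of_le h1 h).trans (le_of_eq ?_)
  rw [show (2 / 3 : ℝ) = (3 / 2)⁻¹ by norm_num, inv_pow]
  field_simp

/-- Sampling estimates of linear combinations of tests. -/
theorem SamplingEst.of_blockTests {s I : ℕ} (hs : 1 ≤ s) {p q : ℕ → Oracle n a → Oracle n b → ℝ}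
    (hp : ∀ i, QubitTest n a b (1 + 4 * (s * 2 ^ (i + 1))) (p i))
    (hq : ∀ i, QubitTest n a b (1 + 4 * (s * 2 ^ (i + 1))) (q i)) {X : ℝ} (hX : 0 < X) :
    ∃ k v, SamplingEst n a b k (fun Uρ Uσ => ∑ i ∈ Finset.range I,
        (blockWeight i / 2 * p i Uρ Uσ + -(blockWeight i / 2) * q i Uρ Uσ)) v ∧
      (k : ℝ) ≤ 54 * (s * 2 ^ I) * (X + 1) ∧ v ≤ 9 / X := by
  -- Any growth ratio strictly between 1 and 2 would do: below 2 the costs, proportional to 2^i, are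
  -- dominated by the last block; above 1 the variances have a bounded sum.
  set N : ℕ → ℕ := fun i => ⌈X * (3 / 2) ^ (I - i)⌉₊ with hN
  have hN0 : ∀ i, N i ≠ 0 := fun i => (Nat.ceil_pos.2 (by positivity)).ne'
  refine ⟨_, _, SamplingEst.sum fun i _ => ((SamplingEst.of_test (hp i) (hN0 i)).smul
    (blockWeight i / 2)).add ((SamplingEst.of_test (hq i) (hN0 i)).smul (-(blockWeight i / 2))),
    ?_, ?_⟩
  · have h1 := sum_cost_le hX.le hs I
    push_cast
    have h2 : ∀ i ∈ Finset.range I, (N i : ℝ) * (1 + 4 * (s * 2 ^ (i + 1))) +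
        N i * (1 + 4 * (s * 2 ^ (i + 1))) ≤
        2 * ((X * (3 / 2) ^ (I - i) + 1) * (1 + 4 * (s * 2 ^ (i + 1)))) := by
      intro i _
      have h3 : (N i : ℝ) ≤ X * (3 / 2) ^ (I - i) + 1 := (Nat.ceil_lt_add_one (by positivity)).le
      rw [← two_mul]
      gcongr
    refine (Finset.sum_le_sum h2).trans ?_
    rw [← Finset.mul_sum]
    linarith
  · have h2 : ∀ i ∈ Finset.range I, (blockWeight i / 2) ^ 2 * (1 / (N i : ℝ)) +
        (-(blockWeight i / 2)) ^ 2 * (1 / (N i : ℝ)) ≤ 9 / 2 / X * (2 / 3) ^ (I - i) := by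
      intro i _
      have h3 := one_div_le_of_three_halves_pow_le hX (Nat.le_ceil (X * (3 / 2) ^ (I - i)))
      have h4 : (blockWeight i / 2) ^ 2 ≤ (3 / 2) ^ 2 := by
        have := blockWeight_nonneg i
        have := blockWeight_le i
        gcongr
      rw [neg_sq, ← two_mul]
      calc 2 * ((blockWeight i / 2) ^ 2 * (1 / (N i : ℝ))) ≤
            2 * ((3 / 2) ^ 2 * (1 / X * (2 / 3) ^ (I - i))) := by gcongr
        _ = _ := by ring
    refine (Finset.sum_le_sum h2).trans ?_
    rw [← Finset.mul_sum]
    have h5 := sum_two_thirds_pow_le I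
    calc 9 / 2 / X * ∑ i ∈ Finset.range I, (2 / 3 : ℝ) ^ (I - i) ≤ 9 / 2 / X * 2 := by gcongr
      _ = 9 / X := by ring

theorem exists_two_pow_near {y : ℝ} (hy : 0 ≤ y) : ∃ μ : ℕ, y ≤ 2 ^ μ ∧ (2 : ℝ) ^ μ ≤ 2 * y + 1 := by
  rcases le_total y 1 with h | h
  · exact ⟨0, by simpa using h, by simp [hy]⟩
  · obtain ⟨m, h1, h2⟩ := exists_nat_pow_near h (by norm_num : (1 : ℝ) < 2)
    refine ⟨m + 1, h2.le, ?_⟩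
    rw [pow_succ]
    linarith

/-- Estimates of linear combinations of tests by amplitude estimation. -/
theorem CircuitEst.of_blockTests {s I : ℕ} (hs : 1 ≤ s) {p q : ℕ → Oracle n a → Oracle n b → ℝ}
    (hp : ∀ i, QubitTest n a b (1 + 4 * (s * 2 ^ (i + 1))) (p i))
    (hq : ∀ i, QubitTest n a b (1 + 4 * (s * 2 ^ (i + 1))) (q i)) {X : ℝ} (hX : 0 < X) :
    ∃ k e, CircuitEst n a b k (fun Uρ Uσ => ∑ i ∈ Finset.range I,
        (blockWeight i / 2 * p i Uρ Uσ + -(blockWeight i / 2) * q i Uρ Uσ)) e ∧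
      (k : ℝ) ≤ 864 * (s * 2 ^ I) * (X + 1) ∧ e ≤ 12 / X := by
  -- The same geometric allocation as for sampling, with inverse precision in place of the number of
  -- repetitions, rounded up to a power of two for the clock.
  have hμ := fun i : ℕ => exists_two_pow_near (y := X * (3 / 2) ^ (I - i)) (by positivity)
  choose μ h1 h2 using hμ
  refine ⟨_, _, CircuitEst.sum fun i _ => ((CircuitEst.of_test (hp i) (μ i)).smul
    (blockWeight i / 2)).add ((CircuitEst.of_test (hq i) (μ i)).smul (-(blockWeight i / 2))),
    ?_, ?_⟩
  · have h3 := sum_cost_le hX.le hs I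
    push_cast
    have h4 : ∀ i ∈ Finset.range I, (8 * (2 : ℝ) ^ μ i + 1) * (1 + 4 * (s * 2 ^ (i + 1))) +
        (8 * (2 : ℝ) ^ μ i + 1) * (1 + 4 * (s * 2 ^ (i + 1))) ≤
        32 * ((X * (3 / 2) ^ (I - i) + 1) * (1 + 4 * (s * 2 ^ (i + 1)))) := by
      intro i _
      have h5 : 8 * (2 : ℝ) ^ μ i + 1 ≤ 16 * (X * (3 / 2) ^ (I - i) + 1) := by linarith [h2 i]
      calc _ ≤ 16 * (X * (3 / 2) ^ (I - i) + 1) * (1 + 4 * (s * 2 ^ (i + 1))) +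
            16 * (X * (3 / 2) ^ (I - i) + 1) * (1 + 4 * (s * 2 ^ (i + 1))) := by gcongr
        _ = _ := by ring
    refine (Finset.sum_le_sum h4).trans ?_
    rw [← Finset.mul_sum]
    linarith
  · have h4 : ∀ i ∈ Finset.range I, |blockWeight i / 2| * (2 / ((2 ^ μ i : ℕ) : ℝ)) +
        |(-(blockWeight i / 2))| * (2 / ((2 ^ μ i : ℕ) : ℝ)) ≤ 6 / X * (2 / 3) ^ (I - i) := by
      intro i _
      have h3 := one_div_le_of_three_halves_pow_le hX (h1 i)
      have h5 := blockWeight_le i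
      have h6 := blockWeight_nonneg i
      rw [abs_neg, abs_of_nonneg (by positivity)]
      push_cast
      calc blockWeight i / 2 * (2 / (2 : ℝ) ^ μ i) + blockWeight i / 2 * (2 / (2 : ℝ) ^ μ i) =
            2 * blockWeight i * (1 / (2 : ℝ) ^ μ i) := by ring
        _ ≤ 2 * 3 * (1 / X * (2 / 3) ^ (I - i)) := by gcongr
        _ = _ := by ring
    refine (Finset.sum_le_sum h4).trans ?_
    rw [← Finset.mul_sum]
    have h5 := sum_two_thirds_pow_le I
    calc 6 / X * ∑ i ∈ Finset.range I, (2 / 3 : ℝ) ^ (I - i) ≤ 6 / X * 2 := by gcongr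
      _ = 12 / X := by ring

end Blocks

/-! ### Choice of parameters and the trivial cases -/

section Parameters

/-- The choice of the truncation. -/
theorem exists_truncation {γ ε : ℝ} (hγ0 : 0 < γ) (hγ : γ ≤ 1 / 2) (hε : 0 < ε)
    (h : 2 * ε < Real.log (1 / γ)) :
    ∃ s I : ℕ, 1 ≤ s ∧ (s : ℝ) ≤ γ * 2 ^ I ∧ (12 * I + 1) * Real.exp (-(s : ℝ) ^ 2) ≤ ε / 2 ∧
      (s : ℝ) * 2 ^ I ≤ 80 * (Real.log (Real.log (1 / γ) / ε) / γ) := by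
  have hl1 := Real.log_two_gt_d9
  have hl2 := Real.log_two_lt_d9
  set L := Real.log (1 / γ) with hL
  set r := L / ε with hr
  have hLl : Real.log 2 ≤ L := Real.log_le_log (by norm_num) (by
    rw [le_div_iff₀ hγ0]
    linarith)
  have hr2 : 2 ≤ r := by
    rw [hr, le_div_iff₀ hε]
    exact h.le
  have hlr : Real.log 2 ≤ Real.log r := Real.log_le_log (by norm_num) hr2
  have h256 : Real.log (256 * r) = 8 * Real.log 2 + Real.log r := by
    rw [Real.log_mul (by norm_num) (by linarith), show (256 : ℝ) = 2 ^ 8 by norm_num, Real.log_pow]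
    norm_num
  -- This makes exp(−s²/2) at most 1/(256 r). The other half of the Gaussian pays for the factor s
  -- in the bound 12 I + 1 ≤ 128 s L on the number of blocks.
  set Q := 2 * Real.log (256 * r) with hQ
  have hQ0 : 0 < Q := by linarith
  set s := ⌈√Q⌉₊ with hs
  have hs1 : 1 ≤ s := Nat.ceil_pos.2 (Real.sqrt_pos.2 hQ0)
  have hs1' : (1 : ℝ) ≤ s := by exact_mod_cast hs1
  have hsQ : Q ≤ (s : ℝ) ^ 2 := by
    rw [← Real.sq_sqrt hQ0.le]
    have := Nat.le_ceil √Q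
    gcongr
  have hsQ' : (s : ℝ) ^ 2 ≤ 40 * Real.log r := by
    have h1 : (s : ℝ) ≤ √Q + 1 := (Nat.ceil_lt_add_one (Real.sqrt_nonneg Q)).le
    have h2 : (s : ℝ) ^ 2 ≤ (√Q + 1) ^ 2 := by gcongr
    -- (√Q + 1)² ≤ 2Q + 2 and Q = 16 ln 2 + 2 ln r ≤ 18 ln r, because r ≥ 2; the remaining 2 is at
    -- most 4 ln r.
    nlinarith [Real.sq_sqrt hQ0.le, sq_nonneg (√Q - 1)]
  have hx : 1 ≤ (s : ℝ) / γ := by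
    rw [le_div_iff₀ hγ0]
    linarith
  -- With I = m + 1 the power 2^I lies between s/γ and 2s/γ, so s·2^I is of order s²/γ.
  obtain ⟨m, hm1, hm2⟩ := exists_nat_pow_near hx (by norm_num : (1 : ℝ) < 2)
  have hpow : (2 : ℝ) ^ (m + 1) ≤ 2 * (s / γ) := by
    rw [pow_succ]
    linarith
  refine ⟨s, m + 1, hs1, ?_, ?_, ?_⟩
  · rw [div_lt_iff₀ hγ0] at hm2
    linarith
  · have hI : ((m + 1 : ℕ) : ℝ) * Real.log 2 ≤ Real.log 2 + s + L := by
      have h1 := Real.log_le_log (by positivity) hpow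
      rw [Real.log_pow, Real.log_mul (by norm_num) (by positivity), div_eq_mul_one_div,
        Real.log_mul (by positivity) (by positivity), ← hL] at h1
      have h2 := Real.log_le_sub_one_of_pos (by linarith : (0 : ℝ) < s)
      linarith
    have hP1 : L ≤ s * L := by nlinarith
    have hP2 : 0.69 * (s : ℝ) ≤ s * L := by nlinarith
    have hI0 : (0 : ℝ) ≤ ((m + 1 : ℕ) : ℝ) := by positivity
    have hI1 : ((m + 1 : ℕ) : ℝ) * 0.69 ≤ ((m + 1 : ℕ) : ℝ) * Real.log 2 := by
      gcongr
      linarith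
    have hI2 : 12 * ((m + 1 : ℕ) : ℝ) + 1 ≤ 128 * (s * L) := by linarith
    have hexp1 : (s : ℝ) * Real.exp (-(s : ℝ) ^ 2 / 2) ≤ 1 := by
      have h1 : (s : ℝ) ≤ Real.exp ((s : ℝ) ^ 2 / 2) := by
        nlinarith [Real.add_one_le_exp ((s : ℝ) ^ 2 / 2), sq_nonneg ((s : ℝ) - 1)]
      calc (s : ℝ) * Real.exp (-(s : ℝ) ^ 2 / 2) ≤
            Real.exp ((s : ℝ) ^ 2 / 2) * Real.exp (-(s : ℝ) ^ 2 / 2) := by gcongr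
        _ = 1 := by
          rw [← Real.exp_add, neg_div, add_neg_cancel, Real.exp_zero]
    have hexp2 : Real.exp (-(s : ℝ) ^ 2 / 2) ≤ 1 / (256 * r) := by
      have h1 : 1 / (256 * r) = Real.exp (-Real.log (256 * r)) := by
        rw [Real.exp_neg, Real.exp_log (by positivity), one_div]
      rw [h1, Real.exp_le_exp]
      linarith
    have hexp3 : Real.exp (-(s : ℝ) ^ 2) =
        Real.exp (-(s : ℝ) ^ 2 / 2) * Real.exp (-(s : ℝ) ^ 2 / 2) := by
      rw [← Real.exp_add]
      congr 1
      ring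
    have hL0 : 0 < L := by linarith
    calc (12 * ((m + 1 : ℕ) : ℝ) + 1) * Real.exp (-(s : ℝ) ^ 2)
        ≤ 128 * (s * L) * Real.exp (-(s : ℝ) ^ 2) := by gcongr
      _ = 128 * L * (s * Real.exp (-(s : ℝ) ^ 2 / 2)) * Real.exp (-(s : ℝ) ^ 2 / 2) := by
        rw [hexp3]
        ring
      _ ≤ 128 * L * 1 * (1 / (256 * r)) := by gcongr
      _ = ε / 2 := by
        rw [hr]
        field_simp
        norm_num
  · calc (s : ℝ) * 2 ^ (m + 1) ≤ s * (2 * (s / γ)) := by gcongr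
      _ = 2 * (s ^ 2 / γ) := by ring
      _ ≤ 2 * (40 * Real.log r / γ) := by gcongr
      _ = _ := by ring

variable {n a b : ℕ}

/-- Parameters for which the relative entropy is known to precision `ε` in advance. -/
theorem exists_constant_estimate (n a b : ℕ) {γ ε : ℝ} (hγ0 : 0 < γ) (hγ1 : γ < 1) (hε : 0 < ε)
    (h : 1 / 2 < γ ∨ Real.log (1 / γ) ≤ 2 * ε) :
    ∃ d : ℝ, ∀ (ρ σ : Matrix (Qubits n) (Qubits n) ℂ) (Uρ : Oracle n a) (Uσ : Oracle n b),
      ValidInput γ ρ σ Uρ Uσ → |d - relEntropy ρ σ| ≤ ε := by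
  rcases h with h | h
  · refine ⟨0, fun ρ σ Uρ Uσ ⟨hρ, hσ, hγρ, hγσ, _⟩ => ?_⟩
    rw [relEntropy_eq, matLog_eq_zero hρ h hγρ, matLog_eq_zero hσ h hγσ]
    simpa using hε.le
  -- The relative entropy lies in [0, ln(1/γ)], an interval of length at most 2ε, so its midpoint
  -- serves.
  · refine ⟨Real.log (1 / γ) / 2, fun ρ σ Uρ Uσ ⟨hρ, hσ, hγρ, hγσ, hs, _⟩ => ?_⟩
    have h1 := relEntropy_nonneg hρ hσ hγρ hγσ hs
    have h2 := relEntropy_le hρ hσ hγ0 hγ1 hγρ hγσ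
    rw [abs_le]
    constructor <;> linarith

theorem SamplingAlgorithm.exists_const (n a b : ℕ) (d : ℝ) :
    ∃ alg : SamplingAlgorithm n a b, alg.queries = 0 ∧ ∀ Uρ Uσ D ε, |d - D| ≤ ε →
      alg.successProb Uρ Uσ D ε = 1 :=
  ⟨⟨0, fun j => j.elim0, fun j => j.elim0, fun _ => d⟩, by simp [SamplingAlgorithm.queries],
    fun Uρ Uσ D ε h => by simp [SamplingAlgorithm.successProb, h]⟩

theorem QueryAlgorithm.exists_const (n a b : ℕ) (d : ℝ) :
    ∃ alg : QueryAlgorithm n a b, alg.queries = 0 ∧ ∀ Uρ Uσ D ε, |d - D| ≤ ε →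
      alg.successProb Uρ Uσ D ε = 1 := by
  refine ⟨⟨⟨0, 1, []⟩, fun _ => d⟩, rfl, fun Uρ Uσ D ε h => ?_⟩
  simp only [QueryAlgorithm.successProb, h, if_true, QueryCircuit.outcomeProb,
    QueryCircuit.finalState, List.foldl_nil]
  exact sum_norm_sq_mulVec_single (one_mem (Matrix.unitaryGroup (Mem n a b 0) ℂ)) 0

end Parameters

theorem log_bounds {γ ε : ℝ} (hγ0 : 0 < γ) (hγ : γ ≤ 1 / 2) (hε : 0 < ε)
    (h : 2 * ε < Real.log (1 / γ)) :
    0.69 ≤ Real.log (1 / γ) ∧ 1 ≤ Real.log (1 / γ) / ε ∧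
      0 ≤ Real.log (Real.log (1 / γ) / ε) := by
  have h1 : Real.log 2 ≤ Real.log (1 / γ) := Real.log_le_log (by norm_num) (by
    rw [le_div_iff₀ hγ0]
    linarith)
  have h2 : 1 ≤ Real.log (1 / γ) / ε := by
    rw [le_div_iff₀ hε]
    linarith
  exact ⟨by linarith [Real.log_two_gt_d9], h2, Real.log_nonneg h2⟩

end QEntropy

end

/-! ### Assembly of the two algorithms -/

theorem theorem6 (δ : ℝ) (hδ0 : 0 < δ) (hδ1 : δ < 1) :
    (∃ C : ℝ, ∀ (n a b : ℕ) (γ ε : ℝ), 0 < γ → γ < 1 → 0 < ε →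
      ∃ alg : QEntropy.SamplingAlgorithm n a b,
        (alg.queries : ℝ) ≤ C * (1 / (γ * ε ^ 2) * Real.log (1 / γ) ^ 2
            * max 0 (Real.log (Real.log (1 / γ) / ε))) ∧
        ∀ (ρ σ : Matrix (QEntropy.Qubits n) (QEntropy.Qubits n) ℂ)
          (Uρ : QEntropy.Oracle n a) (Uσ : QEntropy.Oracle n b),
          QEntropy.ValidInput γ ρ σ Uρ Uσ →
            1 - δ ≤ alg.successProb Uρ Uσ (QEntropy.relEntropy ρ σ) ε) ∧
    (∃ C : ℝ, ∀ (n a b : ℕ) (γ ε : ℝ), 0 < γ → γ < 1 → 0 < ε →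
      ∃ alg : QEntropy.QueryAlgorithm n a b,
        (alg.queries : ℝ) ≤ C * (1 / (γ * ε) * Real.log (1 / γ)
            * max 0 (Real.log (Real.log (1 / γ) / ε))) ∧
        ∀ (ρ σ : Matrix (QEntropy.Qubits n) (QEntropy.Qubits n) ℂ)
          (Uρ : QEntropy.Oracle n a) (Uσ : QEntropy.Oracle n b),
          QEntropy.ValidInput γ ρ σ Uρ Uσ →
            1 - δ ≤ alg.successProb Uρ Uσ (QEntropy.relEntropy ρ σ) ε) := by
  constructor
  -- 4320 = 54·80 combines the cost of the tests with the bound on s·2^I; the other factor comes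
  -- from `h4` below.
  · refine ⟨4320 * (90 / δ + 1), fun n a b γ ε hγ0 hγ1 hε => ?_⟩
    have hL0 : 0 < Real.log (1 / γ) := Real.log_pos ((one_lt_div hγ0).2 hγ1)
    -- The bound vanishes when ln(1/γ) ≤ ε, so this regime requires an algorithm without queries.
    -- Outside it, ln(1/γ)/ε > 2 and ln(1/γ) ≥ 0.69.
    by_cases h : 1 / 2 < γ ∨ Real.log (1 / γ) ≤ 2 * ε
    · obtain ⟨d, hd⟩ := QEntropy.exists_constant_estimate n a b hγ0 hγ1 hε h
      obtain ⟨alg, hq, hp⟩ := QEntropy.SamplingAlgorithm.exists_const n a b d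
      refine ⟨alg, ?_, fun ρ σ Uρ Uσ hv => ?_⟩
      · rw [hq, Nat.cast_zero]
        positivity
      · rw [hp Uρ Uσ _ ε (hd ρ σ Uρ Uσ hv)]
        linarith
    · push Not at h
      obtain ⟨s, I, hs, hI, hbias, hcost⟩ := QEntropy.exists_truncation hγ0 h.1 hε h.2
      obtain ⟨p, q, hp, hq, hpq⟩ := QEntropy.exists_blockTests n a b s
      -- X is chosen so that the variance bound 9/X equals δε²/4.
      obtain ⟨k, v, hest, hk, hv⟩ := QEntropy.SamplingEst.of_blockTests (I := I) hs hp hq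
        (X := 36 / (δ * ε ^ 2)) (by positivity)
      obtain ⟨alg, hqu, hsucc⟩ := hest.exists_algorithm
      refine ⟨alg, ?_, fun ρ σ Uρ Uσ hin => hsucc Uρ Uσ _ ε δ hε
        ((hpq I γ ρ σ Uρ Uσ hγ0 hs hI hin).trans hbias) (hv.trans (le_of_eq ?_))⟩
      · rw [hqu]
        obtain ⟨h1, h2, h3⟩ := QEntropy.log_bounds hγ0 h.1 hε h.2
        set L := Real.log (1 / γ)
        set l := Real.log (L / ε)
        -- The factor L² is not needed by the construction: L ≥ 0.69 gives 36 ≤ 90 L², and the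
        -- rounding term 1 is at most (L/ε)².
        have h4 : 36 / (δ * ε ^ 2) + 1 ≤ (90 / δ + 1) * (L / ε) ^ 2 := by
          have h5 : 36 / (δ * ε ^ 2) ≤ 90 / δ * (L / ε) ^ 2 := by
            rw [div_pow, div_mul_div_comm]
            gcongr
            nlinarith
          have h6 : 1 ≤ (L / ε) ^ 2 := one_le_pow₀ h2
          linarith
        rw [max_eq_right h3]
        calc (k : ℝ) ≤ 54 * (s * 2 ^ I) * (36 / (δ * ε ^ 2) + 1) := hk
          _ ≤ 54 * (80 * (l / γ)) * ((90 / δ + 1) * (L / ε) ^ 2) := by gcongr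
          _ = _ := by
            field_simp
            ring
      · field_simp
        norm_num
  -- 69120 = 864·80, as in the sampling case; √δ appears because the error is now a root mean
  -- square.
  · refine ⟨69120 * (40 / √δ + 1), fun n a b γ ε hγ0 hγ1 hε => ?_⟩
    have hL0 : 0 < Real.log (1 / γ) := Real.log_pos ((one_lt_div hγ0).2 hγ1)
    by_cases h : 1 / 2 < γ ∨ Real.log (1 / γ) ≤ 2 * ε
    · obtain ⟨d, hd⟩ := QEntropy.exists_constant_estimate n a b hγ0 hγ1 hε h
      obtain ⟨alg, hq, hp⟩ := QEntropy.QueryAlgorithm.exists_const n a b d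
      refine ⟨alg, ?_, fun ρ σ Uρ Uσ hv => ?_⟩
      · rw [hq, Nat.cast_zero]
        positivity
      · rw [hp Uρ Uσ _ ε (hd ρ σ Uρ Uσ hv)]
        linarith
    · push Not at h
      obtain ⟨s, I, hs, hI, hbias, hcost⟩ := QEntropy.exists_truncation hγ0 h.1 hε h.2
      obtain ⟨p, q, hp, hq, hpq⟩ := QEntropy.exists_blockTests n a b s
      have hδ : 0 < √δ := Real.sqrt_pos.2 hδ0
      -- The error bound 12/X becomes √δ·ε/2, whose square is δε²/4.
      obtain ⟨k, e, hest, hk, he⟩ := QEntropy.CircuitEst.of_blockTests (I := I) hs hp hq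
        (X := 24 / (√δ * ε)) (by positivity)
      obtain ⟨alg, hqu, hsucc⟩ := hest.exists_algorithm
      have he2 : e ^ 2 ≤ δ * ε ^ 2 / 4 := by
        refine (pow_le_pow_left₀ hest.1 he 2).trans (le_of_eq ?_)
        rw [show 12 / (24 / (√δ * ε)) = √δ * ε / 2 by field_simp; norm_num, div_pow, mul_pow,
          Real.sq_sqrt hδ0.le]
        norm_num
      refine ⟨alg, ?_, fun ρ σ Uρ Uσ hin => hsucc Uρ Uσ _ ε δ hε
        ((hpq I γ ρ σ Uρ Uσ hγ0 hs hI hin).trans hbias) he2⟩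
      rw [hqu]
      obtain ⟨h1, h2, h3⟩ := QEntropy.log_bounds hγ0 h.1 hε h.2
      set L := Real.log (1 / γ)
      set l := Real.log (L / ε)
      have h4 : 24 / (√δ * ε) + 1 ≤ (40 / √δ + 1) * (L / ε) := by
        have h5 : 24 / (√δ * ε) ≤ 40 / √δ * (L / ε) := by
          rw [div_mul_div_comm]
          gcongr
          linarith
        linarith
      rw [max_eq_right h3]
      calc (k : ℝ) ≤ 864 * (s * 2 ^ I) * (24 / (√δ * ε) + 1) := hk
        _ ≤ 864 * (80 * (l / γ)) * ((40 / √δ + 1) * (L / ε)) := by gcongr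
        _ = _ := by
          field_simp
          ring
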